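/- For a graph $H$, the $k$th power $H^k$ is the graph on $V(H)$ in which two distinct vertices are adjacent if and only if their distance in $H$ is at most $k$. For $\varepsilon>0$, $0<p<1$ and nonnegative integers $a\le b$, an $n$-vertex graph $G$ is called $(\varepsilon,p,a,b)$-pseudorandom if $$\bigl|e(X,Y)-p|X||Y|\bigr|<\varepsilon p|X||Y|$$ for all disjoint $X,Y\subseteq V(G)$ with $|X|\ge\varepsilon p^a n$ and $|Y|\ge\varepsilon p^b n$, where $e(X,Y)$ is the number of edges between $X$ and $Y$. **Theorem.** For every integer $k\ge 2$ and all real $\beta>0$ and $0<\nu\le 1$ there is a constant $c>0$ such that the following holds for all $n$, all $\varepsilon>0$ with $\varepsilon\log^2 n\le c$, and all $0<p<1$. Let $G$ be an $n$-vertex graph with minimum degree $\delta(G)\ge\beta pn$. If $k=2$, suppose that $G$ is $(\varepsilon,p,1,2)$-pseudorandom; if $k>2$, suppose that $G$ is both $(\varepsilon,p,k-1,2k-1)$-pseudorandom and $(\varepsilon,p,k,k+1)$-pseudorandom. Then $G$ contains at least $$(1-\nu)^n\,p^{kn}\,n!$$ labelled copies of the $k$th power of a Hamilton cycle, that is, there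 are at least this many injective graph homomorphisms from $C_n^k$ to $G$, where $C_n$ is the cycle on $n$ vertices. -/

import Mathlib

namespace SimpleGraph

variable {V : Type*}

/-- The `k`th power of a graph `H`: two distinct vertices are adjacent iff their distance in `H`
is at most `k`.  (`edist` is the extended distance, `⊤` for vertices in different components.) -/
def kthPower (H : SimpleGraph V) (k : ℕ) : SimpleGraph V where
  Adj u v := u ≠ v ∧ H.edist u v ≤ (k : ℕ∞)
  symm := ⟨fun _ _ h => ⟨h.1.symm, by rw [edist_comm]; exact h.2⟩⟩
  loopless := ⟨fun _ h => h.1 rfl⟩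

/-- The `(ε, p, k, l)`-pseudorandomness of a graph on `n = |V|` vertices: for all disjoint vertex
sets `X`, `Y` with `|X| ≥ ε p^k n` and `|Y| ≥ ε p^l n`, the number `e(X, Y)` of edges between `X`
and `Y` satisfies `|e(X, Y) - p |X| |Y|| < ε p |X| |Y|`.  As `X` and `Y` are disjoint, every edge
between them is counted exactly once by `interedges`. -/
def IsPseudorandom [Fintype V] [DecidableEq V] (G : SimpleGraph V) [DecidableRel G.Adj]
    (ε p : ℝ) (k l : ℕ) : Prop :=
  ∀ X Y : Finset V, Disjoint X Y →
    ε * p ^ k * (Fintype.card V : ℝ) ≤ (X.card : ℝ) →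
    ε * p ^ l * (Fintype.card V : ℝ) ≤ (Y.card : ℝ) →
    |((G.interedges X Y).card : ℝ) - p * (X.card : ℝ) * (Y.card : ℝ)|
      < ε * p * (X.card : ℝ) * (Y.card : ℝ)

end SimpleGraph

/-! The proof is an absorption argument in which a greedy path supplies the count. If the scale of
pseudorandomness falls below single vertices, the graph is complete (`Dense.complete_or`) and the
bound is trivial. Otherwise pseudorandomness is used as one-sided regularity (`RgL`, `RgUp`): for a
given target set, only few vertices have too few, or too many, neighbours in it. A path is extended
vertex by vertex while its end block stays typical: every terminal sub-block of length `j ≤ k` keeps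
a share of order `p ^ j` of common neighbours in each set that will still be needed (`Typ`,
`RgL.exists_extension`).

Counting: if `u` vertices are uncovered, the greedy path has nearly `p ^ k * u` continuations.
Stopping when all but `O(θ)` vertices are covered, after `T` steps, gives at least `((1 - ν / 2) * p
^ k) ^ T * T!` words (`exists_greedyWords`). With `θ` of order `n / log n`, the missing factors of
`n!` amount to at most `exp (ν * T / 2)` (`factorial_bound`). Distinct words give distinct copies
(`card_le_labelledCopyCount`), so each word only has to be completed to one Hamilton cycle power.

Completion: a segment is prepared beforehand with a set of skippable vertices, any subset of which
can be left out without changing the ends (`Seg`, `Tool.exists_absorber`). Half of them, `R₁`,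
serves to cover the vertices left by the greedy path (`Tool.cover_all`); the other half, `R₂`,
serves to close the cycle; whatever is not used stays in the segment (`Tool.exists_cycle`).
Skippable vertices come from gadgets. For `k ≥ 3` a gadget is a `k`-path in the neighbourhood of
`r`, into whose middle `r` may be inserted; this is the purpose of `(k, k + 1)`-pseudorandomness.
For `k = 2` that is too expensive, and a gadget built around a seven-cycle is used (`SquareGadget`).

Connecting two typical end blocks (`exists_connection`) is the other main point. From either end,
almost all blocks in a fixed family of sets are reachable, so some block is reachable from both.
"Many" is a nested counting quantifier that depends on the order of the choices (`Many`); double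
counting with upper regularity permits reordering them (`Many.rot`, `Many.reverse`). Many
unreachable blocks yield many unreachable blocks one step earlier (`many_step`), and finally an
unreachable block adjacent to the end itself, which is absurd. This needs exponents up to `2 * k -
1`; for `k = 2` a hub vertex saves one power of `p` (`leftOK_two`). -/

set_option linter.unusedSectionVars false

universe u

/-! ### Common neighbourhoods and one-sided regularity -/

namespace PowHam

open Finset

variable {V : Type*} [DecidableEq V] (G : SimpleGraph V) [DecidableRel G.Adj]

/-- The common neighbours in `Z` of the vertices of the list `l`. -/
def nb (l : List V) (Z : Finset V) : Finset V := Z.filter fun z => ∀ a ∈ l, G.Adj a z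

variable {G}

lemma mem_nb {l : List V} {Z : Finset V} {z : V} :
    z ∈ nb G l Z ↔ z ∈ Z ∧ ∀ a ∈ l, G.Adj a z := by
  simp [nb]

lemma mem_nb_one {a : V} {Z : Finset V} {z : V} :
    z ∈ nb G [a] Z ↔ z ∈ Z ∧ G.Adj a z := by
  simp [nb]

@[simp] lemma nb_nil (Z : Finset V) : nb G [] Z = Z := by simp [nb]

lemma nb_cons (a : V) (l : List V) (Z : Finset V) : nb G (a :: l) Z = nb G [a] (nb G l Z) := by
  ext z; simp only [nb, mem_filter, List.forall_mem_cons, List.mem_singleton, forall_eq]; tauto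

lemma nb_subset (l : List V) (Z : Finset V) : nb G l Z ⊆ Z := filter_subset _ _

lemma nb_mono (l : List V) {Y Z : Finset V} (h : Y ⊆ Z) : nb G l Y ⊆ nb G l Z :=
  filter_subset_filter _ h

lemma nb_sdiff (l : List V) (Z X : Finset V) : nb G l (Z \ X) = nb G l Z \ X := by
  ext z; simp only [nb, mem_filter, mem_sdiff]; grind

lemma nb_congr {l m : List V} (h : ∀ a, a ∈ l ↔ a ∈ m) (Z : Finset V) : nb G l Z = nb G m Z := by
  ext z; simp [nb, h]

lemma card_nb_sdiff_le (l : List V) (Z X : Finset V) :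
    ((nb G l Z).card : ℝ) - X.card ≤ (nb G l (Z \ X)).card := by
  rw [nb_sdiff]
  have := Finset.le_card_sdiff X (nb G l Z)
  have h2 : (nb G l Z).card ≤ (nb G l Z \ X).card + X.card := by omega
  have : ((nb G l Z).card : ℝ) ≤ (nb G l Z \ X).card + X.card := by exact_mod_cast h2
  linarith

variable (G)

/-- Lower regularity: among any `x` vertices, some vertex has almost the expected degree into any
given set of `y` vertices. -/
def RgL (p η x y : ℝ) : Prop := ∀ X Y : Finset V, x ≤ X.card → y ≤ Y.card →
  ∃ v ∈ X, (1 - η) * p * Y.card ≤ (nb G [v] Y).card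

/-- Upper regularity: among any `x` vertices, some vertex has at most twice the expected degree
into any given disjoint set of at most `y` vertices. -/
def RgUp (p x y : ℝ) : Prop := ∀ X Y : Finset V, Disjoint X Y → x ≤ X.card → Y.card ≤ y →
  ∃ v ∈ X, (nb G [v] Y).card ≤ 2 * p * y

variable {G}

lemma RgL.mono {p η x y x' y' : ℝ} (h : RgL G p η x y) (hx : x ≤ x') (hy : y ≤ y') :
    RgL G p η x' y' := fun X Y hX hY => h X Y (hx.trans hX) (hy.trans hY)

/-- Otherwise the hypothesis, applied to the set of exceptional vertices itself, would produce an
unexceptional one in it. Regularity is mostly used in this form. -/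
lemma RgL.card_bad_lt {p η x y : ℝ} (h : RgL G p η x y) (X : Finset V) {Y : Finset V}
    (hY : y ≤ Y.card) :
    ((X.filter fun v => ¬ ((1 - η) * p * Y.card ≤ (nb G [v] Y).card)).card : ℝ) < x := by
  by_contra hc
  push Not at hc
  obtain ⟨v, hv, h1⟩ := h _ Y hc hY
  exact absurd h1 (not_le.2 (mem_filter.1 hv).2)

lemma RgUp.card_bad_lt {p x y : ℝ} (h : RgUp G p x y) {X Y : Finset V}
    (hd : Disjoint X Y) (hY : Y.card ≤ y) :
    ((X.filter fun v => ¬ ((nb G [v] Y).card ≤ 2 * p * y)).card : ℝ) < x := by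
  by_contra hc
  push Not at hc
  obtain ⟨v, hv, h1⟩ := h _ Y (disjoint_of_subset_left (filter_subset _ _) hd) hc hY
  exact absurd h1 (not_le.2 (mem_filter.1 hv).2)

lemma card_filter_and_ge {α : Type*} (X : Finset α) (P Q : α → Prop) [DecidablePred P]
    [DecidablePred Q] [DecidablePred fun v => P v ∧ Q v] {x y : ℝ}
    (hP : x ≤ (X.filter P).card) (hQ : ((X.filter fun v => ¬ Q v).card : ℝ) ≤ y) :
    x - y ≤ ((X.filter fun v => P v ∧ Q v).card : ℝ) := by
  classical
  have : X.filter P ⊆ (X.filter fun v => P v ∧ Q v) ∪ X.filter fun v => ¬ Q v := by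
    intro v; simp only [mem_filter, mem_union]; tauto
  have h2 := (card_le_card this).trans (card_union_le _ _)
  have h3 : ((X.filter P).card : ℝ) ≤ (X.filter fun v => P v ∧ Q v).card +
    (X.filter fun v => ¬ Q v).card := by exact_mod_cast h2
  linarith

/-- Picking a vertex that is good for finitely many sets at once. -/
lemma RgL.pick {p η x y : ℝ} (h : RgL G p η x y) (X : Finset V) (Ys : List (Finset V))
    (hY : ∀ Y ∈ Ys, y ≤ Y.card) :
    (X.card : ℝ) - Ys.length * x ≤
      ((X.filter fun v => ∀ Y ∈ Ys, (1 - η) * p * Y.card ≤ (nb G [v] Y).card).card : ℝ) := by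
  classical
  induction Ys with
  | nil => simp
  | cons Y Ys ih =>
    have h1 := ih fun Z hZ => hY Z (List.mem_cons_of_mem _ hZ)
    have h2 := h.card_bad_lt X (hY Y List.mem_cons_self)
    have h3 := card_filter_and_ge X _ _ h1 h2.le
    refine le_trans (le_of_eq ?_) (h3.trans (le_of_eq ?_))
    · push_cast [List.length_cons]; ring
    · congr 2
      ext v
      simp only [mem_filter, List.forall_mem_cons]
      tauto

/-- Disjoint subsets of prescribed sizes. -/
lemma exists_disjoint_subsets {ι : Type*} [Fintype ι] (A : ι → Finset V) (c : ι → ℕ)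
    (h : ∀ i, Fintype.card ι * c i ≤ (A i).card) :
    ∃ B : ι → Finset V, (∀ i, B i ⊆ A i) ∧ (∀ i, (B i).card = c i) ∧
      ∀ i j, i ≠ j → Disjoint (B i) (B j) := by
  classical
  -- Hall's condition after cloning each index `i` into `c i` copies: if `q` maximises `c` on `J`,
  -- then `J` has at most `card ι * c q.1` elements, and the single set `A q.1` is already that
  -- large.
  have key : ∀ J : Finset (Σ i : ι, Fin (c i)),
      J.card ≤ (J.biUnion fun q => A q.1).card := by
    intro J
    rcases J.eq_empty_or_nonempty with rfl | hJ
    · simp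
    obtain ⟨q, hq, hmax⟩ := J.exists_max_image (fun q => c q.1) hJ
    have h1 : J.card ≤ Fintype.card ι * c q.1 := by
      have hs : J ⊆ (univ : Finset ι).sigma
          (fun i => if c i ≤ c q.1 then (univ : Finset (Fin (c i))) else ∅) := by
        intro r hr
        simp [hmax r hr]
      refine (card_le_card hs).trans ?_
      rw [card_sigma]
      refine (sum_le_card_nsmul _ _ (c q.1) ?_).trans (by simp)
      intro i _
      split_ifs with hi
      · simpa using hi
      · simp
    exact h1.trans ((h q.1).trans (card_le_card (subset_biUnion_of_mem (fun q => A q.1) hq)))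
  obtain ⟨f, hf, hfA⟩ := (Finset.all_card_le_biUnion_card_iff_exists_injective
    (fun q : Σ i : ι, Fin (c i) => A q.1)).1 key
  refine ⟨fun i => univ.image fun x : Fin (c i) => f ⟨i, x⟩, ?_, ?_, ?_⟩
  · intro i v hv
    obtain ⟨x, -, rfl⟩ := mem_image.1 hv
    exact hfA ⟨i, x⟩
  · intro i
    rw [card_image_of_injective]
    · simp
    · intro x y hxy
      simpa using hf hxy
  · intro i j hij
    rw [disjoint_left]
    intro v hv hv'
    obtain ⟨x, -, rfl⟩ := mem_image.1 hv
    obtain ⟨y, -, hy⟩ := mem_image.1 hv'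
    have := hf hy
    exact hij (congrArg Sigma.fst this).symm

end PowHam

/-! ### Paths, segments with skippable vertices, typical end blocks -/

namespace PowHam

open Finset

variable {V : Type*} [DecidableEq V] (G : SimpleGraph V) [DecidableRel G.Adj]

/-- Consecutive entries of `l` at distance at most `k` are adjacent. -/
def KPath (k : ℕ) (l : List V) : Prop :=
  ∀ i j a b, i < j → j ≤ i + k → l[i]? = some a → l[j]? = some b → G.Adj a b

variable {G} {k : ℕ}

lemma KPath.mono {k' : ℕ} {l : List V} (h : KPath G k l) (hk : k' ≤ k) : KPath G k' l :=
  fun i j a b hij hj => h i j a b hij (by omega)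

lemma kPath_nil : KPath G k [] := by intro i j a b _ _ h; simp at h

lemma KPath.left {l m : List V} (h : KPath G k (l ++ m)) : KPath G k l := by
  intro i j a b hij hj ha hb
  have hi := (List.getElem?_eq_some_iff.1 ha).1
  have hj' := (List.getElem?_eq_some_iff.1 hb).1
  exact h i j a b hij hj (by rw [List.getElem?_append_left hi, ha])
    (by rw [List.getElem?_append_left hj', hb])

lemma KPath.right {l m : List V} (h : KPath G k (l ++ m)) : KPath G k m := by
  intro i j a b hij hj ha hb
  refine h (l.length + i) (l.length + j) a b (by omega) (by omega) ?_ ?_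
  · rw [List.getElem?_append_right (by omega)]; simpa using ha
  · rw [List.getElem?_append_right (by omega)]; simpa using hb

lemma KPath.infix {l m : List V} (h : KPath G k l) (hm : m <:+: l) : KPath G k m := by
  obtain ⟨a, b, rfl⟩ := hm
  exact h.left.right

lemma KPath.reverse {l : List V} (h : KPath G k l) : KPath G k l.reverse := by
  intro i j a b hij hj ha hb
  have hi := (List.getElem?_eq_some_iff.1 ha).1
  have hj' := (List.getElem?_eq_some_iff.1 hb).1
  rw [List.length_reverse] at hi hj'
  rw [List.getElem?_reverse hi] at ha
  rw [List.getElem?_reverse hj'] at hb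
  exact (h _ _ b a (by omega) (by omega) hb ha).symm

lemma kPath_reverse {l : List V} : KPath G k l.reverse ↔ KPath G k l :=
  ⟨fun h => by simpa using h.reverse, KPath.reverse⟩

/-- Constrained positions are at most `k` apart, so they cannot lie on different sides of a block of
length at least `k`; each constraint is seen by one of the two lists. -/
lemma KPath.glue {l t m : List V} (h₁ : KPath G k (l ++ t)) (h₂ : KPath G k (t ++ m))
    (ht : k ≤ t.length) : KPath G k (l ++ t ++ m) := by
  intro i j a b hij hj ha hb
  by_cases hjt : j < (l ++ t).length
  · rw [List.getElem?_append_left hjt] at hb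
    rw [List.getElem?_append_left (by omega)] at ha
    exact h₁ i j a b hij hj ha hb
  · rw [List.length_append] at hjt
    rw [List.append_assoc, List.getElem?_append_right (by omega)] at ha hb
    exact h₂ _ _ a b (by omega) (by omega) ha hb

lemma KPath.cons {l : List V} {z : V} (h : KPath G k l) (hz : ∀ a ∈ l.take k, G.Adj a z) :
    KPath G k (z :: l) := by
  intro i j a b hij hj ha hb
  obtain ⟨j, rfl⟩ : ∃ j', j = j' + 1 := ⟨j - 1, by omega⟩
  rw [List.getElem?_cons_succ] at hb
  rcases i with _ | i
  · rw [List.getElem?_cons_zero, Option.some_inj] at ha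
    subst ha
    refine (hz b ?_).symm
    apply List.mem_of_getElem? (i := j)
    rw [List.getElem?_take, if_pos (by omega), hb]
  · rw [List.getElem?_cons_succ] at ha
    exact h i j a b (by omega) (by omega) ha hb

lemma KPath.adj_of_cons {l : List V} {z : V} (h : KPath G k (z :: l)) :
    ∀ a ∈ l.take k, G.Adj a z := by
  intro a ha
  obtain ⟨i, hi, rfl⟩ := List.mem_iff_getElem.1 ha
  rw [List.length_take] at hi
  refine (h 0 (i + 1) z _ (by omega) (by omega) rfl ?_).symm
  rw [List.getElem?_cons_succ, List.getElem?_eq_getElem (by omega)]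
  simp

lemma KPath.of_pairwise {l : List V} (h : l.Pairwise G.Adj) : KPath G k l := by
  intro i j a b hij _ ha hb
  obtain ⟨hi, rfl⟩ := List.getElem?_eq_some_iff.1 ha
  obtain ⟨hj, rfl⟩ := List.getElem?_eq_some_iff.1 hb
  exact List.pairwise_iff_getElem.1 h i j hi hj hij

variable (G)

/-- A flexible path segment: for every set `R' ⊆ R` of vertices to be skipped there is a `k`-path
on exactly `S \ R'`, whose first `k` vertices are `s`, whose last `k` vertices, read from the end,
are `e`, and which contains `w` as a contiguous block. -/
structure Seg (k : ℕ) (S R : Finset V) (s e w : List V) : Prop where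
  sub : R ⊆ S
  len_s : s.length = k
  len_e : e.length = k
  real : ∀ R' ⊆ R, ∃ l : List V, l.Nodup ∧ KPath G k l ∧ l.toFinset = S \ R' ∧ l.take k = s ∧
    l.reverse.take k = e ∧ w <:+: l

variable {G}

lemma Seg.of_list {l w : List V} (hl : KPath G k l) (hn : l.Nodup) (hk : k ≤ l.length)
    (hw : w <:+: l) : Seg G k l.toFinset ∅ (l.take k) (l.reverse.take k) w where
  sub := empty_subset _
  len_s := by simp [hk]
  len_e := by simp [hk]
  real R' hR' := ⟨l, hn, hl, by rw [subset_empty.1 hR', sdiff_empty], rfl, rfl, hw⟩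

lemma Seg.reverse {S R : Finset V} {s e w : List V} (h : Seg G k S R s e w) :
    Seg G k S R e s w.reverse where
  sub := h.sub
  len_s := h.len_e
  len_e := h.len_s
  real R' hR' := by
    obtain ⟨l, h1, h2, h3, h4, h5, h6⟩ := h.real R' hR'
    exact ⟨l.reverse, List.nodup_reverse.2 h1, h2.reverse, by simpa using h3, h5, by simpa using h4,
      List.reverse_infix.2 h6⟩

lemma KPath.join {l m : List V} (hl : KPath G k l) (hm : KPath G k m) (hkl : k ≤ l.length)
    (hkm : k ≤ m.length) (h : KPath G k ((l.reverse.take k).reverse ++ m.take k)) :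
    KPath G k (l ++ m) := by
  have e1 : l = l.take (l.length - k) ++ (l.reverse.take k).reverse := by
    rw [List.take_reverse, List.reverse_reverse, List.take_append_drop]
  have e2 : m = m.take k ++ m.drop k := (List.take_append_drop k m).symm
  rw [e1] at hl
  rw [e2] at hm
  have h1 := hl.glue h (by simp [hkl])
  have h2 := h1.glue hm (by simp [hkm])
  rwa [← e1, List.append_assoc, ← e2] at h2

/-- The first segment is told to skip the overlap, so vertices that it may skip can be spent by the
second. They remain skippable only if the second segment may skip them. This is what allows a pool
of skippable vertices to be used for later connections. -/
lemma Seg.concat {S₁ R₁ S₂ R₂ : Finset V} {s₁ e₁ s₂ e₂ w : List V} (h₁ : Seg G k S₁ R₁ s₁ e₁ w)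
    (h₂ : Seg G k S₂ R₂ s₂ e₂ []) (hS : S₁ ∩ S₂ ⊆ R₁) (hj : KPath G k (e₁.reverse ++ s₂)) :
    Seg G k (S₁ ∪ S₂) ((R₁ \ S₂) ∪ R₂) s₁ e₂ w where
  sub := union_subset_union (sdiff_subset.trans h₁.sub) h₂.sub
  len_s := h₁.len_s
  len_e := h₂.len_e
  real R' hR' := by
    obtain ⟨l, a1, a2, a3, a4, a5, a6⟩ := h₁.real ((R' ∩ S₁) ∪ (S₁ ∩ S₂)) (by
      have := h₂.sub
      intro x hx
      have := @hR' x
      have := @hS x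
      grind)
    obtain ⟨m, b1, b2, b3, b4, b5, b6⟩ := h₂.real (R' ∩ S₂) (by
      intro x hx
      have := @hR' x
      grind)
    have hkl : k ≤ l.length := by
      have := h₁.len_s; rw [← a4, List.length_take] at this; omega
    have hkm : k ≤ m.length := by
      have := h₂.len_s; rw [← b4, List.length_take] at this; omega
    refine ⟨l ++ m, ?_, ?_, ?_, ?_, ?_, ?_⟩
    · rw [List.nodup_append']
      refine ⟨a1, b1, ?_⟩
      intro x hx hx'
      have h1 : x ∈ l.toFinset := List.mem_toFinset.2 hx
      have h2 : x ∈ m.toFinset := List.mem_toFinset.2 hx'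
      rw [a3] at h1
      rw [b3] at h2
      simp only [mem_sdiff, mem_union, mem_inter] at h1 h2
      tauto
    · exact a2.join b2 hkl hkm (by rwa [a5, b4])
    · rw [List.toFinset_append, a3, b3]
      ext x
      simp only [mem_sdiff, mem_union, mem_inter]
      tauto
    · rw [List.take_append_of_le_length hkl, a4]
    · rw [List.reverse_append, List.take_append_of_le_length (by simpa using hkm), b5]
    · exact a6.trans (List.infix_append' [] l m)

lemma Seg.snoc {S R : Finset V} {s e w : List V} {z : V} (h : Seg G k S R s e w)
    (hz : z ∈ S → z ∈ R) (ha : ∀ a ∈ e, G.Adj a z) :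
    Seg G k (S ∪ {z}) (R \ {z}) s ((z :: e).take k) w where
  sub := by
    have := h.sub
    intro x hx
    have := @this x
    grind
  len_s := h.len_s
  len_e := by simp [h.len_e]
  real R' hR' := by
    obtain ⟨l, a1, a2, a3, a4, a5, a6⟩ := h.real (R' ∪ (S ∩ {z})) (by
      intro x hx
      have := @hR' x
      grind)
    have hkl : k ≤ l.length := by
      have := h.len_s; rw [← a4, List.length_take] at this; omega
    have hR'z : z ∉ R' := fun hz' => by
      have := hR' hz'
      simp at this
    refine ⟨l ++ [z], ?_, ?_, ?_, ?_, ?_, ?_⟩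
    · rw [List.nodup_append']
      refine ⟨a1, List.nodup_singleton z, ?_⟩
      intro x hx hx'
      rw [List.mem_singleton] at hx'
      subst hx'
      have h1 : x ∈ l.toFinset := List.mem_toFinset.2 hx
      rw [a3] at h1
      simp only [mem_sdiff, mem_union, mem_inter, mem_singleton] at h1
      tauto
    · rw [← kPath_reverse, List.reverse_append]
      exact a2.reverse.cons (by rwa [a5])
    · rw [List.toFinset_append, a3]
      ext x
      simp only [mem_sdiff, mem_union, mem_inter, List.mem_toFinset, List.mem_singleton,
        mem_singleton]
      by_cases hx : x = z
      · subst hx; tauto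
      · tauto
    · rw [List.take_append_of_le_length hkl, a4]
    · rw [List.reverse_append, ← a5]
      simp only [List.reverse_singleton, List.singleton_append]
      rcases k with _ | k
      · simp
      · simp [List.take_take]
    · exact a6.trans (List.infix_append' [] l [z])

/-- The connector `c` is a rigid segment, and two concatenations suffice: as `k ≤ c.length`, each
junction involves only one end block and one end of `c`. -/
lemma Seg.link {S₁ R₁ S₂ R₂ : Finset V} {s₁ e₁ s₂ e₂ w c : List V} (h₁ : Seg G k S₁ R₁ s₁ e₁ w)
    (h₂ : Seg G k S₂ R₂ s₂ e₂ []) (hc : c.Nodup) (hkc : k ≤ c.length)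
    (hj : KPath G k (e₁.reverse ++ c ++ s₂)) (hS : S₁ ∩ S₂ ⊆ R₁) (hS₁ : S₁ ∩ c.toFinset ⊆ R₁)
    (hS₂ : Disjoint c.toFinset S₂) :
    Seg G k (S₁ ∪ c.toFinset ∪ S₂) ((R₁ \ (c.toFinset ∪ S₂)) ∪ R₂) s₁ e₂ w := by
  have hC : Seg G k c.toFinset ∅ (c.take k) (c.reverse.take k) [] :=
    Seg.of_list hj.left.right hc hkc (List.nil_infix)
  have h3 := h₁.concat hC hS₁ (hj.infix ⟨[], c.drop k ++ s₂, by
    simp only [List.nil_append, List.append_assoc]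
    rw [← List.append_assoc (List.take k c), List.take_append_drop]⟩)
  have h4 := h3.concat h₂ (by
    intro x hx
    have := @hS x
    have := @hS₁ x
    have h5 : x ∈ c.toFinset → x ∉ S₂ := fun h => disjoint_left.1 hS₂ h
    grind) (by
    refine hj.infix ⟨e₁.reverse ++ c.take (c.length - k), [], ?_⟩
    rw [List.take_reverse, List.reverse_reverse]
    simp only [List.append_nil, List.append_assoc]
    rw [← List.append_assoc (List.take _ _), List.take_append_drop])
  have e : (R₁ \ c.toFinset ∪ ∅) \ S₂ ∪ R₂ = (R₁ \ (c.toFinset ∪ S₂)) ∪ R₂ := by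
    ext x; simp only [mem_sdiff, mem_union, notMem_empty, or_false]; tauto
  rwa [e] at h4

/-- Every end block of length `j ≤ k` has at least `θ p ^ j` common neighbours in `Z`. -/
def Typ (G : SimpleGraph V) [DecidableRel G.Adj] (p : ℝ) (k : ℕ) (θ : ℝ) (l : List V)
    (Z : Finset V) : Prop :=
  ∀ j ≤ k, θ * p ^ j ≤ (nb G (l.take j) Z).card

lemma Typ.mono {p θ θ' : ℝ} {l : List V} {Z Z' : Finset V} (hp : 0 ≤ p) (h : Typ G p k θ l Z)
    (hθ : θ' ≤ θ) (hZ : Z ⊆ Z') : Typ G p k θ' l Z' := fun j hj =>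
  (mul_le_mul_of_nonneg_right hθ (by positivity)).trans
    ((h j hj).trans (by exact_mod_cast card_le_card (nb_mono _ hZ)))

/-- As `p ≤ 1`, the requirement is tightest at `j = k`; deleting at most half of the bound there
costs a factor two for all `j`. -/
lemma Typ.sdiff {p θ : ℝ} {l : List V} {Z X : Finset V} (hp : 0 < p) (hp1 : p ≤ 1) (hθ : 0 ≤ θ)
    (h : Typ G p k θ l Z) (hX : (X.card : ℝ) ≤ θ / 2 * p ^ k) : Typ G p k (θ / 2) l (Z \ X) := by
  intro j hj
  have h1 := card_nb_sdiff_le (G := G) (l.take j) Z X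
  have h2 := h j hj
  have h3 : θ / 2 * p ^ k ≤ θ / 2 * p ^ j :=
    mul_le_mul_of_nonneg_left (pow_le_pow_of_le_one hp.le hp1 hj) (by linarith)
  linarith

lemma Typ.take {p θ : ℝ} {l : List V} {Z : Finset V} (h : Typ G p k θ l Z) :
    Typ G p k θ (l.take k) Z := fun j hj => by
  rw [List.take_take, min_eq_left hj]; exact h j hj

end PowHam

/-! ### Regularity over a range of exponents and nested counting of choices -/

namespace PowHam

open Finset

variable {V : Type*} [DecidableEq V] (G : SimpleGraph V) [DecidableRel G.Adj]

/-- Exponent pairs covered by `(k - 1, b)`-pseudorandomness. -/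
def Adm (k b u v : ℕ) : Prop := (u + 1 ≤ k ∧ v ≤ b) ∨ (v + 1 ≤ k ∧ u ≤ b)

/-- Regularity of `G` at scale `σ` for all pairs of exponents admissible for `(k - 1, b)`. -/
structure Reg (k b : ℕ) (p σ N : ℝ) : Prop where
  p_pos : 0 < p
  p_le : p ≤ 1
  σ_pos : 0 < σ
  big : 1 ≤ σ * p ^ b
  k_le : k ≤ b
  two_le : 2 ≤ k
  lower : ∀ u v, Adm k b u v → RgL G p (1 / 2) (σ * p ^ u) (σ * p ^ v)
  upper : ∀ u v, Adm k b u v → ∀ y, σ * p ^ v ≤ y → y ≤ N → RgUp G p (σ * p ^ u) y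

open Classical in
/-- Many ways to choose vertices from the sets in the list one after the other, each adjacent to
all previous ones (collected in the context), so that the result satisfies `Q`. -/
noncomputable def Many (p c : ℝ) (Q : List V → Prop) :
    List (Finset V × ℕ) → List V → Prop
  | [], ctx => Q ctx
  | A :: L, ctx => c * p ^ (A.2 + ctx.length) ≤
      (((nb G ctx A.1).filter fun z => Many p c Q L (z :: ctx)).card : ℝ)

/-- The lists that can be obtained by choosing from the sets in the list one after the other. -/
def Chosen : List (Finset V × ℕ) → List V → List V → Prop
  | [], ctx, τ => τ = ctx
  | A :: L, ctx, τ => ∃ z ∈ nb G ctx A.1, Chosen L (z :: ctx) τ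

variable {G} {k b : ℕ} {p σ N c c' : ℝ} {Q Q' : List V → Prop}

lemma many_append (L₁ L₂ : List (Finset V × ℕ)) (ctx : List V) :
    Many G p c Q (L₁ ++ L₂) ctx ↔ Many G p c (Many G p c Q L₂) L₁ ctx := by
  classical
  induction L₁ generalizing ctx with
  | nil => simp [Many]
  | cons A L₁ ih =>
    rw [List.cons_append, Many, Many]
    rw [filter_congr fun z _ => ih (z :: ctx)]

lemma Many.mono (hp : 0 ≤ p) (hc : c' ≤ c) {L : List (Finset V × ℕ)} {ctx ctx' : List V}
    (hctx : ctx.Perm ctx')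
    (hQ : ∀ t, t.length = L.length → Q (t ++ ctx) → Q' (t ++ ctx'))
    (h : Many G p c Q L ctx) : Many G p c' Q' L ctx' := by
  classical
  induction L generalizing ctx ctx' with
  | nil => exact hQ [] rfl h
  | cons A L ih =>
    rw [Many] at h ⊢
    rw [← hctx.length_eq, ← nb_congr (G := G) (fun a => hctx.mem_iff)]
    refine (mul_le_mul_of_nonneg_right hc (by positivity)).trans (h.trans ?_)
    norm_cast
    refine card_le_card fun z hz => ?_
    rw [mem_filter] at hz ⊢
    refine ⟨hz.1, ih (hctx.cons z) (fun t ht hq => ?_) hz.2⟩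
    have := hQ (t ++ [z]) (by simp [ht]) (by simpa using hq)
    simpa using this

lemma Many.exists_chosen (hp : 0 < p) (hc : 0 < c) {L : List (Finset V × ℕ)} {ctx : List V}
    (h : Many G p c Q L ctx) : ∃ τ, Chosen G L ctx τ ∧ Q τ := by
  classical
  induction L generalizing ctx with
  | nil => exact ⟨ctx, rfl, h⟩
  | cons A L ih =>
    rw [Many] at h
    have h1 : (0 : ℝ) < c * p ^ (A.2 + ctx.length) := by positivity
    have h2 := h1.trans_le h
    obtain ⟨z, hz⟩ := card_pos.1 (Nat.cast_pos.1 h2)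
    rw [mem_filter] at hz
    obtain ⟨τ, h3, h4⟩ := ih hz.2
    exact ⟨τ, ⟨z, hz.1, h3⟩, h4⟩

/-- Pigeonhole at each level: one of the two alternatives is kept by at least half of the
candidates. -/
lemma Many.or (hp : 0 ≤ p) (hc : 0 ≤ c) {L : List (Finset V × ℕ)} {ctx : List V}
    (h : Many G p c (fun τ => Q τ ∨ Q' τ) L ctx) :
    Many G p (c / 2 ^ L.length) Q L ctx ∨ Many G p (c / 2 ^ L.length) Q' L ctx := by
  classical
  induction L generalizing ctx with
  | nil => exact h
  | cons A L ih =>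
    simp only [Many] at h ⊢
    set F := (nb G ctx A.1).filter fun z => Many G p c (fun τ => Q τ ∨ Q' τ) L (z :: ctx)
    have hle : c / 2 ^ (A :: L).length ≤ c / 2 ^ L.length := by
      apply div_le_div_of_nonneg_left hc (by positivity)
      exact pow_le_pow_right₀ (by norm_num) (by simp)
    have hsub : F ⊆ ((nb G ctx A.1).filter fun z =>
        Many G p (c / 2 ^ (A :: L).length) Q L (z :: ctx)) ∪ ((nb G ctx A.1).filter fun z =>
        Many G p (c / 2 ^ (A :: L).length) Q' L (z :: ctx)) := by
      intro z hz
      rw [mem_filter] at hz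
      rw [mem_union, mem_filter, mem_filter]
      rcases ih hz.2 with h1 | h1
      · exact Or.inl ⟨hz.1, h1.mono hp hle (List.Perm.refl _) (fun _ _ => id)⟩
      · exact Or.inr ⟨hz.1, h1.mono hp hle (List.Perm.refl _) (fun _ _ => id)⟩
    have h2 := (card_le_card hsub).trans (card_union_le _ _)
    have h3 := (Nat.cast_le (α := ℝ)).2 h2
    push_cast at h3
    have h4 : c / 2 ^ (A :: L).length * p ^ (A.2 + ctx.length) ≤
        c * p ^ (A.2 + ctx.length) / 2 := by
      rw [List.length_cons, pow_succ, mul_div_right_comm]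
      refine mul_le_mul_of_nonneg_right ?_ (by positivity)
      refine div_le_div_of_nonneg_left hc (by positivity) ?_
      have : (1 : ℝ) ≤ 2 ^ L.length := one_le_pow₀ (by norm_num)
      linarith
    by_contra hcon
    rw [not_or, not_le, not_le] at hcon
    linarith [hcon.1, hcon.2]

/-- The choices may be assumed to have the expected number of common neighbours in `W`. -/
lemma Many.typ (hR : Reg G k b p σ N) {W : Finset V} {h : ℕ} {w : ℝ}
    {L : List (Finset V × ℕ)} {ctx : List V}
    (hadm : ∀ i B, L[i]? = some B → Adm k b (B.2 + ctx.length + i) (h + ctx.length + i))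
    (hc : σ ≤ c / 2) (hw : σ ≤ w / 2 ^ L.length)
    (hW : w * p ^ (h + ctx.length) ≤ (nb G ctx W).card) (hM : Many G p c Q L ctx) :
    Many G p (c / 2) (fun τ => Q τ ∧
      w / 2 ^ L.length * p ^ (h + ctx.length + L.length) ≤ (nb G τ W).card) L ctx := by
  classical
  induction L generalizing ctx w with
  | nil => exact ⟨hM, by simpa using hW⟩
  | cons A L ih =>
    have hp := hR.p_pos
    rw [Many] at hM ⊢
    have hσw : σ ≤ w := by
      refine hw.trans (div_le_self ?_ (one_le_pow₀ (by norm_num)))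
      have := hR.σ_pos.le.trans hw
      by_contra hneg
      exact absurd this (not_le.2 (div_neg_of_neg_of_pos (not_le.1 hneg) (by positivity)))
    have h0 := hadm 0 A rfl
    simp only [add_zero] at h0
    -- Candidates that do not keep half of the expected share of the neighbourhood in `W` number
    -- fewer than `σ * p ^ _`, at most half of the available ones.
    have hbad := (hR.lower _ _ h0).card_bad_lt (nb G ctx A.1) (Y := nb G ctx W)
      ((mul_le_mul_of_nonneg_right hσw (by positivity)).trans hW)
    have h1 := card_filter_and_ge (nb G ctx A.1) _ _ hM hbad.le
    have h2 : c / 2 * p ^ (A.2 + ctx.length) ≤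
        c * p ^ (A.2 + ctx.length) - σ * p ^ (A.2 + ctx.length) := by
      rw [← sub_mul]
      exact mul_le_mul_of_nonneg_right (by linarith) (by positivity)
    refine h2.trans (h1.trans (Nat.cast_le.2 ?_))
    refine card_le_card fun z hz => ?_
    rw [mem_filter] at hz ⊢
    obtain ⟨hz1, hz2, hz3⟩ := hz
    refine ⟨hz1, ?_⟩
    have e1 : w / 2 / 2 ^ L.length = w / 2 ^ (A :: L).length := by
      rw [List.length_cons, pow_succ, div_div, mul_comm]
    have := ih (ctx := z :: ctx) (w := w / 2) (fun i B hB => ?_) (by rw [e1]; exact hw) ?_ hz2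
    · refine this.mono hp.le le_rfl (List.Perm.refl _) fun t ht hq => ⟨hq.1, ?_⟩
      refine le_trans (le_of_eq ?_) hq.2
      rw [e1, List.length_cons, List.length_cons,
        show h + ctx.length + (L.length + 1) = h + (ctx.length + 1) + L.length by omega]
    · have := hadm (i + 1) B (by simpa using hB)
      rw [List.length_cons, show B.2 + (ctx.length + 1) + i = B.2 + ctx.length + (i + 1) by omega,
        show h + (ctx.length + 1) + i = h + ctx.length + (i + 1) by omega]
      exact this
    · rw [nb_cons]
      refine le_trans ?_ hz3
      rw [List.length_cons, ← add_assoc, pow_succ]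
      have : 0 ≤ p := hp.le
      nlinarith
  
/-- Choosing greedily from large sets. -/
lemma many_true (hR : Reg G k b p σ N) {L : List (Finset V × ℕ)} {ctx : List V} {w : ℝ}
    (hadm : ∀ B ∈ L, B.2 = 0) (hlen : ctx.length + L.length ≤ k)
    (hw : σ * (k + 1) ≤ w / 2 ^ L.length)
    (hL : ∀ B ∈ L, w * p ^ ctx.length ≤ (nb G ctx B.1).card) :
    Many G p (w / 2 ^ L.length) (fun _ => True) L ctx := by
  classical
  induction L generalizing ctx w with
  | nil => trivial
  | cons A L ih =>
    have hp := hR.p_pos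
    have hσ := hR.σ_pos
    have hkb := hR.k_le
    rw [Many]
    have hw0 : 0 ≤ w := by
      have h1 : 0 ≤ w / 2 ^ (A :: L).length := le_trans (by positivity) hw
      by_contra hneg
      exact absurd h1 (not_le.2 (div_neg_of_neg_of_pos (not_le.1 hneg) (by positivity)))
    have hww : w / 2 ^ (A :: L).length ≤ w / 2 := by
      refine div_le_div_of_nonneg_left hw0 (by norm_num) ?_
      rw [List.length_cons, pow_succ]
      have : (1 : ℝ) ≤ 2 ^ L.length := one_le_pow₀ (by norm_num)
      linarith
    rw [List.length_cons] at hlen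
    have hkr : ((L.length : ℝ) + 1) ≤ k := by exact_mod_cast (by omega : L.length + 1 ≤ k)
    have hσw : σ * k ≤ w / 2 := by nlinarith
    have hA : A.2 = 0 := hadm A List.mem_cons_self
    -- The chosen vertex must serve all later sets at once; there are fewer than `k` of these, and
    -- each excludes at most `σ * p ^ ctx.length` candidates.
    have hpick := (hR.lower ctx.length ctx.length (Or.inl ⟨by omega, by omega⟩)).pick
      (nb G ctx A.1) (L.map fun B => nb G ctx B.1) (by
        intro Y hY
        obtain ⟨B, hB, rfl⟩ := List.mem_map.1 hY
        refine le_trans ?_ (hL B (List.mem_cons_of_mem _ hB))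
        refine mul_le_mul_of_nonneg_right ?_ (by positivity)
        nlinarith)
    have hA2 := hL A List.mem_cons_self
    rw [hA, zero_add]
    have h1 : w / 2 ^ (A :: L).length * p ^ ctx.length ≤ (nb G ctx A.1).card -
        (L.map fun B => nb G ctx B.1).length * (σ * p ^ ctx.length) := by
      rw [List.length_map]
      have h3 : (w / 2 ^ (A :: L).length + L.length * σ) * p ^ ctx.length ≤ w * p ^ ctx.length := by
        refine mul_le_mul_of_nonneg_right ?_ (by positivity)
        nlinarith
      nlinarith
    refine h1.trans (hpick.trans (Nat.cast_le.2 ?_))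
    refine card_le_card fun z hz => ?_
    rw [mem_filter] at hz ⊢
    refine ⟨hz.1, ?_⟩
    have e1 : w / 2 / 2 ^ L.length = w / 2 ^ (A :: L).length := by
      rw [List.length_cons, pow_succ, div_div, mul_comm]
    rw [← e1]
    refine ih (fun B hB => hadm B (List.mem_cons_of_mem _ hB)) (by rw [List.length_cons]; omega)
      (by rw [e1]; exact hw) fun B hB => ?_
    have h4 := hz.2 _ (List.mem_map.2 ⟨B, hB, rfl⟩)
    have h5 := hL B (List.mem_cons_of_mem _ hB)
    rw [nb_cons, List.length_cons, pow_succ]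
    refine le_trans ?_ h4
    nlinarith

/-- The core of exchanging two consecutive choices. -/
lemma swap_core {F A : Finset V} (hd : Disjoint F A) (S : V → V → Prop) [∀ a b, Decidable (S a b)]
    {x α β β₁ M : ℝ}
    (hp : 0 < p) (hα : 0 < α) (hβ : 0 < β) (hβ₁ : 0 ≤ β₁)
    (hF : β ≤ F.card) (h : ∀ b ∈ F, p * α ≤ (A.filter fun a => G.Adj b a ∧ S b a).card)
    (hA : A.card ≤ M) (hx : x ≤ β / 2) (hUp : RgUp G p x (α / 8)) (hM : β₁ * M ≤ β * (p * α) / 4) :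
    α / 8 ≤ (A.filter fun a => β₁ ≤ (F.filter fun b => G.Adj b a ∧ S b a).card).card := by
  classical
  by_contra hcon
  rw [not_le] at hcon
  -- `A'` collects the vertices of `A` with many partners. If it were small, upper regularity would
  -- leave `β / 2` vertices of `F` with at most `p * α / 4` neighbours in `A'`, hence with `3 / 4 *
  -- (p * α)` partners outside. But vertices outside `A'` have fewer than `β₁` partners each, and
  -- the two counts of pairs conflict.
  set A' := A.filter fun a => β₁ ≤ (F.filter fun b => G.Adj b a ∧ S b a).card with hA'
  have hbad := hUp.card_bad_lt (X := F) (Y := A')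
    (disjoint_of_subset_right (filter_subset _ _) hd) hcon.le
  set F' := F.filter fun v => ((nb G [v] A').card : ℝ) ≤ 2 * p * (α / 8) with hF'
  have hF'c : β / 2 ≤ F'.card := by
    have h1 := card_filter_add_card_filter_not (s := F) (fun v => ((nb G [v] A').card : ℝ) ≤ 2 * p * (α / 8))
    have h2 : (F.card : ℝ) = F'.card + (F.filter fun v => ¬ ((nb G [v] A').card : ℝ) ≤ 2 * p * (α / 8)).card := by
      exact_mod_cast h1.symm
    linarith
  have hdc := sum_card_bipartiteAbove_eq_sum_card_bipartiteBelow (s := F') (t := A \ A')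
    (fun b a => G.Adj b a ∧ S b a)
  have hlow : (β / 2) * (3 / 4 * (p * α)) ≤
      ((∑ b ∈ F', (bipartiteAbove (fun b a => G.Adj b a ∧ S b a) (A \ A') b).card : ℕ) : ℝ) := by
    push_cast
    refine le_trans (mul_le_mul_of_nonneg_right hF'c (by positivity)) ?_
    rw [← nsmul_eq_mul]
    refine card_nsmul_le_sum _ _ _ fun b hb => ?_
    rw [hF', mem_filter] at hb
    have h1 := h b hb.1
    have h2 : (A.filter fun a => G.Adj b a ∧ S b a) ⊆
        bipartiteAbove (fun b a => G.Adj b a ∧ S b a) (A \ A') b ∪ nb G [b] A' := by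
      intro a ha
      simp only [bipartiteAbove, mem_union, mem_filter, mem_sdiff, mem_nb_one] at ha ⊢
      tauto
    have h3 := (card_le_card h2).trans (card_union_le _ _)
    have h4 : ((A.filter fun a => G.Adj b a ∧ S b a).card : ℝ) ≤
      (bipartiteAbove (fun b a => G.Adj b a ∧ S b a) (A \ A') b).card + (nb G [b] A').card := by
      exact_mod_cast h3
    linarith [hb.2]
  have hupp : ((∑ a ∈ A \ A', (bipartiteBelow (fun b a => G.Adj b a ∧ S b a) F' a).card : ℕ) : ℝ) ≤
      β₁ * M := by
    push_cast
    refine (sum_le_card_nsmul _ _ β₁ fun a ha => ?_).trans ?_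
    · rw [mem_sdiff, hA', mem_filter, not_and, not_le] at ha
      refine le_trans ?_ (ha.2 ha.1).le
      norm_cast
      refine card_le_card ?_
      exact filter_subset_filter _ (filter_subset _ _)
    · rw [nsmul_eq_mul, mul_comm]
      refine mul_le_mul_of_nonneg_left (le_trans ?_ hA) hβ₁
      exact_mod_cast card_le_card sdiff_subset
  rw [hdc] at hlow
  have : 0 < β * (p * α) := by positivity
  nlinarith

/-- The loss in moving the last choice past `n` others. -/
noncomputable def rotC (n : ℕ) (c M : ℝ) : ℝ := c * (c / (2 ^ (n + 3) * M)) ^ n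

lemma rotC_pos {n : ℕ} {c M : ℝ} (hc : 0 < c) (hM : 0 < M) : 0 < rotC n c M := by
  unfold rotC; positivity

lemma rotC_le {n : ℕ} {c M : ℝ} (hc : 0 < c) (hM : c ≤ M) : rotC n c M ≤ c := by
  unfold rotC
  have hM0 : 0 < M := hc.trans_le hM
  refine mul_le_of_le_one_right hc.le (pow_le_one₀ (by positivity) ?_)
  rw [div_le_one (by positivity)]
  have : (1 : ℝ) ≤ 2 ^ (n + 3) := one_le_pow₀ (by norm_num)
  nlinarith

lemma rotC_succ_le {n : ℕ} {c M : ℝ} (hc : 0 < c) (hM : c ≤ M) :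
    rotC (n + 1) c M ≤ c * rotC n c (2 * M) / (8 * M) := by
  unfold rotC
  have hM0 : 0 < M := hc.trans_le hM
  have e : (2 : ℝ) ^ (n + 3) * (2 * M) = 2 ^ (n + 1 + 3) * M := by ring
  rw [e]
  set r := c / (2 ^ (n + 1 + 3) * M) with hr
  have hr0 : 0 < r := by positivity
  have h1 : r ≤ c / (8 * M) := by
    refine div_le_div_of_nonneg_left hc.le (by positivity) ?_
    have : (1 : ℝ) ≤ 2 ^ (n + 1) := one_le_pow₀ (by norm_num)
    rw [show n + 1 + 3 = (n + 1) + 3 by rfl, pow_add]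
    nlinarith
  calc c * r ^ (n + 1) = c * r ^ n * r := by ring
    _ ≤ c * r ^ n * (c / (8 * M)) := mul_le_mul_of_nonneg_left h1 (by positivity)
    _ = c * (c * r ^ n) / (8 * M) := by ring

lemma rotC_succ_le' {n : ℕ} {c M : ℝ} (hc : 0 < c) (hM : c ≤ M) :
    rotC (n + 1) c M ≤ rotC n c (2 * M) / 8 := by
  refine (rotC_succ_le hc hM).trans ?_
  have hM0 : 0 < M := hc.trans_le hM
  have := rotC_pos (n := n) hc (by positivity : 0 < 2 * M)
  rw [div_le_div_iff₀ (by positivity) (by norm_num)]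
  nlinarith

end PowHam

/-! ### Reordering the choices -/

namespace PowHam

open Finset

variable {V : Type*} [DecidableEq V] {G : SimpleGraph V} [DecidableRel G.Adj]
variable {k b : ℕ} {p σ N c c' : ℝ} {Q Q' : List V → Prop}

/-- Moving the last choice to the front. -/
lemma Many.rot (hR : Reg G k b p σ N) {A : Finset V × ℕ}
    {L : List (Finset V × ℕ)} {ctx : List V} {M : ℝ} (hc : 0 < c) (hcM : c ≤ M)
    (hd : ∀ B ∈ L, Disjoint B.1 A.1)
    (hadm : ∀ i B, L[i]? = some B → Adm k b (B.2 + ctx.length + i) (A.2 + ctx.length + i))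
    (hσ : 8 * σ ≤ rotC L.length c M) (hN : 2 ^ L.length * M ≤ N)
    (hA : (nb G ctx A.1).card ≤ M * p ^ (A.2 + ctx.length))
    (hQ : ∀ a t, t.length = L.length → Q (a :: (t ++ ctx)) → Q' (t ++ (a :: ctx)))
    (h : Many G p c Q (L ++ [A]) ctx) : Many G p (rotC L.length c M) Q' (A :: L) ctx := by
  classical
  induction L generalizing ctx M Q Q' with
  | nil =>
    refine h.mono hR.p_pos.le (by simp [rotC]) (List.Perm.refl _) fun t ht hq => ?_
    obtain ⟨a, rfl⟩ := List.length_eq_one_iff.1 ht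
    exact hQ a [] rfl hq
  | cons B L ih =>
    have hp := hR.p_pos
    have hσ0 := hR.σ_pos
    have hM0 : 0 < M := hc.trans_le hcM
    rw [List.length_cons] at hσ hN
    set n := L.length with hn
    set m := ctx.length with hm
    set c₁ := rotC n c (2 * M) with hc₁
    have hc₁0 : 0 < c₁ := rotC_pos hc (by positivity)
    have hσc₁ : 8 * σ ≤ c₁ / 8 := hσ.trans (rotC_succ_le' hc hcM)
    have hc₁c : c₁ ≤ c := rotC_le hc (by linarith)
    have h0 := hadm 0 B rfl
    simp only [add_zero] at h0
    rw [List.cons_append, Many] at h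
    have hMN : M ≤ N := by
      refine le_trans ?_ hN
      have : (1 : ℝ) ≤ 2 ^ (n + 1) := one_le_pow₀ (by norm_num)
      nlinarith
    have hpA : 0 < p ^ (A.2 + m) := by positivity
    have hpA1 : p ^ (A.2 + m) ≤ 1 := pow_le_one₀ hp.le hR.p_le
    have hUpM := hR.upper _ _ h0 (M * p ^ (A.2 + m))
      (mul_le_mul_of_nonneg_right (by linarith) hpA.le) (by nlinarith)
    have hUpC := hR.upper _ _ h0 (c₁ * p ^ (A.2 + m) / 8) (by nlinarith) (by nlinarith)
    have hdBA : Disjoint (nb G ctx B.1) (nb G ctx A.1) :=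
      disjoint_of_subset_left (nb_subset _ _) (disjoint_of_subset_right (nb_subset _ _)
        (hd B List.mem_cons_self))
    -- First choices that see too much of `A` are dropped, so that the upper bound on the last
    -- choice survives, with `2 * M` in place of `M`, for the induction.
    have hbad := hUpM.card_bad_lt hdBA hA
    have hF := card_filter_and_ge (nb G ctx B.1) _ _ h hbad.le
    set F := (nb G ctx B.1).filter fun z => Many G p c Q (L ++ [A]) (z :: ctx) ∧
      ((nb G [z] (nb G ctx A.1)).card : ℝ) ≤ 2 * p * (M * p ^ (A.2 + m)) with hFdef
    let Q₂ : V → List V → Prop := fun b τ => ∃ t a, t.length = n ∧ τ = t ++ (a :: b :: ctx) ∧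
      Q (a :: (t ++ b :: ctx))
    -- For fixed `b`, induction moves the last choice `a` in front of the choices from `L`, and `S b
    -- a` says that `a` is then a good choice. What remains is to exchange the two choices `b` and
    -- `a`, by `swap_core`.
    let S : V → V → Prop := fun b a => Many G p c₁ (Q₂ b) L (a :: b :: ctx)
    have hS : ∀ b ∈ F, p * (c₁ * p ^ (A.2 + m)) ≤
        ((nb G ctx A.1).filter fun a => G.Adj b a ∧ S b a).card := by
      intro b hb
      rw [hFdef, mem_filter] at hb
      obtain ⟨hb1, hb2, hb3⟩ := hb
      have h1 := ih (ctx := b :: ctx) (M := 2 * M) (Q := Q) (Q' := Q₂ b) (by linarith)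
        (fun B' hB' => hd B' (List.mem_cons_of_mem _ hB'))
        (fun i B' hB' => by
          have := hadm (i + 1) B' (by simpa using hB')
          rw [List.length_cons, show B'.2 + (ctx.length + 1) + i = B'.2 + m + (i + 1) by omega,
            show A.2 + (ctx.length + 1) + i = A.2 + m + (i + 1) by omega]
          exact this)
        (by linarith) (by rw [← mul_assoc, ← pow_succ]; exact hN)
        (by
          rw [nb_cons, List.length_cons, ← add_assoc, pow_succ]
          refine hb3.trans (le_of_eq ?_)
          rw [hm]; ring)
        (fun a t ht hq => ⟨t, a, ht, rfl, hq⟩) hb2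
      rw [Many, List.length_cons] at h1
      refine le_trans (le_of_eq ?_) (h1.trans (Nat.cast_le.2 (card_le_card fun a ha => ?_)))
      · rw [← add_assoc, pow_succ]; ring
      · rw [mem_filter, nb_cons, mem_nb_one] at ha
        rw [mem_filter]
        exact ⟨ha.1.1, ha.1.2, ha.2⟩
    set c'' := rotC (n + 1) c M with hc''
    have hc''le : c'' ≤ c * c₁ / (8 * M) := rotC_succ_le hc hcM
    have hc''0 : 0 < c'' := rotC_pos hc hM0
    have hpB : 0 < p ^ (B.2 + m) := by positivity
    have hFc : c / 2 * p ^ (B.2 + m) ≤ F.card := by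
      refine le_trans ?_ hF
      rw [← sub_mul]
      exact mul_le_mul_of_nonneg_right (by linarith) hpB.le
    have hsw := swap_core (F := F) (A := nb G ctx A.1)
      (disjoint_of_subset_left (filter_subset _ _) hdBA) S (x := σ * p ^ (B.2 + m))
      (α := c₁ * p ^ (A.2 + m)) (β := c / 2 * p ^ (B.2 + m)) (β₁ := c'' * p ^ (B.2 + m + 1))
      (M := M * p ^ (A.2 + m)) hp (by positivity) (by positivity) (by positivity) hFc hS hA
      (by nlinarith) hUpC (by
        have e1 : c'' * M ≤ c * c₁ / 8 := by
          have := mul_le_mul_of_nonneg_right hc''le hM0.le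
          refine this.trans (le_of_eq ?_)
          field_simp
        have : c'' * p ^ (B.2 + m + 1) * (M * p ^ (A.2 + m)) =
          (c'' * M) * (p ^ (B.2 + m) * p * p ^ (A.2 + m)) := by ring
        rw [this]
        refine (mul_le_mul_of_nonneg_right e1 (by positivity)).trans (le_of_eq ?_)
        ring)
    rw [Many]
    refine le_trans ?_ (hsw.trans (Nat.cast_le.2 (card_le_card fun a ha => ?_)))
    · have : c'' ≤ c₁ / 8 := rotC_succ_le' hc hcM
      calc c'' * p ^ (A.2 + m) ≤ c₁ / 8 * p ^ (A.2 + m) := mul_le_mul_of_nonneg_right this hpA.le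
        _ = _ := by ring
    · rw [mem_filter] at ha ⊢
      refine ⟨ha.1, ?_⟩
      rw [Many]
      change c'' * p ^ (B.2 + (m + 1)) ≤ _
      rw [← add_assoc]
      refine ha.2.trans (Nat.cast_le.2 (card_le_card fun b hb => ?_))
      rw [mem_filter] at hb ⊢
      refine ⟨?_, ?_⟩
      · rw [nb_cons, mem_nb_one]
        exact ⟨(mem_filter.1 hb.1).1, hb.2.1.symm⟩
      -- Later choices depend only on the set of earlier ones, so the contexts `a :: b :: ctx` and
      -- `b :: a :: ctx` are interchangeable.
      · refine Many.mono hp.le ?_ (List.Perm.swap b a ctx) (fun t ht hq => ?_) hb.2.2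
        · have : c'' ≤ c₁ / 8 := rotC_succ_le' hc hcM
          change c'' ≤ c₁
          linarith
        · obtain ⟨t', a', ht', he, hq⟩ := hq
          obtain ⟨rfl, he2⟩ := List.append_inj he (by rw [ht, ht'])
          obtain ⟨rfl, -⟩ := List.cons.inj he2
          have := hQ a (t ++ [b]) (by simp [ht]) (by simpa using hq)
          simpa using this

/-- The loss in reversing `n` choices. -/
noncomputable def revC : ℕ → ℝ → ℝ → ℝ
  | 0, c, _ => c
  | n + 1, c, M => revC n (rotC n c M / 2) (2 * M)

lemma revC_pos {n : ℕ} {c M : ℝ} (hc : 0 < c) (hM : c ≤ M) : 0 < revC n c M := by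
  induction n generalizing c M with
  | zero => exact hc
  | succ n ih =>
    have hM0 := hc.trans_le hM
    refine ih (by have := rotC_pos (n := n) hc hM0; positivity) ?_
    have := rotC_le (n := n) hc hM
    linarith

lemma revC_le {n : ℕ} {c M : ℝ} (hc : 0 < c) (hM : c ≤ M) : revC n c M ≤ c := by
  induction n generalizing c M with
  | zero => exact le_rfl
  | succ n ih =>
    have hM0 := hc.trans_le hM
    have h1 := rotC_pos (n := n) hc hM0
    have h2 := rotC_le (n := n) hc hM
    refine (ih (c := rotC n c M / 2) (M := 2 * M) (by positivity) (by linarith)).trans ?_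
    linarith

/-- Reversing the order of the choices. -/
lemma Many.reverse (hR : Reg G k b p σ N)
    {L : List (Finset V × ℕ)} {ctx : List V} {M : ℝ} (hc : 0 < c) (hcM : c ≤ M)
    (hd : L.Pairwise fun B A => Disjoint B.1 A.1) (h0 : ∀ B ∈ L, B.2 = 0)
    (hk : ctx.length + L.length ≤ k)
    (hσ : 8 * σ * (k + 1) ≤ revC L.length c M) (hN : 2 ^ (2 * L.length) * M ≤ N)
    (hA : ∀ B ∈ L, (nb G ctx B.1).card ≤ M * p ^ ctx.length)
    (hQ : ∀ t, t.length = L.length → Q (t ++ ctx) → Q' (t.reverse ++ ctx))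
    (h : Many G p c Q L ctx) : Many G p (revC L.length c M) Q' L.reverse ctx := by
  classical
  induction hn : L.length generalizing L ctx M c Q Q' with
  | zero =>
    rw [List.length_eq_zero_iff] at hn
    subst hn
    exact hQ [] rfl h
  | succ n ih =>
    obtain ⟨L, A, rfl⟩ : ∃ L' A, L = L' ++ [A] := by
      rcases List.eq_nil_or_concat L with rfl | ⟨L', A, rfl⟩
      · simp at hn
      · exact ⟨L', A, by simp⟩
    have hL : L.length = n := by simpa using hn
    have hp := hR.p_pos
    have hσ0 := hR.σ_pos
    have hkb := hR.k_le
    have hM0 : 0 < M := hc.trans_le hcM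
    simp only [List.length_append, List.length_singleton, hL] at hσ hN hk hQ
    rw [revC] at hσ ⊢
    set c₁ := rotC n c M with hc₁
    have hc₁0 : 0 < c₁ := rotC_pos hc hM0
    have hc₁M : c₁ ≤ M := (rotC_le hc hcM).trans hcM
    have hr := revC_le (n := n) (c := c₁ / 2) (M := 2 * M) (by positivity) (by linarith)
    have hσk : σ ≤ σ * (k + 1) := by
      have : (0 : ℝ) ≤ k := Nat.cast_nonneg k
      nlinarith
    have hA0 : A.2 = 0 := h0 A (by simp)
    have hN1 : M * 2 ^ n ≤ N ∧ M ≤ N := by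
      have h1 : (1 : ℝ) ≤ 2 ^ n := one_le_pow₀ (by norm_num)
      have h2 : (2 : ℝ) ^ n ≤ 2 ^ (2 * (n + 1)) :=
        pow_le_pow_right₀ (by norm_num) (by omega)
      constructor <;> nlinarith
    let Q₁ : List V → Prop := fun τ => ∃ t a, t.length = n ∧ τ = t ++ (a :: ctx) ∧
      Q (a :: (t ++ ctx))
    -- The last set is brought to the front and the rest is reversed by induction, after discarding
    -- the vertices with too many neighbours in one of the remaining sets.
    have h1 := Many.rot (Q' := Q₁) hR hc hcM (fun B hB => by
        rw [List.pairwise_append] at hd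
        exact hd.2.2 B hB A (by simp)) (fun i B hB => by
          have hi := (List.getElem?_eq_some_iff.1 hB).1
          have hB0 : B.2 = 0 := h0 B (by simp [List.mem_of_getElem? hB])
          rw [hB0, hA0]
          left
          constructor <;> omega) (by rw [hL]; linarith) (by rw [hL]; linarith [hN1.1])
        (by rw [hA0, zero_add]; exact hA A (by simp)) (fun a t ht hq => ⟨t, a, by omega, rfl, hq⟩) h
    rw [List.reverse_append, List.reverse_singleton, List.singleton_append, Many]
    rw [hL, Many] at h1
    have hpm : 0 < p ^ ctx.length := by positivity
    have hpm1 : p ^ ctx.length ≤ 1 := pow_le_one₀ hp.le hR.p_le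
    have hup := hR.upper ctx.length ctx.length (Or.inl ⟨by omega, by omega⟩) (M * p ^ ctx.length)
      (mul_le_mul_of_nonneg_right (by linarith) hpm.le) (by nlinarith [hN1.2])
    have hpick : ∀ L' : List (Finset V × ℕ), (∀ B ∈ L', B ∈ L) →
        (c₁ - L'.length * σ) * p ^ ctx.length ≤
          ((nb G ctx A.1).filter fun z => Many G p c₁ Q₁ L (z :: ctx) ∧
        ∀ B ∈ L', ((nb G [z] (nb G ctx B.1)).card : ℝ) ≤ 2 * p * (M * p ^ ctx.length)).card := by
      intro L' hL'
      induction L' with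
      | nil => simpa [hA0] using h1
      | cons B L' ih' =>
        have h2 := ih' fun B hB => hL' B (List.mem_cons_of_mem _ hB)
        have hBL := hL' B List.mem_cons_self
        have hdBA : Disjoint (nb G ctx A.1) (nb G ctx B.1) := by
          rw [List.pairwise_append] at hd
          exact disjoint_of_subset_left (nb_subset _ _) (disjoint_of_subset_right (nb_subset _ _)
            (hd.2.2 B hBL A (by simp)).symm)
        have h3 := hup.card_bad_lt hdBA (hA B (by simp [hBL]))
        have h4 := card_filter_and_ge _ _ _ h2 h3.le
        refine le_trans (le_of_eq ?_) (h4.trans (le_of_eq ?_))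
        · push_cast [List.length_cons]; ring
        · congr 2
          ext v
          simp only [mem_filter, List.forall_mem_cons]
          tauto
    have hpL := hpick L fun _ => id
    have hLσ : (L.length : ℝ) * σ ≤ c₁ / 2 := by
      have : (L.length : ℝ) ≤ k := by exact_mod_cast (by omega : L.length ≤ k)
      nlinarith
    rw [hA0, zero_add]
    refine le_trans (mul_le_mul_of_nonneg_right (by linarith) hpm.le)
      (hpL.trans (Nat.cast_le.2 (card_le_card fun z hz => ?_)))
    rw [mem_filter] at hz ⊢
    obtain ⟨hz1, hz2, hz3⟩ := hz
    refine ⟨hz1, ?_⟩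
    refine ih (c := c₁ / 2) (M := 2 * M) (Q := Q₁) (by positivity) (by linarith)
      (List.pairwise_append.1 hd).1 (fun B hB => h0 B (by simp [hB])) (by simp; omega)
      (by rw [hL]; exact hσ) ?_ ?_ ?_ (hz2.mono hp.le (by linarith) (List.Perm.refl _) fun _ _ => id)
      hL
    · rw [hL]
      refine le_trans ?_ hN
      have h1 : (2 : ℝ) ^ (2 * (n + 1)) = 2 ^ (2 * n) * 4 := by ring
      rw [h1]
      have : (0 : ℝ) < 2 ^ (2 * n) := by positivity
      nlinarith
    · intro B hB
      rw [nb_cons, List.length_cons, pow_succ]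
      refine (hz3 B hB).trans (le_of_eq (by ring))
    · rintro t ht ⟨t', a, ht', he, hq⟩
      obtain ⟨rfl, he2⟩ := List.append_inj he (by omega)
      obtain ⟨rfl, -⟩ := List.cons.inj he2
      have := hQ (z :: t) (by simp; omega) (by simpa using hq)
      simpa using this

end PowHam

/-! ### Pulling unreachable blocks back towards an end block -/

namespace PowHam

open Finset

variable {V : Type*} [DecidableEq V] (G : SimpleGraph V) [DecidableRel G.Adj]

/-- The block `τ` (newest vertex first) can be reached from the end block `e` by a `k`-path with
`m` intermediate vertices, all in `Y`. -/
def Reach (k : ℕ) (e : List V) (Y : Finset V) (m : ℕ) (τ : List V) : Prop :=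
  ∃ y : List V, y.Nodup ∧ (∀ v ∈ y, v ∈ Y) ∧ y.length = m ∧ KPath G k (τ ++ y ++ e)

variable {G} {k b : ℕ} {p σ N c c' : ℝ} {Q Q' : List V → Prop}

/-- Fix the `k - 1` choices `t` from `L` and let `Zs` be the set of `z` for which `z :: t` is
unreachable. If `v ∈ A` is a common neighbour of `t` and `t ++ [v]` is reachable inside `Y`, then
`v` has no neighbour in `Zs`: otherwise the same path, with `v` now counted as intermediate, would
reach `z :: t`. Lower regularity makes such `v` rare, so most `v` give an unreachable block; moving
the choice of `v` to the front restores the order of the sets. -/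
lemma many_step (hR : Reg G k b p σ N) {e : List V} {Y : Finset V} {m : ℕ}
    {A C : Finset V × ℕ} {L : List (Finset V × ℕ)} {M w : ℝ} (hL : L.length + 1 = k)
    (hAY : Disjoint A.1 Y) (hd : ∀ B ∈ L, Disjoint B.1 A.1) (hc : 0 < c) (hcM : c ≤ M)
    (hcw : c ≤ w / 2 ^ L.length)
    (hadm : ∀ i B, L[i]? = some B → Adm k b (B.2 + i) (A.2 + i))
    (hA2 : A.2 + k ≤ b + 1) (hC : C.2 = 0)
    (hAw : w * p ^ A.2 ≤ A.1.card) (hAM : A.1.card ≤ M * p ^ A.2)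
    (hσ : 8 * σ ≤ rotC L.length (c / 2) M) (hN : 2 ^ k * M ≤ N)
    (h : Many G p c (fun τ => ¬ Reach G k e (Y ∪ A.1) (m + 1) τ) (L ++ [C]) []) :
    Many G p (rotC L.length (c / 2) M) (fun τ => ¬ Reach G k e Y m τ) (A :: L) [] := by
  classical
  have hp := hR.p_pos
  have hσ0 := hR.σ_pos
  have hrc := rotC_le (n := L.length) (c := c / 2) (M := M) (by linarith) (by linarith)
  rw [many_append] at h
  have h1 := h.typ hR (W := A.1) (h := A.2) (w := w)
    (fun i B hB => by simpa using hadm i B hB) (by linarith) (by linarith) (by simpa using hAw)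
  have h2 : Many G p (c / 2) (Many G p (c / 2)
      (fun τ => ∀ v t, τ = v :: t → ¬ Reach G k e Y m (t ++ [v])) [A]) L [] := by
    refine h1.mono hp.le le_rfl (List.Perm.refl _) fun t ht hq => ?_
    rw [List.append_nil] at hq ⊢
    obtain ⟨hq1, hq2⟩ := hq
    rw [Many] at hq1 ⊢
    simp only [Many, hC, zero_add, List.length_nil, add_zero] at hq1 hq2 ⊢
    rw [ht] at hq1 ⊢
    set Zs := (nb G t C.1).filter fun z => ¬ Reach G k e (Y ∪ A.1) (m + 1) (z :: t) with hZs
    have hno : ∀ v ∈ nb G t A.1, Reach G k e Y m (t ++ [v]) → nb G [v] Zs = ∅ := by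
      rintro v hv ⟨y, hy1, hy2, hy3, hy4⟩
      rw [eq_empty_iff_forall_notMem]
      intro z hz
      rw [mem_nb_one, hZs, mem_filter] at hz
      obtain ⟨⟨hz1, hz2⟩, hz3⟩ := hz
      rw [mem_nb] at hz1 hv
      refine hz2 ⟨v :: y, ?_, ?_, by simp [hy3], ?_⟩
      · exact List.nodup_cons.2 ⟨fun hvy => disjoint_left.1 hAY hv.1 (hy2 v hvy), hy1⟩
      · intro u hu
        rcases List.mem_cons.1 hu with rfl | hu
        · exact mem_union_right _ hv.1
        · exact mem_union_left _ (hy2 u hu)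
      · have e1 : z :: t ++ v :: y ++ e = z :: ((t ++ [v]) ++ y ++ e) := by simp
        rw [e1]
        refine hy4.cons fun a ha => ?_
        rw [List.append_assoc, List.take_append_of_le_length (by simp; omega)] at ha
        have ha' := List.mem_of_mem_take ha
        rw [List.mem_append, List.mem_singleton] at ha'
        rcases ha' with ha' | rfl
        · exact hz1.2 a ha'
        · exact hz3
    have hRl := hR.lower (A.2 + L.length) L.length (Or.inr ⟨by omega, by omega⟩)
    have hZc : σ * p ^ L.length ≤ Zs.card :=
      (mul_le_mul_of_nonneg_right (by linarith : σ ≤ c) (by positivity)).trans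
        (hq1.trans (Nat.cast_le.2 (card_le_card fun z hz => by
          rw [hZs, mem_filter]; exact (@mem_filter _ _ (_) _ _).1 hz)))
    have hbad := hRl.card_bad_lt (nb G t A.1) hZc
    have hpos : (0 : ℝ) < Zs.card := lt_of_lt_of_le (by positivity) hZc
    have hfin := card_filter_and_ge (nb G t A.1) (fun _ => True)
      (fun v => ∀ v' t', v :: t = v' :: t' → ¬ Reach G k e Y m (t' ++ [v']))
      (x := w / 2 ^ L.length * p ^ (A.2 + L.length)) (y := σ * p ^ (A.2 + L.length))
      (by rwa [filter_true]) (by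
        refine le_trans (Nat.cast_le.2 (card_le_card fun v hv => ?_)) hbad.le
        rw [mem_filter] at hv ⊢
        refine ⟨hv.1, ?_⟩
        obtain ⟨hv1, hv2⟩ := hv
        push Not at hv2
        obtain ⟨v', t', he, hr⟩ := hv2
        obtain ⟨rfl, rfl⟩ := List.cons.inj he
        rw [hno v hv1 hr, not_le, card_empty, Nat.cast_zero]
        have : (0 : ℝ) < 1 - 1 / 2 := by norm_num
        positivity)
    simp only [true_and] at hfin
    refine le_trans ?_ (hfin.trans (le_of_eq (by congr!)))
    rw [← sub_mul]
    exact mul_le_mul_of_nonneg_right (by linarith) (by positivity)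
  rw [← many_append] at h2
  refine h2.rot hR (by linarith) (by linarith) hd (fun i B hB => by simpa using hadm i B hB) hσ ?_
    (by simpa using hAM) (fun a t ht hq => hq a t (by rw [List.append_nil]))
  refine le_trans (mul_le_mul_of_nonneg_right ?_ (by linarith)) hN
  exact pow_le_pow_right₀ (by norm_num) (by omega)

/-- `k` consecutive terms of a sequence of sets. -/
def window (W : ℕ → Finset V × ℕ) (i k : ℕ) : List (Finset V × ℕ) :=
  (List.range k).map fun j => W (i + j)

lemma window_succ (W : ℕ → Finset V × ℕ) (i k : ℕ) :
    window W i (k + 1) = W i :: window W (i + 1) k := by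
  simp only [window, List.range_succ_eq_map, List.map_cons, List.map_map, add_zero]
  congr 1
  refine List.map_congr_left fun j _ => ?_
  simp only [Function.comp, Nat.succ_eq_add_one]
  congr 1
  omega

lemma window_snoc (W : ℕ → Finset V × ℕ) (i k : ℕ) :
    window W i (k + 1) = window W i k ++ [W (i + k)] := by
  simp [window, List.range_succ]

@[simp] lemma length_window (W : ℕ → Finset V × ℕ) (i k : ℕ) : (window W i k).length = k := by
  simp [window]

lemma window_getElem? {W : ℕ → Finset V × ℕ} {i k j : ℕ} {B : Finset V × ℕ}
    (h : (window W i k)[j]? = some B) : j < k ∧ B = W (i + j) := by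
  obtain ⟨hj, rfl⟩ := List.getElem?_eq_some_iff.1 h
  simp only [window, List.length_map, List.length_range] at hj
  exact ⟨hj, by simp [window]⟩

lemma mem_window {W : ℕ → Finset V × ℕ} {i k : ℕ} {B : Finset V × ℕ}
    (h : B ∈ window W i k) : ∃ j < k, B = W (i + j) := by
  obtain ⟨j, hj, rfl⟩ := List.mem_map.1 h
  exact ⟨j, List.mem_range.1 hj, rfl⟩

/-- The loss in one step of `many_step`. -/
noncomputable def stepC (k : ℕ) (M c : ℝ) : ℝ := rotC (k - 1) (c / 2) M

lemma stepC_pos {M : ℝ} (hc : 0 < c) (hM : 0 < M) : 0 < stepC k M c :=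
  rotC_pos (by linarith) hM

lemma stepC_le {M : ℝ} (hc : 0 < c) (hcM : c ≤ M) : stepC k M c ≤ c := by
  have := rotC_le (n := k - 1) (c := c / 2) (M := M) (by linarith) (by linarith)
  unfold stepC
  linarith

lemma stepC_iterate {M : ℝ} (hc : 0 < c) (hcM : c ≤ M) (i : ℕ) :
    0 < (stepC k M)^[i] c ∧ (stepC k M)^[i] c ≤ c := by
  induction i with
  | zero => exact ⟨hc, le_rfl⟩
  | succ i ih =>
    rw [Function.iterate_succ_apply']
    exact ⟨stepC_pos ih.1 (hc.trans_le hcM), (stepC_le ih.1 (ih.2.trans hcM)).trans ih.2⟩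

/-- The window of `k` sets slides back one place at a time, from `W n` to `W 0`, and the sets that
leave it no longer count as room for intermediate vertices. -/
lemma many_steps (hR : Reg G k b p σ N) {e : List V} {Y : Finset V} {m n : ℕ}
    {W : ℕ → Finset V × ℕ} {M w : ℝ} (hWY : ∀ i < n, Disjoint (W i).1 Y)
    (hd : ∀ i j, i ≠ j → i < n + k → j < n + k → Disjoint (W i).1 (W j).1)
    (hc : 0 < c) (hcM : c ≤ M) (hcw : c ≤ w / 2 ^ k)
    (hadm : ∀ i < n, ∀ j, j + 1 < k → Adm k b ((W (i + 1 + j)).2 + j) ((W i).2 + j))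
    (hW2 : ∀ i < n, (W i).2 + k ≤ b + 1) (hWk : ∀ i < n, (W (i + k)).2 = 0)
    (hWw : ∀ i < n, w * p ^ (W i).2 ≤ (W i).1.card)
    (hWM : ∀ i < n, (W i).1.card ≤ M * p ^ (W i).2)
    (hσ : 8 * σ ≤ (stepC k M)^[n] c) (hN : 2 ^ k * M ≤ N)
    (h : Many G p c (fun τ => ¬ Reach G k e (Y ∪ (range n).biUnion fun i => (W i).1) (m + n) τ)
      (window W n k) []) :
    Many G p ((stepC k M)^[n] c) (fun τ => ¬ Reach G k e Y m τ) (window W 0 k) [] := by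
  have hk := hR.two_le
  obtain ⟨k', rfl⟩ : ∃ k', k = k' + 1 := ⟨k - 1, by omega⟩
  have key : ∀ i ≤ n, Many G p ((stepC (k' + 1) M)^[i] c) (fun τ => ¬ Reach G (k' + 1) e
      (Y ∪ (range (n - i)).biUnion fun i => (W i).1) (m + (n - i)) τ)
      (window W (n - i) (k' + 1)) [] := by
    intro i hi
    induction i with
    | zero => simpa using h
    | succ i ih =>
      have h1 := ih (by omega)
      set j := n - (i + 1) with hj
      have hji : n - i = j + 1 := by omega
      have hjn : j < n := by omega
      rw [hji, window_snoc] at h1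
      have hit := stepC_iterate (k := k' + 1) hc hcM i
      have hwc : c ≤ w / 2 ^ k' := by
        refine hcw.trans ?_
        have : 0 ≤ w := by
          have := hc.le.trans hcw
          by_contra hneg
          exact absurd this (not_le.2 (div_neg_of_neg_of_pos (not_le.1 hneg) (by positivity)))
        refine div_le_div_of_nonneg_left this (by positivity) ?_
        exact pow_le_pow_right₀ (by norm_num) (by omega)
      have h2 := many_step hR (e := e) (Y := Y ∪ (range j).biUnion fun i => (W i).1) (m := m + j)
        (A := W j) (C := W (j + 1 + k')) (L := window W (j + 1) k') (M := M) (w := w) (by simp)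
        (by
          rw [disjoint_union_right, disjoint_biUnion_right]
          refine ⟨hWY j hjn, fun l hl => hd _ _ ?_ (by omega) ?_⟩ <;>
          have := mem_range.1 hl <;> omega)
        (fun B hB => by
          obtain ⟨l, hl, rfl⟩ := mem_window hB
          exact hd _ _ (by omega) (by omega) (by omega)) hit.1 (hit.2.trans hcM)
        (by rw [length_window]; exact hit.2.trans hwc)
        (fun l B hB => by
          obtain ⟨hl, rfl⟩ := window_getElem? hB
          exact hadm j hjn l (by omega)) (hW2 j hjn)
        (by rw [show j + 1 + k' = j + (k' + 1) by omega]; exact hWk j hjn) (hWw j hjn) (hWM j hjn)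
        (by
          rw [length_window]
          have h3 : (stepC (k' + 1) M)^[n] c ≤ (stepC (k' + 1) M)^[i + 1] c := by
            have e3 : n = (n - (i + 1)) + (i + 1) := by omega
            rw [e3, Function.iterate_add_apply]
            have hit2 := stepC_iterate (k := k' + 1) hc hcM (i + 1)
            exact (stepC_iterate hit2.1 (hit2.2.trans hcM) _).2
          rw [Function.iterate_succ_apply'] at h3
          exact hσ.trans h3)
        hN (by
          refine h1.mono hR.p_pos.le le_rfl (List.Perm.refl _) fun t ht hq => ?_
          rwa [range_add_one, biUnion_insert, union_comm (W j).1, ← union_assoc, ← add_assoc] at hq)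
      rw [length_window, ← window_succ] at h2
      rw [Function.iterate_succ_apply']
      exact h2
  have := key n le_rfl
  simpa using this

end PowHam

/-! ### Connecting two typical end blocks -/

namespace PowHam

open Finset

/-- The losses are homogeneous of degree one in `(c, M)`: they are computed once with `M = 1` and
scaled by `θ`, so the constants are independent of the graph. -/
lemma rotC_smul {n : ℕ} {c M t : ℝ} (ht : 0 < t) : rotC n (t * c) (t * M) = t * rotC n c M := by
  unfold rotC
  rw [mul_left_comm ((2 : ℝ) ^ (n + 3)), mul_div_mul_left _ _ ht.ne', mul_assoc]

lemma revC_smul {n : ℕ} {c M t : ℝ} (ht : 0 < t) : revC n (t * c) (t * M) = t * revC n c M := by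
  induction n generalizing c M with
  | zero => rfl
  | succ n ih =>
    rw [revC, revC, rotC_smul ht, ← ih]
    congr 1 <;> ring

lemma stepC_iterate_smul {k n : ℕ} {c M t : ℝ} (ht : 0 < t) :
    (stepC k (t * M))^[n] (t * c) = t * (stepC k M)^[n] c := by
  induction n with
  | zero => rfl
  | succ n ih =>
    rw [Function.iterate_succ_apply', Function.iterate_succ_apply', ih, stepC, stepC, ← rotC_smul ht]
    congr 1; ring

section

variable {V : Type*} [DecidableEq V] {G : SimpleGraph V} [DecidableRel G.Adj]
variable {k b : ℕ} {p σ N c c' : ℝ} {Q Q' : List V → Prop}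

lemma Many.mono_chosen {L : List (Finset V × ℕ)} {ctx : List V}
    (hQ : ∀ τ, Chosen G L ctx τ → Q τ → Q' τ)
    (h : Many G p c Q L ctx) : Many G p c Q' L ctx := by
  classical
  induction L generalizing ctx with
  | nil => exact hQ ctx rfl h
  | cons A L ih =>
    rw [Many] at h ⊢
    refine h.trans (Nat.cast_le.2 (card_le_card fun z hz => ?_))
    rw [mem_filter] at hz ⊢
    exact ⟨hz.1, ih (fun τ hτ => hQ τ ⟨z, hz.1, hτ⟩) hz.2⟩

lemma Chosen.length {L : List (Finset V × ℕ)} {ctx τ : List V} (h : Chosen G L ctx τ) :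
    τ.length = ctx.length + L.length := by
  induction L generalizing ctx with
  | nil => rw [Chosen] at h; simp [h]
  | cons A L ih =>
    obtain ⟨z, -, hz⟩ := h
    rw [ih hz]; simp; omega

lemma Chosen.pairwise {L : List (Finset V × ℕ)} {ctx τ : List V} (h : Chosen G L ctx τ)
    (hc : ctx.Pairwise G.Adj) : τ.Pairwise G.Adj := by
  induction L generalizing ctx with
  | nil => rw [Chosen] at h; rwa [h]
  | cons A L ih =>
    obtain ⟨z, hz, hz'⟩ := h
    exact ih hz' (List.pairwise_cons.2 ⟨fun a ha => ((mem_nb.1 hz).2 a ha).symm, hc⟩)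

lemma Chosen.mem {L : List (Finset V × ℕ)} {ctx τ : List V} (h : Chosen G L ctx τ) {v : V}
    (hv : v ∈ τ) : v ∈ ctx ∨ ∃ B ∈ L, v ∈ B.1 := by
  induction L generalizing ctx with
  | nil => rw [Chosen] at h; exact Or.inl (h ▸ hv)
  | cons A L ih =>
    obtain ⟨z, hz, hz'⟩ := h
    rcases ih hz' with h1 | ⟨B, hB, h1⟩
    · rcases List.mem_cons.1 h1 with rfl | h1
      · exact Or.inr ⟨A, List.mem_cons_self, (mem_nb.1 hz).1⟩
      · exact Or.inl h1
    · exact Or.inr ⟨B, List.mem_cons_of_mem _ hB, h1⟩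

lemma nodup_of_pairwise_adj {l : List V} (h : l.Pairwise G.Adj) : l.Nodup :=
  h.imp fun hab => hab.ne

/-- A vertex with `j` vertices already placed before it sees only `k - j` vertices of `e` within
distance `k`, so `W j` has to lie in a common neighbourhood of those alone. -/
lemma Chosen.kPath {W : ℕ → Finset V × ℕ} {e : List V}
    (hW : ∀ j < k, ∀ v ∈ (W j).1, ∀ a ∈ e.take (k - j), G.Adj a v) {n : ℕ} {ctx τ : List V}
    (hn : ctx.length + n ≤ k) (hK : KPath G k (ctx ++ e))
    (h : Chosen G (window W ctx.length n) ctx τ) : KPath G k (τ ++ e) := by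
  induction n generalizing ctx with
  | zero =>
    have : τ = ctx := h
    rwa [this]
  | succ n ih =>
    rw [window_succ] at h
    obtain ⟨z, hz, h⟩ := h
    rw [mem_nb] at hz
    refine ih (ctx := z :: ctx) (by simp; omega) ?_ h
    refine hK.cons fun a ha => ?_
    rw [List.take_append, List.mem_append] at ha
    rcases ha with ha | ha
    · exact hz.2 a (List.mem_of_mem_take ha)
    · exact hW ctx.length (by omega) z hz.1 a ha

lemma Reach.mono {e : List V} {Y Y' : Finset V} {m : ℕ} {τ : List V} (h : Reach G k e Y m τ)
    (hY : Y ⊆ Y') : Reach G k e Y' m τ := by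
  obtain ⟨y, h1, h2, h3, h4⟩ := h
  exact ⟨y, h1, fun v hv => hY (h2 v hv), h3, h4⟩

end

/-- Almost all blocks in sufficiently large sets `U j` can be reached from an end block `e`
using vertices from given sets `B i` of common neighbours of the last `J i` vertices of `e`. -/
def LeftOK (k b mL : ℕ) (J : Fin mL → ℕ) : Prop := ∀ r : ℝ, 0 < r → r ≤ 1 → ∃ κ : ℝ, 0 < κ ∧
  ∀ (V : Type u) [DecidableEq V] (G : SimpleGraph V) [DecidableRel G.Adj] (p σ N θ : ℝ)
    (e : List V) (B : Fin mL → Finset V) (U : ℕ → Finset V),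
    Reg G k b p σ N → 0 < θ → σ ≤ κ * θ → 4 ^ (k + 1) * θ ≤ N → e.length = k → KPath G k e →
    (∀ i, ∀ v ∈ B i, ∀ a ∈ e.take (J i), G.Adj a v) →
    (∀ i, r * θ * p ^ J i ≤ (B i).card) → (∀ i, (B i).card ≤ θ * p ^ J i) →
    (∀ j < k, r * θ ≤ (U j).card) → (∀ j < k, (U j).card ≤ θ) →
    (∀ i j, i ≠ j → Disjoint (B i) (B j)) → (∀ i, ∀ j < k, Disjoint (B i) (U j)) →
    (∀ i < k, ∀ j < k, i ≠ j → Disjoint (U i) (U j)) →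
    ¬ Many G p (r * θ) (fun τ => ¬ Reach G k e (univ.biUnion B) mL τ)
      (window (fun j => (U j, 0)) 0 k) []

/-- Pulling back `k` times leads to blocks chosen from the sets `B i`; these attach directly to `e`,
so none of them is unreachable. A common neighbourhood of `k` vertices, cut down by `k - 1` further
choices, has exponent `2 * k - 1`, whence the condition on `b`. -/
lemma leftOK_of_large {k b : ℕ} (hb : 2 * k ≤ b + 1) :
    LeftOK.{u} k b k (fun i => k - i) := by
  intro r hr hr1
  have hst := stepC_iterate (k := k) (c := r / 2 ^ k) (M := 1) (by positivity)
    ((div_le_self hr.le (one_le_pow₀ (by norm_num))).trans hr1) k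
  refine ⟨(stepC k 1)^[k] (r / 2 ^ k) / 8, by linarith [hst.1], ?_⟩
  intro V _ G _ p σ N θ e B U hR hθ hσ hN he hKe hB hB1 hB2 hU1 hU2 hBB hBU hUU hM
  have hp := hR.p_pos
  have h2k := hR.two_le
  set W : ℕ → Finset V × ℕ := fun i => if h : i < k then (B ⟨i, h⟩, k - i) else (U (i - k), 0)
    with hW
  have hWlt : ∀ i (h : i < k), W i = (B ⟨i, h⟩, k - i) := fun i h => by simp [hW, h]
  have hWge : ∀ i, k ≤ i → W i = (U (i - k), 0) := fun i h => by simp [hW, not_lt.2 h]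
  have hwin : window W k k = window (fun j => (U j, 0)) 0 k := by
    refine List.map_congr_left fun j _ => ?_
    rw [hWge _ (by omega)]
    simp
  have hsub : ((range k).biUnion fun i => (W i).1) ⊆ univ.biUnion B := by
    intro v hv
    obtain ⟨i, hi, hv⟩ := mem_biUnion.1 hv
    rw [mem_range] at hi
    rw [hWlt i hi] at hv
    exact mem_biUnion.2 ⟨⟨i, hi⟩, mem_univ _, hv⟩
  have hst2 := stepC_iterate_smul (k := k) (n := k) (c := r / 2 ^ k) (M := 1) hθ
  rw [mul_one] at hst2
  have h1 := many_steps (c := θ * (r / 2 ^ k)) (M := θ) (w := r * θ) (n := k) (Y := ∅) (m := 0)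
    (W := W) (e := e) hR (fun i _ => disjoint_empty_right _) ?_ (by positivity) ?_
    (le_of_eq (by ring)) ?_ ?_ (fun i hi => by rw [hWge _ (by omega)]) ?_ ?_ ?_ ?_ ?_
  · obtain ⟨τ, hτ, hq⟩ := h1.exists_chosen hp (by rw [hst2]; exact mul_pos hθ hst.1)
    refine hq ⟨[], List.nodup_nil, by simp, rfl, ?_⟩
    rw [List.append_nil]
    refine Chosen.kPath (ctx := []) (W := W) (fun j hj v hv a ha => ?_) (by simp) (by simpa using hKe) hτ
    rw [hWlt j hj] at hv
    exact hB ⟨j, hj⟩ v hv a ha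
  · intro i j hij hi hj
    rcases lt_or_ge i k with hi' | hi' <;> rcases lt_or_ge j k with hj' | hj'
    · rw [hWlt i hi', hWlt j hj']
      exact hBB _ _ (by simpa using hij)
    · rw [hWlt i hi', hWge j hj']
      exact hBU _ _ (by omega)
    · rw [hWge i hi', hWlt j hj']
      exact (hBU _ _ (by omega)).symm
    · rw [hWge i hi', hWge j hj']
      exact hUU _ (by omega) _ (by omega) (by omega)
  · have : r / 2 ^ k ≤ 1 := (div_le_self hr.le (one_le_pow₀ (by norm_num))).trans hr1
    nlinarith
  · intro i hi j hj
    rw [hWlt i hi]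
    rcases lt_or_ge (i + 1 + j) k with h | h
    · rw [hWlt _ h]
      exact Or.inl ⟨by simp only; omega, by simp only; omega⟩
    · rw [hWge _ h]
      exact Or.inl ⟨by simp only; omega, by simp only; omega⟩
  · intro i hi
    rw [hWlt i hi]
    simp only
    omega
  · intro i hi
    rw [hWlt i hi]
    exact hB1 ⟨i, hi⟩
  · intro i hi
    rw [hWlt i hi]
    exact hB2 ⟨i, hi⟩
  · rw [hst2]; nlinarith
  · refine le_trans (mul_le_mul_of_nonneg_right ?_ hθ.le) hN
    calc (2 : ℝ) ^ k ≤ 4 ^ k := pow_le_pow_left₀ (by norm_num) (by norm_num) k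
      _ ≤ 4 ^ (k + 1) := pow_le_pow_right₀ (by norm_num) (by omega)
  · rw [hwin]
    refine hM.mono hp.le ?_ (List.Perm.refl _) fun t ht hq hr => hq ?_
    · rw [mul_comm]
      exact mul_le_mul_of_nonneg_right (div_le_self hr.le (one_le_pow₀ (by norm_num))) hθ.le
    · rw [empty_union, zero_add] at hr
      exact hr.mono hsub

/-- Two typical end blocks can be connected by a `k`-path of bounded length inside `Z`. -/
theorem exists_connection {k b mL : ℕ} {J : Fin mL → ℕ} (hL : LeftOK.{u} k b mL J)
    (hJ : ∀ i, J i ≤ k) : ∃ κ : ℝ, 0 < κ ∧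
  ∀ (V : Type u) [DecidableEq V] (G : SimpleGraph V) [DecidableRel G.Adj] (p σ N θ : ℝ)
    (e s : List V) (Z : Finset V),
    Reg G k b p σ N → 0 < θ → σ ≤ κ * θ → 4 ^ (k + 1) * θ ≤ N → e.length = k → s.length = k →
    KPath G k e → KPath G k s → Typ G p k θ e Z → Typ G p k θ s Z →
    ∃ c : List V, c.Nodup ∧ (∀ v ∈ c, v ∈ Z) ∧ c.length = mL + k + mL ∧
      KPath G k (e.reverse ++ c ++ s) := by
  -- One more than the number of disjoint parts to be cut out of `Z`: `mL` next to each end and `k`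
  -- in the middle.
  set P : ℕ := 2 * mL + k + 1 with hP
  -- The parts have relative size at least `1 / (2 * P)`; one factor `2 ^ k` is lost in `many_true`
  -- and another in `Many.or`. The constant `r` below accounts for the reversal as well.
  set r₁ : ℝ := 1 / (2 * P) / 4 ^ k with hr₁
  have hPpos : (1 : ℝ) ≤ P := by exact_mod_cast (by omega : 1 ≤ P)
  have h4k : (1 : ℝ) ≤ 4 ^ k := one_le_pow₀ (by norm_num)
  have hr₁0 : 0 < r₁ := by positivity
  have hr₁P : r₁ ≤ 1 / (2 * P) := div_le_self (by positivity) h4k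
  have hP2 : 1 / (2 * (P : ℝ)) ≤ 1 := by
    rw [div_le_one (by positivity)]; linarith
  have hr₁1 : r₁ ≤ 1 := hr₁P.trans hP2
  set r := revC k r₁ 1 with hr
  have hr0 : 0 < r := revC_pos hr₁0 hr₁1
  have hrr : r ≤ r₁ := revC_le hr₁0 hr₁1
  obtain ⟨κ, hκ, H⟩ := hL r hr0 (hrr.trans hr₁1)
  refine ⟨min κ (r / (8 * (k + 1)) / P), by positivity, ?_⟩
  intro V _ G _ p σ N θ e s Z hR hθ hσ hN he hs hKe hKs hTe hTs
  have hp := hR.p_pos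
  have hp1 := hR.p_le
  have hσ0 := hR.σ_pos
  have hk2 := hR.two_le
  have hσκ : σ ≤ κ * θ := hσ.trans (mul_le_mul_of_nonneg_right (min_le_left _ _) hθ.le)
  have hσr' : σ ≤ r / (8 * (k + 1)) / P * θ :=
    hσ.trans (mul_le_mul_of_nonneg_right (min_le_right _ _) hθ.le)
  have hk1 : (1 : ℝ) ≤ k + 1 := by
    have : (0 : ℝ) ≤ k := Nat.cast_nonneg k
    linarith
  have hσr : 8 * σ * (k + 1) ≤ r * θ := by
    have h1 : r / (8 * (k + 1)) / P * θ ≤ r / (8 * (k + 1)) * θ :=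
      mul_le_mul_of_nonneg_right (div_le_self (by positivity) hPpos) hθ.le
    have h2 : σ ≤ r / (8 * (k + 1)) * θ := hσr'.trans h1
    rw [div_mul_eq_mul_div, le_div_iff₀ (by positivity)] at h2
    linarith
  have hσP : P * σ ≤ θ := by
    have h1 : r / (8 * (k + 1)) ≤ 1 := by
      rw [div_le_one (by positivity)]
      linarith
    have h2 : r / (8 * (k + 1)) / P * θ ≤ 1 / P * θ :=
      mul_le_mul_of_nonneg_right (div_le_div_of_nonneg_right h1 (by positivity)) hθ.le
    have h3 := hσr'.trans h2
    rw [div_mul_eq_mul_div, one_mul, le_div_iff₀ (by positivity)] at h3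
    linarith
  -- Since `σ * p ^ b ≥ 1`, every part has size at least one before rounding, so the floor at most
  -- halves it.
  have hbig : ∀ j ≤ k, (P : ℝ) ≤ θ * p ^ j := by
    intro j hj
    have h1 : p ^ b ≤ p ^ j := pow_le_pow_of_le_one hp.le hp1 (hj.trans hR.k_le)
    have h2 := hR.big
    have h3 : 0 < p ^ b := by positivity
    calc (P : ℝ) ≤ P * (σ * p ^ b) := by nlinarith
      _ = P * σ * p ^ b := by ring
      _ ≤ θ * p ^ j := mul_le_mul hσP h1 h3.le hθ.le
  -- the parts
  let ex : (Fin mL ⊕ Fin mL) ⊕ Fin k → ℕ := Sum.elim (Sum.elim J J) fun _ => 0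
  let A : (Fin mL ⊕ Fin mL) ⊕ Fin k → Finset V := Sum.elim
    (Sum.elim (fun i => nb G (e.take (J i)) Z) fun i => nb G (s.take (J i)) Z) fun _ => Z
  have hexk : ∀ i, ex i ≤ k := by
    rintro ((i | i) | i)
    · exact hJ i
    · exact hJ i
    · exact Nat.zero_le _
  have hA : ∀ i, θ * p ^ ex i ≤ (A i).card := by
    rintro ((i | i) | i)
    · exact hTe _ (hJ i)
    · exact hTs _ (hJ i)
    · have := hTe 0 (by omega)
      simpa [ex, A] using this
  obtain ⟨D, hDA, hDc, hDD⟩ := exists_disjoint_subsets A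
    (fun i => ⌊θ * p ^ ex i / P⌋₊) (by
      intro i
      have h1 : (⌊θ * p ^ ex i / P⌋₊ : ℝ) ≤ θ * p ^ ex i / P := Nat.floor_le (by positivity)
      have h2 : (Fintype.card ((Fin mL ⊕ Fin mL) ⊕ Fin k) : ℝ) ≤ P := by
        simp only [Fintype.card_sum, Fintype.card_fin, hP]
        push_cast
        linarith
      have h3 := mul_le_mul h2 h1 (Nat.cast_nonneg _) (by positivity)
      rw [mul_div_cancel₀ _ (by positivity)] at h3
      exact_mod_cast h3.trans (hA i))
  have hDlow : ∀ i, 1 / (2 * P) * θ * p ^ ex i ≤ (D i).card := by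
    intro i
    rw [hDc]
    have h1 : 1 ≤ θ * p ^ ex i / P := by
      rw [one_le_div (by positivity)]; exact hbig _ (hexk i)
    have h2 := Nat.lt_floor_add_one (θ * p ^ ex i / P)
    have h3 : (1 : ℝ) ≤ ⌊θ * p ^ ex i / P⌋₊ := by exact_mod_cast (Nat.one_le_floor_iff _).2 h1
    have h4 : 1 / (2 * P) * θ * p ^ ex i = θ * p ^ ex i / P / 2 := by field_simp
    rw [h4]
    linarith
  have hDup : ∀ i, (D i).card ≤ θ * p ^ ex i := by
    intro i
    rw [hDc]
    refine (Nat.floor_le (by positivity)).trans (div_le_self (by positivity) hPpos)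
  let U : ℕ → Finset V := fun j => if h : j < k then D (Sum.inr ⟨j, h⟩) else ∅
  have hU : ∀ j (h : j < k), U j = D (Sum.inr ⟨j, h⟩) := fun j h => by simp [U, h]
  have hUl : ∀ j < k, 1 / (2 * P) * θ ≤ (U j).card := by
    intro j hj
    rw [hU j hj]
    simpa [ex] using hDlow (Sum.inr ⟨j, hj⟩)
  have hUu : ∀ j < k, (U j).card ≤ θ := by
    intro j hj
    rw [hU j hj]
    simpa [ex] using hDup (Sum.inr ⟨j, hj⟩)
  have hUU : ∀ i < k, ∀ j < k, i ≠ j → Disjoint (U i) (U j) := by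
    intro i hi j hj hij
    rw [hU i hi, hU j hj]
    exact hDD _ _ (by simpa using hij)
  have hrP : r ≤ 1 / (2 * P) := hrr.trans hr₁P
  have hrt : ∀ x : ℝ, 0 ≤ x → r * θ * x ≤ 1 / (2 * P) * θ * x := fun x hx =>
    mul_le_mul_of_nonneg_right (mul_le_mul_of_nonneg_right hrP hθ.le) hx
  have hHe := H V G p σ N θ e (fun i => D (Sum.inl (Sum.inl i))) U hR hθ hσκ hN he hKe
    (fun i v hv a ha => (mem_nb.1 (hDA _ hv)).2 a ha)
    (fun i => (hrt _ (by positivity)).trans (hDlow (Sum.inl (Sum.inl i))))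
    (fun i => hDup (Sum.inl (Sum.inl i)))
    (fun j hj => by have := hrt 1 zero_le_one; rw [mul_one, mul_one] at this; exact this.trans (hUl j hj)) hUu
    (fun i j hij => hDD _ _ (by simpa using hij))
    (fun i j hj => by rw [hU j hj]; exact hDD _ _ (by simp)) hUU
  have hHs := H V G p σ N θ s (fun i => D (Sum.inl (Sum.inr i))) (fun j => U (k - 1 - j)) hR hθ hσκ hN
    hs hKs (fun i v hv a ha => (mem_nb.1 (hDA _ hv)).2 a ha)
    (fun i => (hrt _ (by positivity)).trans (hDlow (Sum.inl (Sum.inr i))))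
    (fun i => hDup (Sum.inl (Sum.inr i)))
    (fun j hj => by
      have := hrt 1 zero_le_one; rw [mul_one, mul_one] at this; exact this.trans (hUl _ (by omega)))
    (fun j hj => hUu _ (by omega))
    (fun i j hij => hDD _ _ (by simpa using hij))
    (fun i j hj => by rw [hU _ (by omega)]; exact hDD _ _ (by simp))
    (fun i hi j hj hij => hUU _ (by omega) _ (by omega) (by omega))
  by_contra hcon
  have h2k : (1 : ℝ) ≤ 2 ^ k := one_le_pow₀ (by norm_num)
  have e4 : (4 : ℝ) ^ k = 2 ^ k * 2 ^ k := by rw [← mul_pow]; norm_num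
  have hr₁θ : 1 / (2 * P) * θ / 2 ^ k / 2 ^ k = θ * r₁ := by
    rw [hr₁, e4]; field_simp
  have htrue := many_true (w := 1 / (2 * P) * θ) (ctx := []) hR
    (L := window (fun j => (U j, 0)) 0 k) (fun B hB => by
      obtain ⟨j, hj, rfl⟩ := mem_window hB; rfl) (by simp) (by
      rw [length_window]
      have h1 : θ * r₁ ≤ 1 / (2 * P) * θ / 2 ^ k := by
        rw [← hr₁θ]
        exact div_le_self (by positivity) h2k
      nlinarith) (fun B hB => by
        obtain ⟨j, hj, rfl⟩ := mem_window hB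
        simpa using hUl j hj)
  rw [length_window] at htrue
  -- A block reachable from `e` and, read backwards, from `s` would join the two paths. Hence every
  -- block fails on one side, and one kind of failure occurs for many blocks.
  have hor := Many.mono_chosen (Q' := fun τ => ¬ Reach G k e
      (univ.biUnion fun i => D (Sum.inl (Sum.inl i))) mL τ ∨
      ¬ Reach G k s (univ.biUnion fun i => D (Sum.inl (Sum.inr i))) mL τ.reverse)
    (fun τ hτ _ => by
      by_contra hboth
      rw [not_or, not_not, not_not] at hboth
      obtain ⟨⟨y, y1, y2, y3, y4⟩, y', z1, z2, z3, z4⟩ := hboth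
      have hτl : τ.length = k := by rw [hτ.length]; simp
      have hτp := hτ.pairwise List.Pairwise.nil
      have hτU : ∀ v ∈ τ, ∃ j : Fin k, v ∈ D (Sum.inr j) := by
        intro v hv
        rcases hτ.mem hv with h | ⟨B, hB, h⟩
        · simp at h
        · obtain ⟨j, hj, rfl⟩ := mem_window hB
          refine ⟨⟨j, hj⟩, ?_⟩
          rw [← hU j hj]
          simpa using h
      have hyD : ∀ v ∈ y, ∃ i, v ∈ D (Sum.inl (Sum.inl i)) := fun v hv => by
        simpa using y2 v hv
      have hyD' : ∀ v ∈ y', ∃ i, v ∈ D (Sum.inl (Sum.inr i)) := fun v hv => by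
        simpa using z2 v hv
      have hdis : ∀ i j, i ≠ j → ∀ v, v ∈ D i → v ∈ D j → False := fun i j hij v h1 h2 =>
        disjoint_left.1 (hDD i j hij) h1 h2
      have hAZ : ∀ i, A i ⊆ Z := by
        rintro ((i | i) | i)
        · exact nb_subset _ _
        · exact nb_subset _ _
        · exact subset_rfl
      refine hcon ⟨y.reverse ++ τ.reverse ++ y', ?_, ?_, ?_, ?_⟩
      · rw [List.nodup_append', List.nodup_append', List.nodup_reverse, List.nodup_reverse]
        refine ⟨⟨y1, nodup_of_pairwise_adj hτp, ?_⟩, z1, ?_⟩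
        · intro v hv hv'
          obtain ⟨i, hi⟩ := hyD v (by simpa using hv)
          obtain ⟨j, hj⟩ := hτU v (by simpa using hv')
          exact hdis _ _ (by simp) v hi hj
        · intro v hv hv'
          obtain ⟨i, hi⟩ := hyD' v hv'
          rw [List.mem_append] at hv
          rcases hv with hv | hv
          · obtain ⟨j, hj⟩ := hyD v (by simpa using hv)
            exact hdis _ _ (by simp) v hi hj
          · obtain ⟨j, hj⟩ := hτU v (by simpa using hv)
            exact hdis _ _ (by simp) v hi hj
      · intro v hv
        rw [List.mem_append, List.mem_append] at hv
        rcases hv with (hv | hv) | hv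
        · obtain ⟨i, hi⟩ := hyD v (by simpa using hv)
          exact hAZ _ (hDA _ hi)
        · obtain ⟨i, hi⟩ := hτU v (by simpa using hv)
          exact hAZ _ (hDA _ hi)
        · obtain ⟨i, hi⟩ := hyD' v hv
          exact hAZ _ (hDA _ hi)
      · simp [y3, z3, hτl, add_assoc]
      · have g1 := y4.reverse
        rw [List.reverse_append, List.reverse_append, ← List.append_assoc] at g1
        rw [List.append_assoc] at z4
        have := g1.glue z4 (by simp [hτl])
        simpa [List.append_assoc] using this) htrue
  have hθr₁ : θ * r₁ ≤ θ * 1 := mul_le_mul_of_nonneg_left hr₁1 hθ.le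
  rcases hor.or hp.le (by positivity) with h1 | h1
  · rw [length_window, hr₁θ] at h1
    exact hHe (h1.mono hp.le (by nlinarith) (List.Perm.refl _) fun _ _ => id)
  · rw [length_window, hr₁θ] at h1
    have hrev := revC_smul (n := k) (c := r₁) (M := 1) hθ
    rw [mul_one] at hrev hθr₁
    -- Failures towards `s` are counted here in the order opposite to that in which a path from `s`
    -- meets the sets.
    have h2 := h1.reverse (M := θ) (Q' := fun τ => ¬ Reach G k s
      (univ.biUnion fun i => D (Sum.inl (Sum.inr i))) mL τ) hR (by positivity) hθr₁ ?_ ?_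
      (by simp) (by rw [length_window, hrev]; linarith) ?_ ?_ (fun t ht hq => by simpa using hq)
    · refine hHs ?_
      have e5 : (window (fun j => (U j, 0)) 0 k).reverse =
          window (fun j => (U (k - 1 - j), 0)) 0 k := by
        apply List.ext_getElem
        · simp
        · intro i h1 h2
          simp [window]
      rw [e5, length_window, hrev] at h2
      exact h2.mono hp.le (by rw [mul_comm]) (List.Perm.refl _) fun _ _ => id
    · rw [List.pairwise_iff_getElem]
      intro i j hi hj hij
      rw [length_window] at hi hj
      simp only [window, List.getElem_map, List.getElem_range, zero_add]
      exact hUU i hi j hj hij.ne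
    · intro B hB
      obtain ⟨j, hj, rfl⟩ := mem_window hB; rfl
    · rw [length_window]
      refine le_trans (mul_le_mul_of_nonneg_right ?_ hθ.le) hN
      rw [pow_mul]
      norm_num
      exact pow_le_pow_right₀ (by norm_num) (by omega)
    · intro B hB
      obtain ⟨j, hj, rfl⟩ := mem_window hB
      simpa using hUu j hj

end PowHam

/-! ### Squares of paths: reaching blocks through a hub -/

namespace PowHam

open Finset

section

variable {V : Type*} [DecidableEq V] {G : SimpleGraph V} [DecidableRel G.Adj]

lemma RgL.exists_good {p η x y : ℝ} (h : RgL G p η x y) {X : Finset V}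
    (Ys : List (Finset V))
    (hY : ∀ Y ∈ Ys, y ≤ Y.card) (hX : Ys.length * x < X.card) :
    ∃ v ∈ X, ∀ Y ∈ Ys, (1 - η) * p * Y.card ≤ (nb G [v] Y).card := by
  have h1 := h.pick X Ys hY
  have h2 : (0 : ℝ) < (X.filter fun v => ∀ Y ∈ Ys, (1 - η) * p * Y.card ≤
      (nb G [v] Y).card).card := by linarith
  obtain ⟨v, hv⟩ := card_pos.1 (Nat.cast_pos.1 h2)
  exact ⟨v, (mem_filter.1 hv).1, (mem_filter.1 hv).2⟩

lemma exists_subset_card_between {S : Finset V} {x : ℝ} (hx : x ≤ S.card) :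
    ∃ T ⊆ S, x ≤ T.card ∧ (T.card : ℝ) ≤ max x 0 + 1 := by
  obtain ⟨T, hT, hc⟩ := exists_subset_card_eq (s := S) (n := ⌈x⌉₊) (Nat.ceil_le.2 hx)
  refine ⟨T, hT, ?_, ?_⟩
  · rw [hc]; exact Nat.le_ceil x
  · rw [hc]
    rcases le_total 0 x with h | h
    · exact (Nat.ceil_lt_add_one h).le.trans (by linarith [le_max_left x 0])
    · rw [Nat.ceil_eq_zero.2 h]
      have := le_max_right x 0
      push_cast
      linarith

lemma half_le {p a y m : ℝ} (hp : 0 ≤ p) (h : (1 - 1 / 2) * p * y ≤ m) (ha : a ≤ y) :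
    a * p / 2 ≤ m := by
  have := mul_le_mul_of_nonneg_left ha hp
  linarith

lemma scale_le {p θ' σ : ℝ} (hp : 0 ≤ p) (h : σ ≤ θ') (i : ℕ) : σ * p ^ i ≤ θ' * p ^ i :=
  mul_le_mul_of_nonneg_right h (by positivity)

/-- A triangle is chosen greedily so that the later sets keep their share. Since `Z` may be any set
of size `t / 2`, the statement can be applied to a putative set of bad third vertices. -/
lemma exists_square_start {p σ t : ℝ} (hp : 0 < p) (hp1 : p ≤ 1) (hσ0 : 0 < σ)
    (R20 : RgL G p (1 / 2) (σ * p ^ 2) (σ * p)) (hσ : σ ≤ t / 64)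
    {B₀ B₁ Z B₃ : Finset V} (h₀ : t * p ^ 2 ≤ B₀.card) (h₁ : t * p ≤ B₁.card)
    (hZ : t / 2 ≤ Z.card) (h₃ : t ≤ B₃.card) :
    ∃ z₁ ∈ B₀, ∃ z₂ ∈ B₁, ∃ z₃ ∈ Z, G.Adj z₁ z₂ ∧ G.Adj z₁ z₃ ∧ G.Adj z₂ z₃ ∧
      t / 4 * p ^ 2 ≤ (nb G [z₃] (nb G [z₂] B₃)).card := by
  have s1 : σ * p ≤ t / 64 * p := by simpa using scale_le hp.le hσ 1
  have s2 := scale_le hp.le hσ 2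
  have ht : 0 < t := by linarith
  have hp2 : p ^ 2 ≤ p := by nlinarith
  have t2 : t * p ≤ t := mul_le_of_le_one_right ht.le hp1
  have t3 : 0 < t * p ^ 2 := by positivity
  have t4 : 0 < t * p := by positivity
  obtain ⟨z₁, hz₁, hz₁'⟩ := R20.exists_good (X := B₀) [B₁, Z] (by
    intro Y hY
    simp only [List.mem_cons, List.not_mem_nil, or_false] at hY
    rcases hY with rfl | rfl <;> linarith) (by
    simp only [List.length_cons, List.length_nil]
    push_cast
    linarith)
  have g1 := half_le hp.le (hz₁' B₁ (by simp)) h₁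
  have g2 := half_le hp.le (hz₁' Z (by simp)) hZ
  obtain ⟨z₂, hz₂, hz₂'⟩ := R20.exists_good (X := nb G [z₁] B₁)
    [B₃, nb G [z₁] Z] (by
    intro Y hY
    simp only [List.mem_cons, List.not_mem_nil, or_false] at hY
    rcases hY with rfl | rfl <;> linarith) (by
    simp only [List.length_cons, List.length_nil]
    push_cast
    linarith)
  have g3 := half_le hp.le (hz₂' B₃ (by simp)) h₃
  have g4 := half_le hp.le (hz₂' (nb G [z₁] Z) (by simp)) g2
  obtain ⟨z₃, hz₃, hz₃'⟩ := R20.exists_good (X := nb G [z₂] (nb G [z₁] Z))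
    [nb G [z₂] B₃] (by
    intro Y hY
    simp only [List.mem_cons, List.not_mem_nil, or_false] at hY
    rcases hY with rfl
    linarith) (by
    simp only [List.length_cons, List.length_nil]
    push_cast
    linarith)
  have g5 := half_le hp.le (hz₃' (nb G [z₂] B₃) (by simp)) g3
  simp only [mem_nb_one] at hz₂ hz₃
  exact ⟨z₁, hz₁, z₂, hz₂.1, z₃, hz₃.1.1, hz₂.2, hz₃.1.2, hz₃.2, by linarith⟩

/-- A vertex with many predecessors, by averaging over a bipartite relation. -/
lemma exists_many_below {α β : Type*} (H : α → β → Prop)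
    [∀ a b, Decidable (H a b)] (C : Finset α) (D : Finset β)
    {x y d : ℝ} (hx : 0 < x) (hy : 0 < y) (hd : D.card ≤ d) (hC : x ≤ C.card)
    (hdeg : ∀ a ∈ C, y ≤ (bipartiteAbove H D a).card) :
    ∃ w ∈ D, x * y / d ≤ (bipartiteBelow H C w).card := by
  have hdc := sum_card_bipartiteAbove_eq_sum_card_bipartiteBelow (s := C) (t := D) H
  by_contra hno
  push Not at hno
  have hlow : x * y ≤ ((∑ a ∈ C, (bipartiteAbove H D a).card : ℕ) : ℝ) := by
    push_cast
    refine le_trans (mul_le_mul_of_nonneg_right hC hy.le) ?_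
    rw [← nsmul_eq_mul]
    exact card_nsmul_le_sum _ _ _ hdeg
  have hDne : D.Nonempty := by
    have hCne : (0 : ℝ) < C.card := lt_of_lt_of_le hx hC
    obtain ⟨a, ha⟩ := card_pos.1 (Nat.cast_pos.1 hCne)
    have h1 : (0 : ℝ) < (bipartiteAbove H D a).card := lt_of_lt_of_le hy (hdeg a ha)
    obtain ⟨w, hw⟩ := card_pos.1 (Nat.cast_pos.1 h1)
    exact ⟨w, (mem_filter.1 hw).1⟩
  have hd0 : 0 < d := lt_of_lt_of_le (Nat.cast_pos.2 (card_pos.2 hDne)) hd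
  have hupp : ((∑ w ∈ D, (bipartiteBelow H C w).card : ℕ) : ℝ) < d * (x * y / d) := by
    push_cast
    refine (sum_lt_sum_of_nonempty hDne hno).trans_le ?_
    rw [sum_const, nsmul_eq_mul]
    exact mul_le_mul_of_nonneg_right hd (by positivity)
  rw [mul_div_cancel₀ _ hd0.ne'] at hupp
  rw [hdc] at hlow
  linarith

/-- In squares of paths, a vertex `w` at distance four from a typical end block that has many
reachable predecessors. -/
lemma exists_hub {b : ℕ} {p σ N θ r : ℝ} (hR : Reg G 2 b p σ N) (hθ : 0 < θ) (hr : 0 < r)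
    (hσ : σ ≤ r * θ / 64) {B₀ B₁ B₂ B₃ B₄ B₅ : Finset V}
    (h₀ : r * θ * p ^ 2 ≤ B₀.card) (h₁ : r * θ * p ≤ B₁.card) (h₂ : r * θ ≤ B₂.card)
    (h₃ : r * θ ≤ B₃.card) (h₃' : B₃.card ≤ θ) (h₄ : r * θ ≤ B₄.card) (h₅ : r * θ ≤ B₅.card) :
    ∃ w ∈ B₃, ∃ A ⊆ B₂, r ^ 2 / 16 * θ * p ^ 2 ≤ A.card ∧ r / 2 * θ * p ≤ (nb G [w] B₄).card ∧
      r / 2 * θ * p ≤ (nb G [w] B₅).card ∧ ∀ a ∈ A, ∃ z₁ ∈ B₀, ∃ z₂ ∈ B₁,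
        G.Adj z₁ z₂ ∧ G.Adj z₁ a ∧ G.Adj z₂ a ∧ G.Adj z₂ w ∧ G.Adj a w := by
  classical
  have hp := hR.p_pos
  have hp1 := hR.p_le
  have hσ0 := hR.σ_pos
  have hb := hR.k_le
  have hrθ : 0 < r * θ := by positivity
  have R20 : RgL G p (1 / 2) (σ * p ^ 2) (σ * p ^ 1) :=
    hR.lower 2 1 (Or.inr ⟨by omega, by omega⟩)
  rw [pow_one] at R20
  have R20' : RgL G p (1 / 2) (σ * p ^ 2) σ :=
    R20.mono le_rfl (mul_le_of_le_one_right hσ0.le hp1)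
  let H : V → V → Prop := fun a w => ∃ z₁ ∈ B₀, ∃ z₂ ∈ B₁,
    G.Adj z₁ z₂ ∧ G.Adj z₁ a ∧ G.Adj z₂ a ∧ G.Adj z₂ w ∧ G.Adj a w
  -- Third vertices with many possible hubs. If `C` were small, `exists_square_start` would find in
  -- `B₂ \ C` a vertex that qualifies for `C`.
  set C := B₂.filter fun a => r * θ / 4 * p ^ 2 ≤ (B₃.filter fun w => H a w).card with hC
  have hCc : r / 2 * θ ≤ C.card := by
    by_contra hlt
    rw [not_le] at hlt
    have hZc : r * θ / 2 ≤ (B₂ \ C).card := by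
      have h1 : B₂.card ≤ (B₂ \ C).card + C.card := card_le_card_sdiff_add_card
      have h2 : (B₂.card : ℝ) ≤ (B₂ \ C).card + C.card := by exact_mod_cast h1
      linarith
    obtain ⟨z₁, hz₁, z₂, hz₂, z₃, hz₃, q1, q2, q3, q4⟩ :=
      exists_square_start hp hp1 hσ0 R20 hσ h₀ h₁ hZc h₃
    rw [mem_sdiff, hC, mem_filter] at hz₃
    refine hz₃.2 ⟨hz₃.1, q4.trans (Nat.cast_le.2 (card_le_card fun w hw => ?_))⟩
    simp only [mem_nb_one] at hw
    rw [mem_filter]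
    exact ⟨hw.1.1, z₁, hz₁, z₂, hz₂, q1, q2, q3, hw.1.2, hw.2⟩
  set D := B₃.filter fun w => ∀ Y ∈ [B₄, B₅], (1 - 1 / 2) * p * Y.card ≤ (nb G [w] Y).card with hD
  have hdeg : ∀ a ∈ C, r / 8 * θ * p ^ 2 ≤ (bipartiteAbove H D a).card := by
    intro a ha
    rw [hC, mem_filter] at ha
    have h1 := R20'.pick (B₃.filter fun w => H a w) [B₄, B₅] (by
      intro Y hY
      simp only [List.mem_cons, List.not_mem_nil, or_false] at hY
      rcases hY with rfl | rfl <;> linarith)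
    simp only [List.length_cons, List.length_nil] at h1
    have h2 : ((B₃.filter fun w => H a w).filter fun w => ∀ Y ∈ [B₄, B₅],
        (1 - 1 / 2) * p * (Y.card : ℝ) ≤ (nb G [w] Y).card) ⊆ bipartiteAbove H D a := by
      intro w hw
      rw [mem_filter, mem_filter] at hw
      rw [bipartiteAbove, mem_filter, hD, mem_filter]
      tauto
    refine le_trans ?_ (Nat.cast_le.2 (card_le_card h2))
    refine le_trans ?_ h1
    have h4 := scale_le hp.le hσ 2
    have h5 : 0 < r * θ * p ^ 2 := by positivity
    push_cast
    linarith [ha.2]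
  obtain ⟨w, hw, hwA⟩ := exists_many_below H C D (x := r / 2 * θ) (y := r / 8 * θ * p ^ 2) (d := θ)
    (by positivity) (by positivity)
    (le_trans (Nat.cast_le.2 (card_le_card (filter_subset _ _))) h₃') hCc hdeg
  rw [hD, mem_filter] at hw
  have g1 := half_le hp.le (hw.2 B₄ (by simp)) h₄
  have g2 := half_le hp.le (hw.2 B₅ (by simp)) h₅
  refine ⟨w, hw.1, bipartiteBelow H C w, ?_, ?_, by linarith, by linarith, fun a ha => ?_⟩
  · exact (filter_subset _ _).trans (filter_subset _ _)
  · refine le_trans (le_of_eq ?_) hwA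
    field_simp
    ring
  · exact (mem_filter.1 ha).2

end

set_option maxHeartbeats 1600000 in
-- Pulling back through a set of exponent `2` would need exponent `3`, which `b = 2` does not
-- provide. Instead a hub `w` is fixed that has many reachable predecessors `A`. The next vertex has
-- to be adjacent to `w` and to some member of `A`, which regularity grants to nearly all neighbours
-- of `w`; the one after it has to be adjacent to `w` only. Both sets thus have exponent `1`, and
-- two pull-back steps suffice.
lemma leftOK_two {b : ℕ} : LeftOK.{u} 2 b 6 ![2, 1, 0, 0, 0, 0] := by
  intro r hr hr1
  have hst := stepC_iterate (k := 2) (c := r / 16) (M := 1) (by positivity) (by linarith) 2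
  -- The first bound is for the hub, whose predecessor set has relative size `r ^ 2 / 16`. The
  -- second is the loss of two steps started from `r / 16 = (r / 4) / 2 ^ 2`.
  refine ⟨min (r ^ 2 / 64) ((stepC 2 1)^[2] (r / 16) / 8),
    lt_min (by positivity) (by linarith [hst.1]), ?_⟩
  intro V _ G _ p σ N θ e B U hR hθ hσ hN he hKe hB hB1 hB2 hU1 hU2 hBB hBU hUU hM
  have hp := hR.p_pos
  have hp1 := hR.p_le
  have hσ0 := hR.σ_pos
  have hb := hR.k_le
  have hσ1 : σ ≤ r ^ 2 / 64 * θ := hσ.trans (mul_le_mul_of_nonneg_right (min_le_left _ _) hθ.le)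
  have hσ2 : σ ≤ (stepC 2 1)^[2] (r / 16) / 8 * θ :=
    hσ.trans (mul_le_mul_of_nonneg_right (min_le_right _ _) hθ.le)
  have hrr : r ^ 2 ≤ r := by nlinarith
  have hσ' : σ ≤ r / 64 * θ := hσ1.trans (mul_le_mul_of_nonneg_right (by linarith) hθ.le)
  obtain ⟨e₁, e₂, rfl⟩ := List.length_eq_two.1 he
  have b0 := hB1 0
  have b1 := hB1 1
  have b2 := hB1 2
  have b3 := hB1 3
  have b4 := hB1 4
  have b5 := hB1 5
  have b3' := hB2 3
  simp only [Fin.isValue, Matrix.cons_val, pow_one, pow_zero, mul_one] at b0 b1 b2 b3 b4 b5 b3'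
  obtain ⟨w, hw, A, hA, hAc, hw4, hw5, hAH⟩ := exists_hub hR hθ hr (hσ'.trans (by linarith)) b0 b1 b2 b3 b3' b4 b5
  -- the next two sets
  have hbig : 64 ≤ θ * p := by
    have h1 := hR.big
    have h2 : p ^ b ≤ p ^ 1 := pow_le_pow_of_le_one hp.le hp1 (by omega)
    rw [pow_one] at h2
    have h3 : σ * p ^ b ≤ θ / 64 * p := mul_le_mul (by nlinarith) h2 (by positivity) (by positivity)
    linarith
  have R12 := hR.lower 1 2 (Or.inl ⟨by omega, by omega⟩)
  have hAσ : σ * p ^ 2 ≤ A.card :=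
    (mul_le_mul_of_nonneg_right (by nlinarith) (by positivity)).trans hAc
  have hA0 : (0 : ℝ) < A.card := lt_of_lt_of_le (by positivity) hAσ
  have hbad := R12.card_bad_lt (nb G [w] (B 4)) hAσ
  rw [pow_one] at hbad
  -- Although `A` is only of order `θ * p ^ 2`, regularity at exponents `(1, 2)` leaves at most `σ *
  -- p` vertices without a neighbour in it.
  have hV5 := card_filter_and_ge (nb G [w] (B 4)) (fun _ => True)
    (fun v => ∃ a ∈ A, G.Adj a v) (x := r / 2 * θ * p) (y := σ * p) (by rwa [filter_true]) (by
      classical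
      refine le_trans (Nat.cast_le.2 (card_le_card fun v hv => ?_)) hbad.le
      rw [mem_filter] at hv ⊢
      refine ⟨hv.1, ?_⟩
      have : nb G [v] A = ∅ := by
        rw [eq_empty_iff_forall_notMem]
        intro a ha
        rw [mem_nb_one] at ha
        exact hv.2 ⟨a, ha.1, ha.2.symm⟩
      rw [this, not_le, card_empty, Nat.cast_zero]
      have : (0 : ℝ) < 1 - 1 / 2 := by norm_num
      positivity)
  simp only [true_and] at hV5
  -- Trimmed so that the upper bound required for reordering holds; `θ * p ≥ 64` absorbs the
  -- rounding.
  obtain ⟨V₅, hV₅, hV₅l, hV₅u⟩ := exists_subset_card_between (x := r / 4 * θ * p) (le_trans (by nlinarith) hV5)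
  obtain ⟨V₆, hV₆, hV₆l, hV₆u⟩ := exists_subset_card_between (x := r / 4 * θ * p)
    (S := nb G [w] (B 5)) (le_trans (by nlinarith) hw5)
  rw [max_eq_left (by positivity)] at hV₅u hV₆u
  have hV₅B : V₅ ⊆ B 4 := hV₅.trans ((filter_subset _ _).trans (nb_subset _ _))
  have hV₆B : V₆ ⊆ B 5 := hV₆.trans (nb_subset _ _)
  let W : ℕ → Finset V × ℕ := fun i => if i = 0 then (V₅, 1) else if i = 1 then (V₆, 1) else
    (U (i - 2), 0)
  have W0 : W 0 = (V₅, 1) := rfl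
  have W1 : W 1 = (V₆, 1) := rfl
  have W2 : W 2 = (U 0, 0) := rfl
  have W3 : W 3 = (U 1, 0) := rfl
  have hst2 := stepC_iterate_smul (k := 2) (n := 2) (c := r / 16) (M := 1) hθ
  rw [mul_one] at hst2
  set Y : Finset V := B 0 ∪ B 1 ∪ B 2 ∪ B 3 with hY
  have hsubY : Y ∪ ((range 2).biUnion fun i => (W i).1) ⊆ univ.biUnion B := by
    refine union_subset ?_ ?_
    · rw [hY]
      refine union_subset (union_subset (union_subset ?_ ?_) ?_) ?_ <;>
        exact subset_biUnion_of_mem B (mem_univ _)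
    · intro v hv
      obtain ⟨i, hi, hv⟩ := mem_biUnion.1 hv
      rw [mem_range] at hi
      interval_cases i
      · exact mem_biUnion.2 ⟨4, mem_univ _, hV₅B hv⟩
      · exact mem_biUnion.2 ⟨5, mem_univ _, hV₆B hv⟩
  have d5 : ∀ X, Disjoint (B 4) X → Disjoint V₅ X := fun X h => disjoint_of_subset_left hV₅B h
  have d6 : ∀ X, Disjoint (B 5) X → Disjoint V₆ X := fun X h => disjoint_of_subset_left hV₆B h
  have h1 := many_steps (c := θ * (r / 16)) (M := θ) (w := r / 4 * θ) (n := 2) (Y := Y) (m := 4)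
    (W := W) (e := [e₁, e₂]) hR ?_ ?_ (by positivity) (by nlinarith) (by ring_nf; rfl)
    ?_ ?_ ?_ ?_ ?_ ?_ ?_ ?_
  · obtain ⟨τ, hτ, hq⟩ := h1.exists_chosen hp (by rw [hst2]; exact mul_pos hθ hst.1)
    rw [window_succ, window_succ] at hτ
    obtain ⟨z₅, hz₅, z₆, hz₆, hτ⟩ := hτ
    have hτ : τ = [z₆, z₅] := hτ
    subst hτ
    rw [W0, nb_nil] at hz₅
    rw [zero_add, W1, mem_nb_one] at hz₆
    have hz5' := hV₅ hz₅
    rw [mem_filter, mem_nb_one] at hz5'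
    obtain ⟨⟨hz5B, hwz5⟩, a, ha, haz5⟩ := hz5'
    obtain ⟨hz6B, hwz6⟩ := mem_nb_one.1 (hV₆ hz₆.1)
    obtain ⟨z₁, hz₁, z₂, hz₂, q1, q2, q3, q4, q5⟩ := hAH a ha
    have haB := hA ha
    have nd : ∀ i j, i ≠ j → ∀ v u, v ∈ B i → u ∈ B j → v ≠ u := fun i j hij v u hv hu hvu =>
      disjoint_left.1 (hBB i j hij) hv (hvu ▸ hu)
    refine hq ⟨[w, a, z₂, z₁], ?_, ?_, rfl, ?_⟩
    · simp only [List.nodup_cons, List.mem_cons, List.not_mem_nil, or_false, not_or,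
        List.nodup_nil, not_false_eq_true, and_true]
      exact ⟨⟨nd 3 2 (by decide) _ _ hw haB, nd 3 1 (by decide) _ _ hw hz₂,
        nd 3 0 (by decide) _ _ hw hz₁⟩, ⟨nd 2 1 (by decide) _ _ haB hz₂,
        nd 2 0 (by decide) _ _ haB hz₁⟩, nd 1 0 (by decide) _ _ hz₂ hz₁⟩
    · intro v hv
      simp only [List.mem_cons, List.not_mem_nil, or_false] at hv
      simp only [hY, mem_union]
      rcases hv with rfl | rfl | rfl | rfl <;> tauto
    · have a1 := hB 0 z₁ hz₁
      have a2 := hB 1 z₂ hz₂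
      simp at a1 a2
      have k1 : KPath G 2 [z₁, e₁, e₂] := hKe.cons (by simpa using a1)
      have k2 : KPath G 2 [z₂, z₁, e₁, e₂] := k1.cons (by simpa using ⟨q1, a2⟩)
      have k3 : KPath G 2 [a, z₂, z₁, e₁, e₂] := k2.cons (by simpa using ⟨q3, q2⟩)
      have k4 : KPath G 2 [w, a, z₂, z₁, e₁, e₂] := k3.cons (by simpa using ⟨q5, q4⟩)
      have k5 : KPath G 2 [z₅, w, a, z₂, z₁, e₁, e₂] := k4.cons (by simpa using ⟨hwz5, haz5⟩)
      exact k5.cons (by simpa using ⟨hz₆.2, hwz6⟩)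
  · intro i hi
    rw [hY, disjoint_union_right, disjoint_union_right, disjoint_union_right]
    interval_cases i
    · exact ⟨⟨⟨d5 _ (hBB _ _ (by decide)), d5 _ (hBB _ _ (by decide))⟩,
        d5 _ (hBB _ _ (by decide))⟩, d5 _ (hBB _ _ (by decide))⟩
    · exact ⟨⟨⟨d6 _ (hBB _ _ (by decide)), d6 _ (hBB _ _ (by decide))⟩,
        d6 _ (hBB _ _ (by decide))⟩, d6 _ (hBB _ _ (by decide))⟩
  · have hd : ∀ i j, i < j → j < 2 + 2 → Disjoint (W i).1 (W j).1 := by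
      intro i j hij hj
      have u01 := hUU 0 (by omega) 1 (by omega) (by omega)
      have c1 : Disjoint V₅ V₆ := d5 _ (disjoint_of_subset_right hV₆B (hBB _ _ (by decide)))
      have c2 : Disjoint V₅ (U 0) := d5 _ (hBU 4 0 (by omega))
      have c3 : Disjoint V₅ (U 1) := d5 _ (hBU 4 1 (by omega))
      have c4 : Disjoint V₆ (U 0) := d6 _ (hBU 5 0 (by omega))
      have c5 : Disjoint V₆ (U 1) := d6 _ (hBU 5 1 (by omega))
      interval_cases j <;> interval_cases i <;> assumption
    intro i j hij hi hj
    rcases lt_or_gt_of_ne hij with h | h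
    · exact hd i j h hj
    · exact (hd j i h hi).symm
  · intro i hi j hj
    obtain rfl : j = 0 := by omega
    interval_cases i
    · exact Or.inl ⟨by simp [W1], by simp [W0]; omega⟩
    · exact Or.inl ⟨by simp [W2], by simp [W1]; omega⟩
  · intro i hi
    interval_cases i
    · simp only [W0]; omega
    · simp only [W1]; omega
  · intro i hi
    interval_cases i <;> rfl
  · intro i hi
    interval_cases i
    · simpa [W0] using hV₅l
    · simpa [W1] using hV₆l
  · intro i hi
    interval_cases i
    · simp only [W0, pow_one]; nlinarith
    · simp only [W1, pow_one]; nlinarith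
  · rw [hst2]; nlinarith
  · refine le_trans (mul_le_mul_of_nonneg_right ?_ hθ.le) hN
    norm_num
  · have hwin : window W 2 2 = window (fun j => (U j, 0)) 0 2 := rfl
    rw [hwin]
    refine hM.mono hp.le ?_ (List.Perm.refl _) fun t ht hq hr => hq ?_
    · nlinarith
    · exact hr.mono hsubY

end PowHam

/-! ### Greedy extension with typical ends -/

namespace PowHam

open Finset

section

variable {V : Type*} [DecidableEq V] {G : SimpleGraph V} [DecidableRel G.Adj]

lemma Typ.mono_len {p θ : ℝ} {k k' : ℕ} {l : List V} {Z : Finset V} (h : Typ G p k θ l Z)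
    (hk : k' ≤ k) : Typ G p k' θ l Z := fun j hj => h j (hj.trans hk)

lemma Typ.mono_prob {p p' θ : ℝ} {k : ℕ} {l : List V} {Z : Finset V} (h : Typ G p k θ l Z)
    (hp' : 0 ≤ p') (hp : p' ≤ p) (hθ : 0 ≤ θ) : Typ G p' k θ l Z := fun j hj =>
  (mul_le_mul_of_nonneg_left (pow_le_pow_left₀ hp' hp j) hθ).trans (h j hj)

/-- Halving the density costs a factor `2 ^ k` in the typicality. -/
lemma Typ.of_half {p θ : ℝ} {k : ℕ} {l : List V} {Z : Finset V}
    (h : Typ G ((1 - 1 / 2) * p) k (2 ^ k * θ) l Z) (hp : 0 ≤ p) (hθ : 0 ≤ θ) :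
    Typ G p k θ l Z := fun j hj => by
  refine le_trans ?_ (h j hj)
  rw [mul_pow, show (1 - 1 / 2 : ℝ) = 2⁻¹ by norm_num, inv_pow]
  have h1 : (1 : ℝ) ≤ 2 ^ k * (2 ^ j)⁻¹ := by
    rw [← div_eq_mul_inv, one_le_div (by positivity)]
    exact pow_le_pow_right₀ (by norm_num) hj
  have h2 : 0 ≤ θ * p ^ j := by positivity
  nlinarith

lemma typ_zero {p θ : ℝ} {l : List V} {Z : Finset V} (h : θ ≤ Z.card) : Typ G p 0 θ l Z :=
  fun j hj => by
    obtain rfl : j = 0 := by omega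
    simpa using h

lemma typ_cons {p θ : ℝ} {k : ℕ} {l : List V} {Z : Finset V} {z : V} (h : θ ≤ Z.card)
    (hz : ∀ j ≤ k, θ * p ^ (j + 1) ≤ (nb G [z] (nb G (l.take j) Z)).card) :
    Typ G p (k + 1) θ (z :: l) Z := by
  intro j hj
  rcases j with _ | j
  · simpa using h
  · rw [List.take_succ_cons, nb_cons]
    exact hz j (by omega)

/-- All but few vertices of `X` extend a list that is typical with respect to several pools. -/
lemma RgL.pick_typ {p η x y : ℝ} (h : RgL G p η x y) (hx : 0 ≤ x) (hp : 0 ≤ (1 - η) * p)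
    (hp1 : (1 - η) * p ≤ 1)
    {l : List V} (X : Finset V) (K : ℕ) (Ws : List (Finset V × ℕ × ℝ))
    (hW : ∀ w ∈ Ws, Typ G ((1 - η) * p) w.2.1 w.2.2 l w.1 ∧ 0 ≤ w.2.2 ∧
      y ≤ w.2.2 * ((1 - η) * p) ^ w.2.1 ∧ w.2.1 + 1 ≤ K) :
    ∃ X' ⊆ X, (X.card : ℝ) - Ws.length * K * x ≤ X'.card ∧
      ∀ z ∈ X', ∀ w ∈ Ws, Typ G ((1 - η) * p) (w.2.1 + 1) w.2.2 (z :: l) w.1 := by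
  -- All the common neighbourhoods, over all pools and block lengths, of which the new vertex has to
  -- keep its share.
  let Ys := Ws.flatMap fun w => (List.range (w.2.1 + 1)).map fun j => nb G (l.take j) w.1
  have hY : ∀ Y ∈ Ys, y ≤ Y.card := by
    intro Y hY
    obtain ⟨w, hw, hY⟩ := List.mem_flatMap.1 hY
    obtain ⟨j, hj, rfl⟩ := List.mem_map.1 hY
    rw [List.mem_range] at hj
    obtain ⟨h1, h2, h3, -⟩ := hW w hw
    refine h3.trans (le_trans ?_ (h1 j (by omega)))
    exact mul_le_mul_of_nonneg_left (pow_le_pow_of_le_one hp hp1 (by omega)) h2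
  have hlen : Ys.length ≤ Ws.length * K := by
    simp only [Ys, List.length_flatMap, List.length_map, List.length_range]
    have h1 := List.sum_le_card_nsmul (Ws.map fun w => w.2.1 + 1) K (by
      intro a ha
      obtain ⟨w, hw, rfl⟩ := List.mem_map.1 ha
      exact (hW w hw).2.2.2)
    simpa using h1
  refine ⟨X.filter fun v => ∀ Y ∈ Ys, (1 - η) * p * Y.card ≤ (nb G [v] Y).card,
    filter_subset _ _, le_trans ?_ (h.pick X Ys hY), ?_⟩
  · have h1 : (Ys.length : ℝ) ≤ Ws.length * K := by exact_mod_cast hlen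
    have := mul_le_mul_of_nonneg_right h1 hx
    linarith
  · intro z hz w hw
    obtain ⟨h1, h2, -, -⟩ := hW w hw
    refine typ_cons (by simpa using h1 0 (by omega)) fun j hj => ?_
    have h3 := (mem_filter.1 hz).2 (nb G (l.take j) w.1)
      (List.mem_flatMap.2 ⟨w, hw, List.mem_map.2 ⟨j, List.mem_range.2 (by omega), rfl⟩⟩)
    refine le_trans ?_ h3
    have := mul_le_mul_of_nonneg_left (h1 j hj) hp
    rw [pow_succ]
    linarith

/-- Greedy extension of a list inside `A` by `m` vertices, each adjacent to the `q` preceding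
ones, gaining typicality with respect to further pools. -/
lemma RgL.exists_extension {p η x y α : ℝ} {q k : ℕ} (h : RgL G p η x y) (hx : 0 ≤ x)
    (hp : 0 ≤ (1 - η) * p) (hp1 : (1 - η) * p ≤ 1) (hq : 1 ≤ q) (hk : 1 ≤ k) (hα : 0 ≤ α)
    {l : List V} {A : Finset V} (hA : Typ G ((1 - η) * p) q α l A)
    (hy : y ≤ α * ((1 - η) * p) ^ (q - 1)) (Ws : List (Finset V × ℝ))
    (hW : ∀ w ∈ Ws, w.2 ≤ w.1.card ∧ 0 ≤ w.2 ∧ y ≤ w.2 * ((1 - η) * p) ^ (k - 1))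
    (m : ℕ) (hm : m + (Ws.length + 1) * (q + k : ℕ) * x < α * ((1 - η) * p) ^ q) :
    ∃ z : List V, z.length = m ∧ z.Nodup ∧ (∀ v ∈ z, v ∈ A) ∧
      (KPath G q l → KPath G q (z ++ l)) ∧ Typ G ((1 - η) * p) q α (z ++ l) A ∧
      ∀ i ≤ m, ∀ w ∈ Ws, Typ G ((1 - η) * p) (min i k) w.2 (z.drop (m - i) ++ l) w.1 := by
  induction m with
  | zero =>
    refine ⟨[], rfl, List.nodup_nil, by simp, by simp, by simpa using hA, fun i hi w hw => ?_⟩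
    obtain rfl : i = 0 := by omega
    rw [Nat.zero_min]
    exact typ_zero (hW w hw).1
  | succ m ih =>
    push_cast at hm
    obtain ⟨z, h1, h2, h3, h4, h5, h6⟩ := ih (by push_cast; linarith)
    -- The candidates are the common neighbours in `A` of the last `q` vertices; by `hm`, more of
    -- them exist than are already used or atypical.
    have hfull := h5 q le_rfl
    obtain ⟨X', hX', hc, hX⟩ := h.pick_typ (l := z ++ l) hx hp hp1
      (nb G ((z ++ l).take q) A \ z.toFinset) (q + k)
      ((A, q - 1, α) :: Ws.map fun w => (w.1, min m (k - 1), w.2)) (by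
      intro w hw
      rcases List.mem_cons.1 hw with rfl | hw
      · exact ⟨h5.mono_len (by simp), hα, hy, by dsimp only; omega⟩
      · obtain ⟨w, hw', rfl⟩ := List.mem_map.1 hw
        obtain ⟨g1, g2, g3⟩ := hW w hw'
        refine ⟨?_, g2, g3.trans ?_, ?_⟩
        · have := h6 m le_rfl w hw'
          rw [Nat.sub_self, List.drop_zero] at this
          exact this.mono_len (by dsimp only; omega)
        · exact mul_le_mul_of_nonneg_left (pow_le_pow_of_le_one hp hp1 (min_le_right _ _)) g2
        · dsimp only; omega)
    have hpos : (0 : ℝ) < X'.card := by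
      have h7 := Finset.le_card_sdiff z.toFinset (nb G ((z ++ l).take q) A)
      have h8 : (nb G ((z ++ l).take q) A).card ≤
          (nb G ((z ++ l).take q) A \ z.toFinset).card + m := by
        have := z.toFinset_card_le
        omega
      have h9 : ((nb G ((z ++ l).take q) A).card : ℝ) ≤
          (nb G ((z ++ l).take q) A \ z.toFinset).card + m := by exact_mod_cast h8
      rw [List.length_cons, List.length_map] at hc
      push_cast at hc
      linarith
    obtain ⟨v, hv⟩ := card_pos.1 (Nat.cast_pos.1 hpos)
    have hv' := hX' hv
    rw [mem_sdiff, mem_nb, List.mem_toFinset] at hv'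
    have hvT := hX v hv
    refine ⟨v :: z, by simp [h1], List.nodup_cons.2 ⟨hv'.2, h2⟩, ?_, ?_, ?_, ?_⟩
    · intro u hu
      rcases List.mem_cons.1 hu with rfl | hu
      · exact hv'.1.1
      · exact h3 u hu
    · intro hl
      exact (h4 hl).cons hv'.1.2
    · have := hvT (A, q - 1, α) List.mem_cons_self
      exact this.mono_len (by dsimp only; omega)
    · intro i hi w hw
      rcases Nat.lt_or_ge i (m + 1) with hlt | hge
      · have := h6 i (by omega) w hw
        rwa [show m + 1 - i = (m - i) + 1 by omega, List.drop_succ_cons]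
      · obtain rfl : i = m + 1 := by omega
        rw [Nat.sub_self, List.drop_zero]
        have := hvT (w.1, min m (k - 1), w.2)
          (List.mem_cons_of_mem _ (List.mem_map.2 ⟨w, hw, rfl⟩))
        exact this.mono_len (by dsimp only; omega)

lemma Seg.extend {k : ℕ} {S R : Finset V} {s e w z : List V} (h : Seg G k S R s e w)
    (hn : z.Nodup) (hz : ∀ v ∈ z, v ∈ S → v ∈ R) (hK : KPath G k (z ++ e)) :
    Seg G k (S ∪ z.toFinset) (R \ z.toFinset) s ((z ++ e).take k) w := by
  induction z with
  | nil => simpa [List.take_of_length_le h.len_e.le] using h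
  | cons v z ih =>
    rw [List.nodup_cons] at hn
    have h1 := ih hn.2 (fun u hu => hz u (List.mem_cons_of_mem _ hu)) (hK.infix ⟨[v], [], by simp⟩)
    have h2 := h1.snoc (z := v) (by
      intro hv
      rw [mem_union, List.mem_toFinset] at hv
      rw [mem_sdiff, List.mem_toFinset]
      exact ⟨hz v List.mem_cons_self (hv.resolve_right hn.1), hn.1⟩) (by
      rw [List.cons_append] at hK
      intro a ha
      exact hK.adj_of_cons a ha)
    convert h2 using 1
    · ext u; simp only [List.toFinset_cons, mem_union, mem_insert, List.mem_toFinset, mem_singleton]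
      tauto
    · ext u; simp only [List.toFinset_cons, mem_sdiff, mem_insert, List.mem_toFinset, mem_singleton]
      tauto
    · rcases k with _ | k
      · simp
      · rw [List.cons_append, List.take_succ_cons, List.take_succ_cons, List.take_take,
          min_eq_left (by omega)]

/-- Extension of a segment by a word, which becomes the marked infix. -/
lemma Seg.extend_word {k : ℕ} {S R : Finset V} {s e z : List V} (h : Seg G k S R s e [])
    (hn : z.Nodup) (hz : ∀ v ∈ z, v ∉ S) (hK : KPath G k (z ++ e)) :
    Seg G k (S ∪ z.toFinset) R s ((z ++ e).take k) z.reverse where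
  sub := h.sub.trans subset_union_left
  len_s := h.len_s
  len_e := by simp [h.len_e]
  real R' hR' := by
    obtain ⟨l, h1, h2, h3, h4, h5, -⟩ := h.real R' hR'
    have hkl : k ≤ l.length := by
      have := h.len_s
      rw [← h4, List.length_take] at this
      omega
    have hrl : (l ++ z.reverse).reverse = z ++ l.reverse := by simp
    refine ⟨l ++ z.reverse, ?_, ?_, ?_, ?_, ?_, List.suffix_append _ _ |>.isInfix⟩
    · rw [List.nodup_append]
      refine ⟨h1, List.nodup_reverse.2 hn, fun a ha b hb hab => ?_⟩
      subst hab
      have := List.mem_toFinset.2 ha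
      rw [h3] at this
      exact hz a (List.mem_reverse.1 hb) (mem_sdiff.1 this).1
    · rw [← kPath_reverse, hrl, ← List.take_append_drop k l.reverse, h5, ← List.append_assoc]
      refine KPath.glue hK ?_ h.len_e.ge
      rw [← h5, List.take_append_drop]
      exact h2.reverse
    · rw [List.toFinset_append, List.toFinset_reverse, h3]
      have := h.sub
      ext v
      have := @this v
      have := @hR' v
      have := hz v
      simp only [mem_union, mem_sdiff, List.mem_toFinset]
      tauto
    · rw [List.take_append_of_le_length hkl, h4]
    · rw [hrl, ← h5, List.take_append, List.take_append, List.take_take, min_eq_left (by omega)]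

/-- Removing `v` shortens by one every distance measured across it, so adjacency up to distance `k -
1` is enough there; within `x` or `y` all distances are at most `k - 1` because of the lengths. -/
lemma KPath.insert_middle {k : ℕ} {x y : List V} {v : V} (hx : x.length ≤ k) (hy : y.length ≤ k)
    (h : KPath G (k - 1) (x ++ y)) (hv : ∀ a ∈ x ++ y, G.Adj v a) :
    KPath G k (x ++ v :: y) := by
  have key : ∀ j, (x ++ v :: y)[j]? = if j < x.length then (x ++ y)[j]? else
      if j = x.length then some v else (x ++ y)[j - 1]? := by
    intro j
    split_ifs with h1 h2
    · rw [List.getElem?_append_left h1, List.getElem?_append_left h1]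
    · rw [List.getElem?_append_right (by omega), h2]; simp
    · rw [List.getElem?_append_right (by omega), List.getElem?_append_right (by omega),
        show j - x.length = (j - 1 - x.length) + 1 by omega, List.getElem?_cons_succ]
  intro i j a b hij hj ha hb
  have hj' : j < (x ++ v :: y).length := (List.getElem?_eq_some_iff.1 hb).1
  rw [List.length_append, List.length_cons] at hj'
  rw [key] at ha hb
  rcases lt_trichotomy i x.length with h1 | h1 | h1
  · rw [if_pos h1] at ha
    rcases lt_trichotomy j x.length with h2 | h2 | h2
    · rw [if_pos h2] at hb
      exact h i j a b hij (by omega) ha hb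
    · rw [if_neg (by omega), if_pos h2, Option.some_inj] at hb
      exact hb ▸ (hv a (List.mem_of_getElem? ha)).symm
    · rw [if_neg (by omega), if_neg (by omega)] at hb
      exact h i (j - 1) a b (by omega) (by omega) ha hb
  · rw [if_neg (by omega), if_pos h1, Option.some_inj] at ha
    rw [if_neg (by omega), if_neg (by omega)] at hb
    exact ha ▸ hv b (List.mem_of_getElem? hb)
  · rw [if_neg (by omega), if_neg (by omega)] at ha hb
    exact h (i - 1) (j - 1) a b (by omega) (by omega) ha hb

end

end PowHam

/-! ### Pools, pieces and the parameters of the construction -/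

namespace PowHam

open Finset

section

variable {V : Type*} [DecidableEq V] {G : SimpleGraph V} [DecidableRel G.Adj]

lemma typ_nil {p θ : ℝ} {k : ℕ} {Z : Finset V} (hp : 0 ≤ p) (hp1 : p ≤ 1) (hθ : 0 ≤ θ)
    (h : θ ≤ Z.card) : Typ G p k θ [] Z := fun j _ => by
  rw [List.take_nil, nb_nil]
  exact (mul_le_of_le_one_right hθ (pow_le_one₀ hp hp1)).trans h

/-- A path of length `2 * k` inside a given set, both of whose ends are typical. -/
lemma RgL.exists_typ_path {p x y α : ℝ} {q k : ℕ} (h : RgL G p (1 / 2) x y) (hx : 0 ≤ x)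
    (hp : 0 < p) (hp1 : p ≤ 1) (hq : 1 ≤ q) (hk : 1 ≤ k) (hα : 0 ≤ α)
    {A : Finset V} (hA : α ≤ A.card)
    (hy : y ≤ α * ((1 - 1 / 2) * p) ^ (q - 1)) (Zs : List (Finset V × ℝ))
    (hZ : ∀ Z ∈ Zs, 2 ^ k * Z.2 ≤ Z.1.card ∧ 0 ≤ Z.2 ∧
      y ≤ 2 ^ k * Z.2 * ((1 - 1 / 2) * p) ^ (k - 1))
    (hm : (k + k : ℕ) + (Zs.length + 1) * (q + k : ℕ) * x < α * ((1 - 1 / 2) * p) ^ q) :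
    ∃ z : List V, z.length = k + k ∧ z.Nodup ∧ (∀ v ∈ z, v ∈ A) ∧ KPath G q z ∧
      ∀ Z ∈ Zs, Typ G p k Z.2 (z.take k) Z.1 ∧ Typ G p k Z.2 (z.reverse.take k) Z.1 := by
  have hp0 : 0 ≤ (1 - 1 / 2) * p := by linarith
  have hp2 : (1 - 1 / 2) * p ≤ 1 := by linarith
  obtain ⟨z, h1, h2, h3, h4, -, h6⟩ := h.exists_extension hx hp0 hp2 hq hk hα
    (typ_nil hp0 hp2 hα hA) hy (Zs.map fun Z => (Z.1, 2 ^ k * Z.2)) (by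
      intro w hw
      obtain ⟨Z, hZZ, rfl⟩ := List.mem_map.1 hw
      obtain ⟨g1, g2, g3⟩ := hZ Z hZZ
      exact ⟨g1, by positivity, g3⟩) (k + k) (by rwa [List.length_map])
  have h5 := h4 kPath_nil
  rw [List.append_nil] at h5
  refine ⟨z, h1, h2, h3, h5, fun Z hZZ => ⟨?_, ?_⟩⟩
  · have := h6 (k + k) le_rfl _ (List.mem_map.2 ⟨Z, hZZ, rfl⟩)
    rw [Nat.sub_self, List.drop_zero, List.append_nil, min_eq_right (by omega)] at this
    exact (this.of_half hp.le (hZ Z hZZ).2.1).take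
  -- The list grows at its head, so its last `j` entries are the first `j` chosen. Typicality of
  -- that end is therefore inherited from stage `j`, the order within a block being irrelevant for
  -- common neighbours.
  · refine Typ.of_half (fun j hj => ?_) hp.le (hZ Z hZZ).2.1
    have := h6 j (by omega) _ (List.mem_map.2 ⟨Z, hZZ, rfl⟩) j (by simp [hj])
    refine this.trans (le_of_eq ?_)
    rw [List.append_nil, List.take_of_length_le (by rw [List.length_drop]; omega), List.take_take,
      min_eq_left hj, List.take_reverse, h1]
    congr 2
    exact nb_congr (by simp) _

lemma Seg.kPath_ends {k : ℕ} {S R : Finset V} {s e w : List V} (h : Seg G k S R s e w) :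
    KPath G k s ∧ KPath G k e := by
  obtain ⟨l, -, h2, -, rfl, rfl, -⟩ := h.real ∅ (empty_subset _)
  exact ⟨h2.infix (List.take_prefix _ _).isInfix, h2.reverse.infix (List.take_prefix _ _).isInfix⟩

variable (G)

/-- Any two `k`-paths that are typical with respect to a pool can be connected through it. -/
def Conn (p : ℝ) (k C : ℕ) (θ : ℝ) : Prop :=
  ∀ (e s : List V) (Z : Finset V), e.length = k → s.length = k → KPath G k e → KPath G k s →
    Typ G p k θ e Z → Typ G p k θ s Z → ∃ c : List V, c.Nodup ∧ (∀ v ∈ c, v ∈ Z) ∧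
      k ≤ c.length ∧ c.length ≤ C ∧ KPath G k (e.reverse ++ c ++ s)

/-- A segment of bounded size with both ends typical with respect to the pool `Z`. -/
structure Piece (p : ℝ) (k : ℕ) (θ : ℝ) (C : ℕ) (Z S R : Finset V) (s e : List V) : Prop where
  seg : Seg G k S R s e []
  card_le : S.card ≤ C
  typ_s : Typ G p k θ s Z
  typ_e : Typ G p k θ e Z

/-- The parameters for building long segments through pools. -/
structure Tool (p : ℝ) (k : ℕ) (σ θ : ℝ) (C₀ C₁ : ℕ) : Prop where
  two_le : 2 ≤ k
  p_pos : 0 < p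
  p_le : p ≤ 1
  σ_pos : 0 < σ
  θ_pos : 0 < θ
  big : 1 ≤ σ * p ^ k
  small : 4 ^ (k + 2) * (C₀ + C₁) * σ ≤ θ
  size_le : 2 * k + 1 ≤ C₁
  low : RgL G p (1 / 2) (σ * p ^ k) (σ * p ^ (k - 1))
  low_deg : RgL G p (1 / 2) (σ * p) σ
  conn : Conn G p k C₀ (θ / 2)

variable {G} {p σ θ : ℝ} {k C₀ C₁ : ℕ}

lemma Conn.mono {θ' : ℝ} (h : Conn G p k C₀ θ) (hp : 0 ≤ p) (hθ : θ ≤ θ') : Conn G p k C₀ θ' :=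
  fun e s Z he hs hKe hKs hte hts => h e s Z he hs hKe hKs (hte.mono hp hθ subset_rfl)
    (hts.mono hp hθ subset_rfl)

lemma Tool.size_mul_le (h : Tool G p k σ θ C₀ C₁) : 16 * 16 * (C₀ + C₁) * σ ≤ θ := by
  refine le_trans ?_ h.small
  have h1 : (4 : ℝ) ^ (2 + 2) ≤ 4 ^ (k + 2) :=
    pow_le_pow_right₀ (by norm_num) (by have := h.two_le; omega)
  have h2 : 0 ≤ ((C₀ : ℝ) + C₁) * σ := mul_nonneg (by positivity) h.σ_pos.le
  norm_num at h1
  nlinarith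

/-- As `σ * p ^ k ≥ 1`, boundedly many vertices are negligible even against common neighbourhoods of
`k` vertices. -/
lemma Tool.size_le_pow (h : Tool G p k σ θ C₀ C₁) : 16 * 16 * ((C₀ : ℝ) + C₁) ≤ θ * p ^ k := by
  have h1 := mul_le_mul_of_nonneg_right h.size_mul_le (pow_nonneg h.p_pos.le k)
  have h2 := mul_le_mul_of_nonneg_left h.big
    (show (0 : ℝ) ≤ 16 * 16 * ((C₀ : ℝ) + C₁) by positivity)
  linarith

/-- Attach a piece to the end of a segment through the pool. -/
lemma Tool.attach (h : Tool G p k σ θ C₀ C₁) {S R Z S₂ R₂ : Finset V} {s e w s₂ e₂ : List V}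
    (hS : Seg G k S R s e w) (he : Typ G p k θ e Z) (hP : Piece G p k (2 * θ) C₁ Z S₂ R₂ s₂ e₂)
    (hZ : Z ∩ S ⊆ R) (hSS : S ∩ S₂ ⊆ R) :
    ∃ X ⊆ Z, X.card ≤ C₀ + C₁ ∧ S₂ ∩ Z ⊆ X ∧
      Seg G k (S ∪ X ∪ S₂) ((R \ (X ∪ S₂)) ∪ R₂) s e₂ w ∧ Typ G p k θ e₂ (Z \ X) := by
  have hp := h.p_pos
  have hp1 := h.p_le
  have hθ := h.θ_pos
  have hC := h.size_le_pow
  have hX₂ : ((S₂.card : ℕ) : ℝ) ≤ C₁ := by exact_mod_cast hP.card_le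
  -- Removing `S₂` halves the typicality of `e`, hence the `θ / 2` in `Tool.conn`. The far end of
  -- the piece starts at `2 * θ` and is still at `θ` after `X` has been deleted.
  obtain ⟨c, hc1, hc2, hc3, hc4, hc5⟩ := h.conn e s₂ (Z \ S₂) hS.len_e hP.seg.len_s
    hS.kPath_ends.2 hP.seg.kPath_ends.1 (he.sdiff hp hp1 hθ.le (by linarith))
    ((hP.typ_s.sdiff hp hp1 (by linarith) (by linarith)).mono hp.le (by linarith) subset_rfl)
  have hcZ : c.toFinset ⊆ Z \ S₂ := fun v hv => hc2 v (List.mem_toFinset.1 hv)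
  have hcd : Disjoint c.toFinset S₂ := disjoint_of_subset_left hcZ sdiff_disjoint
  have h1 := hS.link hP.seg hc1 hc3 hc5 hSS (fun v hv => by
    rw [mem_inter] at hv
    exact hZ (mem_inter.2 ⟨(mem_sdiff.1 (hcZ hv.2)).1, hv.1⟩)) hcd
  have hXc : (S₂ ∩ Z ∪ c.toFinset).card ≤ C₀ + C₁ := by
    have g1 := card_union_le (S₂ ∩ Z) c.toFinset
    have g2 := card_le_card (inter_subset_left : S₂ ∩ Z ⊆ S₂)
    have g3 := hP.card_le
    have g4 := c.toFinset_card_le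
    omega
  refine ⟨S₂ ∩ Z ∪ c.toFinset, union_subset inter_subset_right (hcZ.trans sdiff_subset), hXc,
    subset_union_left, ?_, ?_⟩
  · have e1 : S ∪ (S₂ ∩ Z ∪ c.toFinset) ∪ S₂ = S ∪ c.toFinset ∪ S₂ := by
      ext v; simp only [mem_union, mem_inter]; tauto
    have e2 : R \ (S₂ ∩ Z ∪ c.toFinset ∪ S₂) = R \ (c.toFinset ∪ S₂) := by
      ext v; simp only [mem_union, mem_inter, mem_sdiff]; tauto
    rwa [e1, e2]
  · have h2 : ((S₂ ∩ Z ∪ c.toFinset).card : ℝ) ≤ C₀ + C₁ := by exact_mod_cast hXc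
    refine (hP.typ_e.sdiff hp hp1 (by linarith) (by linarith)).mono hp.le (by linarith) subset_rfl

lemma Tool.half_pow (h : Tool G p k σ θ C₀ C₁) (a : ℝ) (ha : 0 ≤ a) {j : ℕ} (hj : j ≤ k) :
    a / 2 ^ k * p ^ j ≤ a * ((1 - 1 / 2) * p) ^ j := by
  rw [mul_pow, show (1 - 1 / 2 : ℝ) = 2⁻¹ by norm_num, inv_pow, div_eq_mul_inv, mul_assoc]
  refine mul_le_mul_of_nonneg_left (mul_le_mul_of_nonneg_right ?_ (pow_nonneg h.p_pos.le _)) ha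
  exact inv_anti₀ (by positivity) (pow_le_pow_right₀ (by norm_num) hj)

lemma Tool.numeric (h : Tool G p k σ θ C₀ C₁) (N : ℝ) (hN : N ≤ 16 * (2 * k + 1)) :
    N * σ ≤ θ / 2 ^ k := by
  rw [le_div_iff₀ (by positivity)]
  refine le_trans ?_ h.small
  have h1 : ((2 * k + 1 : ℕ) : ℝ) ≤ C₁ := by exact_mod_cast h.size_le
  push_cast at h1
  have h2 : (4 : ℝ) ^ (k + 2) = 16 * 2 ^ k * 2 ^ k := by
    rw [pow_add, show (4 : ℝ) = 2 * 2 by norm_num, mul_pow]; ring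
  have h3 : (1 : ℝ) ≤ 2 ^ k := one_le_pow₀ (by norm_num)
  have h4 := h.σ_pos
  rw [h2]
  have h5 : N ≤ 16 * (C₀ + C₁) := by
    have : (0 : ℝ) ≤ C₀ := by positivity
    linarith
  have h6 : (16 : ℝ) * (C₀ + C₁) ≤ 16 * (C₀ + C₁) * 2 ^ k := by
    refine le_mul_of_one_le_right (by positivity) h3
  calc N * σ * 2 ^ k = N * (σ * 2 ^ k) := by ring
    _ ≤ (16 * (C₀ + C₁) * 2 ^ k) * (σ * 2 ^ k) :=
      mul_le_mul_of_nonneg_right (h5.trans h6) (by positivity)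
    _ = _ := by ring

/-- A piece containing a given vertex of large degree into the pool. -/
lemma Tool.exists_cover (h : Tool G p k σ θ C₀ C₁) {Z : Finset V} {v : V} (hv : v ∉ Z)
    (hZ : 2 ^ k * (2 * θ) ≤ Z.card) (hd : θ * p ≤ (nb G [v] Z).card) :
    ∃ S s e, Piece G p k (2 * θ) C₁ Z S ∅ s e ∧ v ∈ S ∧ S ⊆ insert v Z := by
  have hk := h.two_le
  have hp := h.p_pos
  have hp1 := h.p_le
  have hσ := h.σ_pos
  have hθ := h.θ_pos
  have hpk1 : 0 < p ^ (k - 1) := by positivity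
  have e1 : θ * p * p ^ (k - 2) = θ * p ^ (k - 1) := by
    rw [mul_assoc, ← pow_succ']; congr 2; omega
  have e2 : θ * p * p ^ (k - 1) = θ * p ^ k := by
    rw [mul_assoc, ← pow_succ']; congr 2; omega
  have hs1 : σ ≤ θ / 2 ^ k := by
    have := h.numeric 1 (by have : (0 : ℝ) ≤ k := by positivity
                            linarith)
    linarith
  have hb := h.big
  -- Inside the neighbourhood of `v` a `(k - 1)`-path suffices, since `v` will be inserted in its
  -- middle; this keeps the exponents at `(k, k - 1)`. The `k` vertices at either end are unaffected
  -- by the insertion.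
  obtain ⟨x, hx1, hx2, hx3, hx4, hx5⟩ := h.low.exists_typ_path (q := k - 1) (k := k)
    (by positivity) hp hp1 (by omega) (by omega) (α := θ * p) (by positivity) hd (by
      have := h.half_pow (θ * p) (by positivity) (j := k - 2) (by omega)
      refine le_trans ?_ this
      rw [show θ * p / 2 ^ k * p ^ (k - 2) = θ / 2 ^ k * p ^ (k - 1) by rw [← mul_div_right_comm, e1]; ring]
      exact mul_le_mul_of_nonneg_right hs1 hpk1.le) [(Z, 2 * θ)] (by
      intro Z' hZ'
      rw [List.mem_singleton] at hZ'
      subst hZ'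
      refine ⟨hZ, by positivity, ?_⟩
      refine le_trans ?_ (h.half_pow _ (by positivity) (by omega))
      refine mul_le_mul_of_nonneg_right ?_ hpk1.le
      rw [mul_div_right_comm, div_self (by positivity), one_mul]
      refine hs1.trans ?_
      exact (div_le_self hθ.le (one_le_pow₀ (by norm_num))).trans (by linarith)) (by
      refine lt_of_lt_of_le ?_ (h.half_pow _ (by positivity) (by omega))
      rw [← mul_div_right_comm, e2, mul_div_right_comm]
      have h1 := mul_le_mul_of_nonneg_right (h.numeric (6 * (2 * k)) (by linarith))
        (pow_nonneg hp.le k)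
      rw [List.length_singleton]
      have hc : ((k - 1 + k : ℕ) : ℝ) ≤ 2 * k := by exact_mod_cast (by omega : k - 1 + k ≤ 2 * k)
      have hk0 : (0 : ℝ) < k := by exact_mod_cast (by omega : 0 < k)
      have h2 := mul_le_mul_of_nonneg_right hc (show 0 ≤ σ * p ^ k by positivity)
      have h3 := mul_le_mul_of_nonneg_left hb hk0.le
      push_cast at *
      have h4 : 0 < (k : ℝ) * (σ * p ^ k) := by positivity
      linarith)
  have hxv : ∀ a ∈ x, G.Adj v a := fun a ha => (mem_nb_one.1 (hx3 a ha)).2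
  have hxZ : ∀ a ∈ x, a ∈ Z := fun a ha => (mem_nb_one.1 (hx3 a ha)).1
  have hvx : v ∉ x := fun hvx => hv (hxZ v hvx)
  have hxx := List.take_append_drop k x
  set y := x.take k ++ v :: x.drop k with hy
  have hperm : y.Perm (v :: x) := by
    rw [hy]
    refine List.perm_middle.trans ?_
    rw [hxx]
  have hyK : KPath G k y := by
    refine KPath.insert_middle (by simp) (by rw [List.length_drop]; omega) (by rwa [hxx])
      (by rwa [hxx])
  have hyn : y.Nodup := hperm.nodup_iff.2 (List.nodup_cons.2 ⟨hvx, hx2⟩)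
  have hyl : y.length = 2 * k + 1 := by rw [hperm.length_eq, List.length_cons, hx1]; omega
  have ht1 : y.take k = x.take k := by
    rw [hy, List.take_append_of_le_length (by rw [List.length_take]; omega), List.take_take,
      min_self]
  have ht2 : y.reverse.take k = x.reverse.take k := by
    conv_rhs => rw [← hxx]
    rw [hy, List.reverse_append, List.reverse_append, List.reverse_cons, List.append_assoc,
      List.take_append_of_le_length (by rw [List.length_reverse, List.length_drop]; omega),
      List.take_append_of_le_length (by rw [List.length_reverse, List.length_drop]; omega)]
  have hty := hx5 _ (List.mem_singleton_self _)
  have hyf : y.toFinset = insert v x.toFinset := by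
    rw [List.toFinset_eq_of_perm _ _ hperm, List.toFinset_cons]
  refine ⟨y.toFinset, y.take k, y.reverse.take k, ⟨Seg.of_list hyK hyn (by omega) List.nil_infix,
    ?_, by rw [ht1]; exact hty.1, by rw [ht2]; exact hty.2⟩, ?_, ?_⟩
  · exact (y.toFinset_card_le.trans hyl.le).trans h.size_le
  · rw [hyf]; exact mem_insert_self _ _
  · rw [hyf]
    exact insert_subset_insert _ fun a ha => hxZ a (List.mem_toFinset.1 ha)

end

end PowHam

/-! ### Covering vertices through a pool; appending gadgets -/

namespace PowHam

open Finset

section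

variable {V : Type*} [DecidableEq V] {G : SimpleGraph V} [DecidableRel G.Adj]
variable {p σ θ : ℝ} {k C₀ C₁ : ℕ}

/-- Cover a set of vertices of large degree into the pool. -/
lemma Tool.cover_set (h : Tool G p k σ θ C₀ C₁) {s w : List V} (B : Finset V) :
    ∀ {S R Z : Finset V} {e : List V}, Seg G k S R s e w → Typ G p k θ e Z → Z ∩ S ⊆ R →
      Disjoint B S → Disjoint B Z → 2 ^ k * (2 * θ) + (C₀ + C₁) * B.card ≤ Z.card →
      (∀ v ∈ B, θ * p + (C₀ + C₁) * B.card ≤ (nb G [v] Z).card) →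
      ∃ X ⊆ Z, X.card ≤ (C₀ + C₁) * B.card ∧ ∃ e', Seg G k (S ∪ B ∪ X) (R \ X) s e' w ∧
        Typ G p k θ e' (Z \ X) := by
  induction B using Finset.induction_on with
  | empty =>
    intro S R Z e hS he _ _ _ _ _
    exact ⟨∅, empty_subset _, by simp, e, by simpa using hS, by simpa using he⟩
  | insert v B hvB ih =>
    intro S R Z e hS he hZ hBS hBZ hZc hd
    rw [disjoint_insert_left] at hBS hBZ
    rw [card_insert_of_notMem hvB] at hZc hd ⊢
    push_cast at hZc hd
    have hC0 : (0 : ℝ) ≤ (C₀ + C₁) * B.card := by positivity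
    have hC1 : (0 : ℝ) ≤ C₀ + C₁ := by positivity
    obtain ⟨S₂, s₂, e₂, hP, hvS, hSv⟩ := h.exists_cover hBZ.1 (by linarith)
      (by linarith [hd v (mem_insert_self _ _)])
    have hSZ : ∀ u ∈ S₂, u ≠ v → u ∈ Z := fun u hu huv => mem_of_mem_insert_of_ne (hSv hu) huv
    obtain ⟨X₁, hX₁, hX₁c, hXS, hseg, htyp⟩ := h.attach hS he hP hZ (by
      intro u hu
      rw [mem_inter] at hu
      refine hZ (mem_inter.2 ⟨hSZ u hu.2 ?_, hu.1⟩)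
      rintro rfl
      exact hBS.1 hu.1)
    have hSX : ∀ u ∈ S₂, u ≠ v → u ∈ X₁ := fun u hu huv =>
      hXS (mem_inter.2 ⟨hu, hSZ u hu huv⟩)
    have hvR : v ∉ R := fun hv => hBS.1 (hS.sub hv)
    have e1 : S ∪ X₁ ∪ S₂ = insert v (S ∪ X₁) := by
      ext u
      have := hSX u
      simp only [mem_union, mem_insert]
      constructor
      · tauto
      · rintro (rfl | h)
        · tauto
        · tauto
    have e2 : R \ (X₁ ∪ S₂) ∪ ∅ = R \ X₁ := by
      ext u
      have := hSX u
      simp only [mem_union, mem_sdiff, notMem_empty, or_false]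
      constructor
      · tauto
      · rintro ⟨hu, hu'⟩
        refine ⟨hu, fun hh => ?_⟩
        by_cases huv : u = v
        · exact hvR (huv ▸ hu)
        · tauto
    rw [e1, e2] at hseg
    have hX₁r : (X₁.card : ℝ) ≤ C₀ + C₁ := by exact_mod_cast hX₁c
    obtain ⟨X, hX, hXc, e', hseg', htyp'⟩ := ih hseg htyp (by
      intro u hu
      simp only [mem_inter, mem_sdiff, mem_insert, mem_union] at hu ⊢
      have := @hZ u
      rw [mem_inter] at this
      refine ⟨this ⟨hu.1.1, ?_⟩, hu.1.2⟩
      rcases hu.2 with rfl | h | h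
      · exact absurd hu.1.1 hBZ.1
      · exact h
      · exact absurd h hu.1.2) (by
      rw [disjoint_insert_right, disjoint_union_right]
      exact ⟨hvB, hBS.2, disjoint_of_subset_right hX₁ hBZ.2⟩)
      (disjoint_of_subset_right sdiff_subset hBZ.2) (by
      have g1 := card_nb_sdiff_le (G := G) [] Z X₁
      rw [nb_nil, nb_nil] at g1
      linarith) (fun u hu => by
      have g1 := card_nb_sdiff_le (G := G) [u] Z X₁
      have g2 := hd u (mem_insert_of_mem hu)
      linarith)
    refine ⟨X₁ ∪ X, union_subset hX₁ (hX.trans sdiff_subset), ?_, e', ?_, ?_⟩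
    · have := card_union_le X₁ X
      rw [mul_add, mul_one]
      omega
    · convert hseg' using 1
      · ext u; simp only [mem_union, mem_insert]; tauto
      · rw [sdiff_sdiff_left, sup_eq_union]
    · rwa [← sup_eq_union, ← sdiff_sdiff_left]

/-- Cover a set of vertices through the pool, treating vertices whose degree into the pool becomes
small first. -/
lemma Tool.cover_all (h : Tool G p k σ θ C₀ C₁) {s w : List V} (n : ℕ) :
    ∀ {S R Z U : Finset V} {e : List V}, U.card = n → Seg G k S R s e w → Typ G p k θ e Z →
      Z ∩ S ⊆ R → Disjoint U S → Disjoint U Z →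
      2 ^ k * (2 * θ) + (C₀ + C₁) * U.card ≤ Z.card →
      (∀ v ∈ U, 2 * θ * p - (C₀ + C₁) * (σ * p) ≤ (nb G [v] Z).card) →
      ∃ X ⊆ Z, X.card ≤ (C₀ + C₁) * U.card ∧ ∃ e', Seg G k (S ∪ U ∪ X) (R \ X) s e' w ∧
        Typ G p k θ e' (Z \ X) := by
  induction n using Nat.strong_induction_on with
  | _ n ih =>
    intro S R Z U e hn hS he hZ hUS hUZ hZc hd
    have hp := h.p_pos
    have hp1 := h.p_le
    have hσ := h.σ_pos
    have hθ := h.θ_pos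
    have hk := h.two_le
    have hC := h.size_mul_le
    have hC0 : (0 : ℝ) ≤ (C₀ + C₁) * σ := by positivity
    rcases U.eq_empty_or_nonempty with rfl | ⟨v₀, hv₀⟩
    · exact ⟨∅, empty_subset _, by simp, e, by simpa using hS, by simpa using he⟩
    have hZθ : 8 * θ ≤ Z.card := by
      have h1 : (2 : ℝ) ^ 2 ≤ 2 ^ k := pow_le_pow_right₀ (by norm_num) hk
      have h2 : (0 : ℝ) ≤ (C₀ + C₁) * U.card := by positivity
      nlinarith
    have hσp : 1 ≤ σ * p := by
      refine h.big.trans (mul_le_mul_of_nonneg_left ?_ hσ.le)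
      exact (pow_le_pow_of_le_one hp.le hp1 (by omega : 1 ≤ k)).trans (by rw [pow_one])
    have hσθ : σ ≤ θ := by
      have h1 : (1 : ℝ) ≤ C₀ + C₁ := by
        have := h.size_le
        exact_mod_cast (by omega : 1 ≤ C₀ + C₁)
      nlinarith
    have hpθ : 0 < θ * p := by positivity
    -- One round: `B` consists of all vertices whose degree into the present pool falls short of its
    -- share, or of one arbitrary vertex if there are none. The others have degree at least `2 * θ *
    -- p`, and the round uses at most `(C₀ + C₁) * (σ * p)` pool vertices, which restores the
    -- invariant.
    obtain ⟨B, hBU, hBne, hBc, hBd⟩ : ∃ B ⊆ U, B.Nonempty ∧ (B.card : ℝ) ≤ σ * p ∧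
        ∀ v ∈ U \ B, 2 * θ * p ≤ (nb G [v] Z).card := by
      have hbad := h.low_deg.card_bad_lt U (Y := Z) (by linarith)
      set D := U.filter fun v => ¬ ((1 - 1 / 2) * p * Z.card ≤ (nb G [v] Z).card) with hD
      have hgood : ∀ v ∈ U \ D, 2 * θ * p ≤ (nb G [v] Z).card := by
        intro v hv
        rw [hD, mem_sdiff, mem_filter, not_and, not_not] at hv
        refine le_trans ?_ (hv.2 hv.1)
        have := mul_le_mul_of_nonneg_left hZθ hp.le
        linarith
      rcases D.eq_empty_or_nonempty with hDe | hDe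
      · refine ⟨{v₀}, by simpa using hv₀, singleton_nonempty _, by simpa using hσp, fun v hv => ?_⟩
        refine hgood v ?_
        rw [hDe, sdiff_empty]
        exact sdiff_subset hv
      · exact ⟨D, filter_subset _ _, hDe, hbad.le, hgood⟩
    have hBC : ((C₀ : ℝ) + C₁) * B.card ≤ (C₀ + C₁) * (σ * p) :=
      mul_le_mul_of_nonneg_left hBc (by positivity)
    have hCp := mul_le_mul_of_nonneg_right hC hp.le
    have hBU' : ((C₀ : ℝ) + C₁) * B.card ≤ (C₀ + C₁) * U.card :=
      mul_le_mul_of_nonneg_left (by exact_mod_cast card_le_card hBU) (by positivity)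
    obtain ⟨X₁, hX₁, hX₁c, e₁, hseg, htyp⟩ := h.cover_set B hS he hZ
      (disjoint_of_subset_left hBU hUS) (disjoint_of_subset_left hBU hUZ) (by linarith)
      (fun v hv => by
        have := hd v (hBU hv)
        have : 0 ≤ ((C₀ : ℝ) + C₁) * σ * p := by positivity
        linarith)
    have hX₁r : (X₁.card : ℝ) ≤ (C₀ + C₁) * B.card := by exact_mod_cast hX₁c
    have hUB : (U \ B).card + B.card = U.card := card_sdiff_add_card_eq_card hBU
    have hUBr : ((U \ B).card : ℝ) + B.card = U.card := by exact_mod_cast hUB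
    obtain ⟨X, hX, hXc, e', hseg', htyp'⟩ := ih (U \ B).card (by
      have := hBne.card_pos
      omega) rfl hseg htyp (by
      intro u hu
      simp only [mem_inter, mem_sdiff, mem_union] at hu ⊢
      have h1 := @hZ u
      rw [mem_inter] at h1
      have h2 : u ∈ U → u ∉ Z := fun h => disjoint_left.1 hUZ h
      have h3 := @hBU u
      tauto) (by
      rw [disjoint_left]
      intro u hu
      have h1 : u ∈ U → u ∉ S := fun h => disjoint_left.1 hUS h
      have h2 : u ∈ U → u ∉ Z := fun h => disjoint_left.1 hUZ h
      have h3 := @hX₁ u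
      simp only [mem_sdiff, mem_union] at hu ⊢
      tauto) (disjoint_of_subset_left sdiff_subset (disjoint_of_subset_right sdiff_subset hUZ)) (by
      have g1 := card_nb_sdiff_le (G := G) [] Z X₁
      rw [nb_nil, nb_nil] at g1
      have g2 : ((C₀ : ℝ) + C₁) * (U \ B).card + (C₀ + C₁) * B.card = (C₀ + C₁) * U.card := by
        rw [← mul_add, hUBr]
      linarith) (fun u hu => by
      have g1 := card_nb_sdiff_le (G := G) [u] Z X₁
      have g2 := hBd u hu
      linarith)
    refine ⟨X₁ ∪ X, union_subset hX₁ (hX.trans sdiff_subset), ?_, e', ?_, ?_⟩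
    · have := card_union_le X₁ X
      rw [← hUB, mul_add]
      omega
    · convert hseg' using 1
      · ext u
        have := @hBU u
        simp only [mem_union, mem_sdiff]
        tauto
      · rw [sdiff_sdiff_left, sup_eq_union]
    · rwa [← sup_eq_union, ← sdiff_sdiff_left]

/-- Every large set contains a piece with one skippable vertex. -/
def HasGadgets (G : SimpleGraph V) [DecidableRel G.Adj] (p : ℝ) (k : ℕ) (θ : ℝ) (C : ℕ) (M : ℝ) :
    Prop := ∀ Z : Finset V, M ≤ Z.card → ∃ r S s e, S ⊆ Z ∧ Piece G p k (2 * θ) C Z S {r} s e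

/-- Append `g` gadgets to a segment. -/
lemma Tool.append_gadgets (h : Tool G p k σ θ C₀ C₁) {M : ℝ} (hG : HasGadgets G p k θ C₁ M)
    {s w : List V} (g : ℕ) :
    ∀ {S R Z : Finset V} {e : List V}, Seg G k S R s e w → Typ G p k θ e Z → Disjoint Z S →
      M + (C₀ + C₁) * g ≤ Z.card →
      ∃ X ⊆ Z, X.card ≤ (C₀ + C₁) * g ∧ ∃ Q ⊆ X, Q.card = g ∧
        ∃ e', Seg G k (S ∪ X) (R ∪ Q) s e' w ∧ Typ G p k θ e' (Z \ X) := by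
  induction g with
  | zero =>
    intro S R Z e hS he _ _
    exact ⟨∅, empty_subset _, by simp, ∅, empty_subset _, rfl, e, by simpa using hS,
      by simpa using he⟩
  | succ g ih =>
    intro S R Z e hS he hZ hZc
    push_cast at hZc
    have hC1 : (0 : ℝ) ≤ C₀ + C₁ := by positivity
    have hC2 : (0 : ℝ) ≤ (C₀ + C₁) * g := by positivity
    obtain ⟨r, S₂, s₂, e₂, hS₂, hP⟩ := hG Z (by linarith)
    have hSS : S ∩ S₂ ⊆ R := by
      intro u hu
      rw [mem_inter] at hu
      exact absurd hu.1 (disjoint_left.1 hZ (hS₂ hu.2))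
    obtain ⟨X₁, hX₁, hX₁c, hXS, hseg, htyp⟩ := h.attach hS he hP
      (by rw [disjoint_iff_inter_eq_empty.1 hZ]; exact empty_subset _) hSS
    rw [inter_eq_left.2 hS₂] at hXS
    have hr : r ∈ X₁ := hXS (hP.seg.sub (mem_singleton_self r))
    have e1 : S ∪ X₁ ∪ S₂ = S ∪ X₁ :=
      union_eq_left.2 (hXS.trans subset_union_right)
    have e2 : R \ (X₁ ∪ S₂) = R := by
      rw [union_eq_left.2 hXS]
      exact sdiff_eq_self_of_disjoint (disjoint_of_subset_left hS.sub
        (disjoint_of_subset_right hX₁ hZ.symm))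
    rw [e1, e2] at hseg
    have hX₁r : (X₁.card : ℝ) ≤ C₀ + C₁ := by exact_mod_cast hX₁c
    obtain ⟨X, hX, hXc, Q, hQ, hQc, e', hseg', htyp'⟩ := ih hseg htyp (by
      rw [disjoint_union_right]
      exact ⟨disjoint_of_subset_left sdiff_subset hZ, sdiff_disjoint⟩) (by
      have g1 := card_nb_sdiff_le (G := G) [] Z X₁
      rw [nb_nil, nb_nil] at g1
      linarith)
    have hrQ : r ∉ Q := fun hrQ => (mem_sdiff.1 (hX (hQ hrQ))).2 hr
    refine ⟨X₁ ∪ X, union_subset hX₁ (hX.trans sdiff_subset), ?_, insert r Q, ?_, ?_, e', ?_, ?_⟩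
    · have := card_union_le X₁ X
      rw [mul_add, mul_one]
      omega
    · exact insert_subset (mem_union_left _ hr) (hQ.trans subset_union_right)
    · rw [card_insert_of_notMem hrQ, hQc]
    · convert hseg' using 1
      · rw [union_assoc]
      · ext u; simp only [mem_union, mem_insert, mem_singleton]; tauto
    · rwa [← sup_eq_union, ← sdiff_sdiff_left]

/-- For `k ≥ 3` a gadget is a `k`-path in the neighbourhood of the skippable vertex. -/
lemma Tool.hasGadgets_of_large (h : Tool G p k σ θ C₀ C₁) (hbig : 1 ≤ σ * p ^ (k + 1))
    (hR : RgL G p (1 / 2) (σ * p ^ (k + 1)) (σ * p ^ k)) :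
    HasGadgets G p k θ C₁ (2 ^ k * (2 * θ)) := by
  intro Z hZ
  have hk := h.two_le
  have hp := h.p_pos
  have hp1 := h.p_le
  have hσ := h.σ_pos
  have hθ := h.θ_pos
  have hk0 : (0 : ℝ) < k := by exact_mod_cast (by omega : 0 < k)
  have hs1 : σ ≤ θ / 2 ^ k := by
    have := h.numeric 1 (by linarith)
    linarith
  have h2k : (1 : ℝ) ≤ 2 ^ k := one_le_pow₀ (by norm_num)
  have hZθ : 2 * θ ≤ Z.card := by nlinarith
  have hσθ : σ ≤ θ := hs1.trans (div_le_self hθ.le h2k)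
  obtain ⟨r, hr, hd⟩ := h.low_deg Z Z (by nlinarith) (by linarith)
  have hd' : θ * p ≤ (nb G [r] Z).card := by
    have := mul_le_mul_of_nonneg_left hZθ hp.le
    linarith
  -- A genuine `k`-path in the neighbourhood of `r`, valid both with and without `r`. This takes one
  -- more power of `p` than covering a vertex, hence the exponents `(k + 1, k)`.
  obtain ⟨x, hx1, hx2, hx3, hx4, hx5⟩ := hR.exists_typ_path (q := k) (k := k)
    (by positivity) hp hp1 (by omega) (by omega) (α := θ * p) (by positivity) hd' (by
      have := h.half_pow (θ * p) (by positivity) (j := k - 1) (by omega)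
      refine le_trans ?_ this
      rw [show θ * p / 2 ^ k * p ^ (k - 1) = θ / 2 ^ k * (p * p ^ (k - 1)) by ring, ← pow_succ',
        show k - 1 + 1 = k by omega]
      exact mul_le_mul_of_nonneg_right hs1 (by positivity)) [(Z, 2 * θ)] (by
      intro Z' hZ'
      rw [List.mem_singleton] at hZ'
      subst hZ'
      refine ⟨hZ, by positivity, ?_⟩
      refine le_trans ?_ (h.half_pow _ (by positivity) (by omega))
      rw [mul_div_right_comm, div_self (by positivity), one_mul]
      exact mul_le_mul (by linarith) (pow_le_pow_of_le_one hp.le hp1 (by omega)) (by positivity)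
        (by positivity)) (by
      refine lt_of_lt_of_le ?_ (h.half_pow _ (by positivity) le_rfl)
      rw [show θ * p / 2 ^ k * p ^ k = θ / 2 ^ k * p ^ (k + 1) by ring]
      have h1 := mul_le_mul_of_nonneg_right (h.numeric (7 * (2 * k)) (by linarith))
        (pow_nonneg hp.le (k + 1))
      rw [List.length_singleton]
      have h3 := mul_le_mul_of_nonneg_left hbig hk0.le
      push_cast
      have h4 : 0 < (k : ℝ) * (σ * p ^ (k + 1)) := by positivity
      linarith)
  have hxr : ∀ a ∈ x, G.Adj r a := fun a ha => (mem_nb_one.1 (hx3 a ha)).2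
  have hxZ : ∀ a ∈ x, a ∈ Z := fun a ha => (mem_nb_one.1 (hx3 a ha)).1
  have hrx : r ∉ x := fun hrx => G.loopless.irrefl _ (hxr r hrx)
  have hxx := List.take_append_drop k x
  have hty := hx5 _ (List.mem_singleton_self _)
  have hcard : (insert r x.toFinset).card ≤ C₁ := by
    refine (card_insert_le _ _).trans (le_trans ?_ h.size_le)
    have := x.toFinset_card_le
    omega
  refine ⟨r, insert r x.toFinset, x.take k, x.reverse.take k, ?_, ⟨⟨?_, ?_, ?_, ?_⟩, hcard,
    hty.1, hty.2⟩⟩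
  · exact insert_subset hr fun a ha => hxZ a (List.mem_toFinset.1 ha)
  · simp
  · simp [hx1]
  · simp [hx1]
  · intro R' hR'
    rcases subset_singleton_iff.1 hR' with rfl | rfl
    · have hperm : (x.take k ++ r :: x.drop k).Perm (r :: x) := by
        refine List.perm_middle.trans ?_
        rw [hxx]
      refine ⟨x.take k ++ r :: x.drop k, hperm.nodup_iff.2 (List.nodup_cons.2 ⟨hrx, hx2⟩), ?_, ?_,
        ?_, ?_, List.nil_infix⟩
      · refine KPath.insert_middle (by simp) (by rw [List.length_drop]; omega) ?_ (by rwa [hxx])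
        rw [hxx]
        exact hx4.mono (by omega)
      · rw [List.toFinset_eq_of_perm _ _ hperm, List.toFinset_cons, sdiff_empty]
      · rw [List.take_append_of_le_length (by rw [List.length_take]; omega), List.take_take,
          min_self]
      · conv_rhs => rw [← hxx]
        rw [List.reverse_append, List.reverse_append, List.reverse_cons, List.append_assoc,
          List.take_append_of_le_length (by rw [List.length_reverse, List.length_drop]; omega),
          List.take_append_of_le_length (by rw [List.length_reverse, List.length_drop]; omega)]
    · refine ⟨x, hx2, hx4, ?_, rfl, rfl, List.nil_infix⟩
      rw [insert_sdiff_of_mem _ (mem_singleton_self r), sdiff_singleton_eq_erase,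
        erase_eq_of_notMem (by rwa [List.mem_toFinset])]

end

end PowHam

/-! ### Ingredients of the gadget for squares: apexes and sides -/

namespace PowHam

open Finset

section

variable {V : Type*} [DecidableEq V] {G : SimpleGraph V} [DecidableRel G.Adj]
variable {p σ θ ψ : ℝ} {k C₀ C₁ : ℕ}

/-- `y ∈ A` is a common neighbour of `a, b, c` such that `[y, b]` is typical for `Z`. -/
def Apex (G : SimpleGraph V) [DecidableRel G.Adj] (p ψ : ℝ) (A Z : Finset V) (a b c y : V) : Prop :=
  y ∈ A ∧ G.Adj a y ∧ G.Adj b y ∧ G.Adj c y ∧ Typ G ((1 - 1 / 2) * p) 2 ψ [y, b] Z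

/-- The edge `ab` has typical (common) neighbourhoods in all pools. -/
def EdgeOK (G : SimpleGraph V) [DecidableRel G.Adj] (p ψ : ℝ) (Ps : List (Finset V)) (a b : V) :
    Prop := ∀ W ∈ Ps, Typ G ((1 - 1 / 2) * p) 2 ψ [b, a] W

lemma RgL.pick_edgeOK {x : ℝ} (hx : 0 ≤ x) (hp : 0 < p) (hp1 : p ≤ 1) (hψ : 0 < ψ)
    (hσψ : 16 * σ ≤ ψ) (h : RgL G p (1 / 2) x (σ * p)) {Ps : List (Finset V)} {b : V}
    (hb : ∀ W ∈ Ps, Typ G ((1 - 1 / 2) * p) 1 ψ [b] W) (X : Finset V) :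
    ∃ X' ⊆ X, (X.card : ℝ) - 2 * Ps.length * x ≤ X'.card ∧ ∀ c ∈ X', EdgeOK G p ψ Ps b c := by
  obtain ⟨X', h1, h2, h3⟩ := h.pick_typ (l := [b]) hx (by linarith) (by linarith) X 2
    (Ps.map fun W => (W, 1, ψ)) (by
    intro w hw
    obtain ⟨W, hW, rfl⟩ := List.mem_map.1 hw
    refine ⟨hb W hW, hψ.le, ?_, le_rfl⟩
    dsimp only
    have := mul_le_mul_of_nonneg_right hσψ hp.le
    have : 0 < ψ * p := by positivity
    rw [pow_one]
    linarith)
  refine ⟨X', h1, ?_, fun c hc W hW => h3 c hc _ (List.mem_map.2 ⟨W, hW, rfl⟩)⟩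
  rw [List.length_map] at h2
  refine le_trans (le_of_eq ?_) h2
  push_cast
  ring

/-- Almost all vertices `c` continue an edge `ab` with an apex over the path `abc`. -/
lemma exists_apexes (hσ : 0 < σ) (hp : 0 < p) (hp1 : p ≤ 1) (hψ : 0 < ψ) (hσψ : 16 * σ ≤ ψ)
    (h21 : RgL G p (1 / 2) (σ * p ^ 2) (σ * p)) (h12 : RgL G p (1 / 2) (σ * p) (σ * p ^ 2))
    {Ps : List (Finset V)} {a b : V} (hab : EdgeOK G p ψ Ps a b) {A Z : Finset V} (hA : A ∈ Ps)
    (hZ : Z ∈ Ps) (X : Finset V) :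
    ∃ X' ⊆ X, (X.card : ℝ) - (2 * Ps.length + 1) * (σ * p) ≤ X'.card ∧
      ∀ c ∈ X', EdgeOK G p ψ Ps b c ∧ ∃ y, Apex G p ψ A Z a b c y := by
  have hp2 : p ^ 2 ≤ p := by nlinarith
  have hb : ∀ W ∈ Ps, Typ G ((1 - 1 / 2) * p) 1 ψ [b] W := fun W hW =>
    ((hab W hW).mono_len (by norm_num : 1 ≤ 2)).take
  obtain ⟨X₁, hX₁, hX₁c, hX₁T⟩ := RgL.pick_edgeOK (x := σ * p) (by positivity) hp hp1 hψ hσψ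
    (h21.mono (mul_le_mul_of_nonneg_left hp2 hσ.le) le_rfl) hb X
  -- `Y` contains common neighbours of `a` and `b` whose block with `b` is typical for `Z`; its size
  -- is of order at least `ψ * p ^ 2`. Almost every `c` then has a neighbour in `Y`, which serves as
  -- apex.
  obtain ⟨Y, hY, hYc, hYT⟩ := h21.pick_edgeOK (by positivity) hp hp1 hψ hσψ (Ps := [Z]) (b := b)
    (by simpa using hb Z hZ) (nb G [b, a] A)
  have h1 := hab A hA 2 le_rfl
  rw [List.take_of_length_le (by simp)] at h1
  have hYl : σ * p ^ 2 ≤ Y.card := by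
    refine le_trans ?_ hYc
    have := mul_le_mul_of_nonneg_right hσψ (pow_nonneg hp.le 2)
    rw [mul_pow] at h1
    rw [List.length_singleton]
    push_cast
    have h3 : 0 < σ * p ^ 2 := by positivity
    linarith
  have hY0 : (0 : ℝ) < Y.card := lt_of_lt_of_le (by positivity) hYl
  have hbad := h12.card_bad_lt X₁ hYl
  have hgood := card_filter_and_ge X₁ (fun _ => True)
    (fun c => (1 - 1 / 2) * p * Y.card ≤ (nb G [c] Y).card) (by rw [filter_true]) hbad.le
  refine ⟨X₁.filter fun v => True ∧ (1 - 1 / 2) * p * Y.card ≤ (nb G [v] Y).card,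
    (filter_subset _ _).trans hX₁, by linarith, fun c hc => ?_⟩
  rw [mem_filter] at hc
  refine ⟨hX₁T c hc.1, ?_⟩
  have h2 : (0 : ℝ) < (nb G [c] Y).card := by
    refine lt_of_lt_of_le ?_ hc.2.2
    have : (0 : ℝ) < 1 - 1 / 2 := by norm_num
    positivity
  obtain ⟨y, hy⟩ := card_pos.1 (Nat.cast_pos.1 h2)
  rw [mem_nb_one] at hy
  have hy' := hY hy.1
  simp only [mem_nb, List.mem_cons, List.not_mem_nil, or_false, forall_eq_or_imp, forall_eq] at hy'
  exact ⟨y, hy'.1, hy'.2.2, hy'.2.1, hy.2, hYT y hy.1 Z (by simp)⟩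

/-- Almost all vertices `c₂` are the end of a path `r c₀ c₁ c₂` with apexes over `r c₀ c₁` and
`c₀ c₁ c₂`. -/
lemma exists_side (hσ : 0 < σ) (hp : 0 < p) (hp1 : p ≤ 1) (hψ : 0 < ψ)
    {Ps : List (Finset V)} (hσψ : 16 * (Ps.length + 1) * σ ≤ ψ)
    (h21 : RgL G p (1 / 2) (σ * p ^ 2) (σ * p)) (h12 : RgL G p (1 / 2) (σ * p) (σ * p ^ 2))
    (h10 : RgL G p (1 / 2) (σ * p) σ)
    {r c₀ : V} (hrc : EdgeOK G p ψ Ps r c₀) {Z₁ A₀ A₁ Z : Finset V} (hZ₁ : Z₁ ∈ Ps) (hA₀ : A₀ ∈ Ps)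
    (hA₁ : A₁ ∈ Ps) (hZ : Z ∈ Ps) (Z₂ : Finset V) :
    ∃ L ⊆ Z₂, (Z₂.card : ℝ) - 4 * (Ps.length + 1) * σ ≤ L.card ∧ ∀ c₂ ∈ L, ∃ c₁ ∈ Z₁,
      G.Adj c₀ c₁ ∧ G.Adj c₁ c₂ ∧ EdgeOK G p ψ Ps c₁ c₂ ∧ (∃ y, Apex G p ψ A₀ Z r c₀ c₁ y) ∧
      ∃ y, Apex G p ψ A₁ Z c₀ c₁ c₂ y := by
  classical
  have hσψ' : 16 * σ ≤ ψ := by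
    refine le_trans ?_ hσψ
    have : 0 ≤ (Ps.length : ℝ) * σ := by positivity
    linarith
  have hP0 : (0 : ℝ) ≤ Ps.length := by positivity
  obtain ⟨L₁, hL₁, hL₁c, hL₁T⟩ := exists_apexes hσ hp hp1 hψ hσψ' h21 h12 hrc hA₀ hZ (nb G [c₀] Z₁)
  have hL₁l : σ * p ≤ L₁.card := by
    have h1 := hrc Z₁ hZ₁ 1 (by norm_num)
    rw [List.take_succ_cons, List.take_zero, pow_one] at h1
    have h2 := mul_le_mul_of_nonneg_right hσψ hp.le
    have h3 : 0 < σ * p := by positivity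
    have h4 : 0 ≤ Ps.length * (σ * p) := by positivity
    linarith
  set P : V → Prop := fun c₂ => ∃ c₁ ∈ Z₁,
      G.Adj c₀ c₁ ∧ G.Adj c₁ c₂ ∧ EdgeOK G p ψ Ps c₁ c₂ ∧ (∃ y, Apex G p ψ A₀ Z r c₀ c₁ y) ∧
      ∃ y, Apex G p ψ A₁ Z c₀ c₁ c₂ y with hP
  refine ⟨Z₂.filter P, filter_subset _ _, ?_, fun c₂ hc₂ => (mem_filter.1 hc₂).2⟩
  by_contra hlt
  rw [not_le] at hlt
  -- If this exceptional set were large, some `c₁ ∈ L₁` would have many neighbours in it, and almost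
  -- all of them would continue the path after all.
  set B := Z₂.filter fun v => ¬ P v with hB
  have hBc : 4 * (Ps.length + 1) * σ ≤ B.card := by
    have h1 := card_filter_add_card_filter_not (s := Z₂) P
    have h2 : ((Z₂.filter P).card : ℝ) + B.card = Z₂.card := by exact_mod_cast h1
    linarith
  obtain ⟨c₁, hc₁, hd⟩ := h10 L₁ B hL₁l (by
    refine le_trans ?_ hBc
    have : 0 ≤ (Ps.length : ℝ) * σ := by positivity
    linarith)
  obtain ⟨hok, hy₀⟩ := hL₁T c₁ hc₁
  have hc₁' := mem_nb_one.1 (hL₁ hc₁)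
  obtain ⟨X', hX', hX'c, hX'T⟩ := exists_apexes hσ hp hp1 hψ hσψ' h21 h12 hok hA₁ hZ (nb G [c₁] B)
  have hpos : (0 : ℝ) < X'.card := by
    refine lt_of_lt_of_le ?_ hX'c
    have h1 := mul_le_mul_of_nonneg_left hBc hp.le
    have : 0 < σ * p := by positivity
    linarith
  obtain ⟨c₂, hc₂⟩ := card_pos.1 (Nat.cast_pos.1 hpos)
  obtain ⟨hok₂, hy₁⟩ := hX'T c₂ hc₂
  have hc₂' := mem_nb_one.1 (hX' hc₂)
  rw [hB, mem_filter] at hc₂'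
  exact hc₂'.1.2 ⟨c₁, hc₁'.1, hc₁'.2, hc₂'.2, hok₂, hy₀, hy₁⟩

/-- In a dense bipartite graph there is an edge avoiding two locally small sets of exceptions. -/
lemma exists_good_edge {L R : Finset V} (hσ : 0 < σ) (hp : 0 < p) (hp1 : p ≤ 1)
    (hσψ : 64 * σ ≤ ψ) (h10 : RgL G p (1 / 2) (σ * p) σ) (hL : ψ / 2 ≤ L.card) (hL' : L.card ≤ ψ)
    (hR : ψ / 2 ≤ R.card) (hR' : R.card ≤ ψ) (P Q : V → V → Prop) {D : ℝ}
    (hD : 32 * D < ψ)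
    (hP : ∀ a ∈ L, ∃ X' ⊆ nb G [a] R, ((nb G [a] R).card : ℝ) - D * p ≤ X'.card ∧
      ∀ b ∈ X', P a b)
    (hQ : ∀ b ∈ R, ∃ X' ⊆ nb G [b] L, ((nb G [b] L).card : ℝ) - D * p ≤ X'.card ∧
      ∀ a ∈ X', Q a b) :
    ∃ a ∈ L, ∃ b ∈ R, G.Adj a b ∧ P a b ∧ Q a b := by
  classical
  by_contra hno
  push Not at hno
  have hPc : ∀ a ∈ L, (((nb G [a] R).filter fun b => ¬ P a b).card : ℝ) ≤ D * p := by
    intro a ha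
    obtain ⟨X', hX', hc, hX⟩ := hP a ha
    have h1 : (nb G [a] R).filter (fun b => ¬ P a b) ⊆ nb G [a] R \ X' := by
      intro b hb
      rw [mem_filter] at hb
      rw [mem_sdiff]
      exact ⟨hb.1, fun h => hb.2 (hX b h)⟩
    have h2 := card_le_card h1
    have h3 := card_sdiff_add_card_eq_card hX'
    have h4 : (((nb G [a] R \ X').card : ℕ) : ℝ) + X'.card = (nb G [a] R).card := by
      exact_mod_cast h3
    have h5 : (((nb G [a] R).filter fun b => ¬ P a b).card : ℝ) ≤ (nb G [a] R \ X').card := by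
      exact_mod_cast h2
    linarith
  have hQc : ∀ b ∈ R, (((nb G [b] L).filter fun a => ¬ Q a b).card : ℝ) ≤ D * p := by
    intro b hb
    obtain ⟨X', hX', hc, hX⟩ := hQ b hb
    have h1 : (nb G [b] L).filter (fun a => ¬ Q a b) ⊆ nb G [b] L \ X' := by
      intro a ha
      rw [mem_filter] at ha
      rw [mem_sdiff]
      exact ⟨ha.1, fun h => ha.2 (hX a h)⟩
    have h2 := card_le_card h1
    have h3 := card_sdiff_add_card_eq_card hX'
    have h4 : (((nb G [b] L \ X').card : ℕ) : ℝ) + X'.card = (nb G [b] L).card := by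
      exact_mod_cast h3
    have h5 : (((nb G [b] L).filter fun a => ¬ Q a b).card : ℝ) ≤ (nb G [b] L \ X').card := by
      exact_mod_cast h2
    linarith
  have hbad := h10.card_bad_lt L (Y := R) (by linarith)
  have hgood := card_filter_and_ge L (fun _ => True)
    (fun c => (1 - 1 / 2) * p * R.card ≤ (nb G [c] R).card) (by rw [filter_true]) hbad.le
  set L' := L.filter fun v => True ∧ (1 - 1 / 2) * p * R.card ≤ (nb G [v] R).card with hL'def
  have hψ : 0 < ψ := by linarith
  have hσp : σ * p ≤ σ := mul_le_of_le_one_right hσ.le hp1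
  have hL'c : ψ / 4 ≤ L'.card := by linarith
  -- There are at least `ψ ^ 2 * p / 16` edges, but the two kinds of exceptions account for at most
  -- `2 * ψ * D * p`; this is where `32 * D < ψ` decides.
  have hlow : (ψ / 4) * (ψ / 4 * p) ≤ ∑ a ∈ L, ((nb G [a] R).card : ℝ) := by
    refine le_trans (mul_le_mul_of_nonneg_right hL'c (by positivity)) ?_
    rw [← nsmul_eq_mul]
    refine (card_nsmul_le_sum _ _ _ fun a ha => ?_).trans
      (sum_le_sum_of_subset_of_nonneg (filter_subset _ _ : L' ⊆ L) fun _ _ _ => by positivity)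
    refine le_trans ?_ (mem_filter.1 ha).2.2
    have := mul_le_mul_of_nonneg_left hR hp.le
    linarith
  have hsplit : ∀ a ∈ L, ((nb G [a] R).card : ℝ) ≤
      D * p + (bipartiteAbove (fun a b => G.Adj b a ∧ ¬ Q a b) R a).card := by
    intro a ha
    have h1 : nb G [a] R ⊆ ((nb G [a] R).filter fun b => ¬ P a b) ∪
        bipartiteAbove (fun a b => G.Adj b a ∧ ¬ Q a b) R a := by
      intro b hb
      have hb' := mem_nb_one.1 hb
      rw [mem_union, mem_filter, bipartiteAbove, mem_filter]
      by_cases hPab : P a b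
      · exact Or.inr ⟨hb'.1, hb'.2.symm, hno a ha b hb'.1 hb'.2 hPab⟩
      · exact Or.inl ⟨hb, hPab⟩
    have h2 := (card_le_card h1).trans (card_union_le _ _)
    have h3 : ((nb G [a] R).card : ℝ) ≤ ((nb G [a] R).filter fun b => ¬ P a b).card +
        (bipartiteAbove (fun a b => G.Adj b a ∧ ¬ Q a b) R a).card := by exact_mod_cast h2
    linarith [hPc a ha]
  have hsum := sum_card_bipartiteAbove_eq_sum_card_bipartiteBelow (s := L) (t := R)
    (fun a b => G.Adj b a ∧ ¬ Q a b)
  have hup1 := sum_le_sum hsplit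
  have hsum' : ∑ a ∈ L, ((bipartiteAbove (fun a b => G.Adj b a ∧ ¬ Q a b) R a).card : ℝ) =
      ∑ b ∈ R, ((bipartiteBelow (fun a b => G.Adj b a ∧ ¬ Q a b) L b).card : ℝ) := by
    exact_mod_cast hsum
  rw [sum_add_distrib, sum_const, nsmul_eq_mul, hsum'] at hup1
  have hup2 : ∑ b ∈ R, ((bipartiteBelow (fun a b => G.Adj b a ∧ ¬ Q a b) L b).card : ℝ) ≤
      R.card * (D * p) := by
    rw [← nsmul_eq_mul]
    refine sum_le_card_nsmul _ _ _ fun b hb => le_trans (Nat.cast_le.2 (card_le_card ?_)) (hQc b hb)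
    intro a ha
    rw [bipartiteBelow, mem_filter] at ha
    rw [mem_filter, mem_nb_one]
    exact ⟨⟨ha.1, ha.2.1⟩, ha.2.2⟩
  have hD0 : 0 ≤ D * p := by
    obtain ⟨a, ha⟩ : L.Nonempty := card_pos.1 (Nat.cast_pos (α := ℝ) |>.1 (by linarith))
    exact le_trans (by positivity) (hPc a ha)
  have h1 := mul_le_mul_of_nonneg_right hL' hD0
  have h2 := mul_le_mul_of_nonneg_right hR' hD0
  have h3 : 32 * D * (ψ * p) < ψ * (ψ * p) := mul_lt_mul_of_pos_right hD (by positivity)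
  linarith

end

end PowHam

/-! ### Existence of the gadget for squares -/

namespace PowHam

open Finset

section

variable {V : Type*} [DecidableEq V] {G : SimpleGraph V} [DecidableRel G.Adj]
variable {p σ θ ψ : ℝ} {k C₀ C₁ : ℕ}

/-- A cycle `r c₀ … c₅` with the chord `c₀c₅` and apexes over all paths of three vertices with
centre `cᵢ`. -/
structure SquareGadget (G : SimpleGraph V) [DecidableRel G.Adj] (p ψ : ℝ) (B : Fin 14 → Finset V)
    (c : Fin 6 → V) (y : Fin 6 → V) (r : V) : Prop where
  mem_c : ∀ i : Fin 6, c i ∈ B (Fin.castLE (by norm_num) i)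
  mem_r : r ∈ B 12
  adj_r0 : G.Adj r (c 0)
  adj_r5 : G.Adj r (c 5)
  adj_05 : G.Adj (c 0) (c 5)
  adj_01 : G.Adj (c 0) (c 1)
  adj_12 : G.Adj (c 1) (c 2)
  adj_23 : G.Adj (c 2) (c 3)
  adj_34 : G.Adj (c 3) (c 4)
  adj_45 : G.Adj (c 4) (c 5)
  apex_0 : Apex G p ψ (B 6) (B 13) r (c 0) (c 1) (y 0)
  apex_1 : Apex G p ψ (B 7) (B 13) (c 0) (c 1) (c 2) (y 1)
  apex_2 : Apex G p ψ (B 8) (B 13) (c 1) (c 2) (c 3) (y 2)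
  apex_3 : Apex G p ψ (B 9) (B 13) (c 4) (c 3) (c 2) (y 3)
  apex_4 : Apex G p ψ (B 10) (B 13) (c 5) (c 4) (c 3) (y 4)
  apex_5 : Apex G p ψ (B 11) (B 13) r (c 5) (c 4) (y 5)

/-- The cycle is grown from `r` along both sides, to almost all possible `c₂` and `c₃`; an edge
`c₂c₃` admitting the last two apexes then closes it. `B 0` to `B 5` host the cycle, `B 6` to `B 11`
the apexes, `B 12` the vertex `r`; `B 13` is kept for connections. -/
lemma exists_squareGadget (hσ : 0 < σ) (hp : 0 < p) (hp1 : p ≤ 1) (hσψ : 2000 * σ ≤ ψ)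
    (h21 : RgL G p (1 / 2) (σ * p ^ 2) (σ * p)) (h12 : RgL G p (1 / 2) (σ * p) (σ * p ^ 2))
    (h10 : RgL G p (1 / 2) (σ * p) σ) (B : Fin 14 → Finset V) (hB : ∀ i, ((B i).card : ℝ) = ψ) :
    ∃ c y r, SquareGadget G p ψ B c y r := by
  have hψ : 0 < ψ := by linarith
  set Ps : List (Finset V) := List.ofFn B with hPs
  have hlen : Ps.length = 14 := by simp [hPs]
  have hmem : ∀ i, B i ∈ Ps := fun i => by rw [hPs, List.mem_ofFn]; exact ⟨i, rfl⟩
  have hp2 : p ^ 2 ≤ p := by nlinarith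
  have hσp : σ * p ≤ σ := mul_le_of_le_one_right hσ.le hp1
  have hσp2 : σ * p ^ 2 ≤ σ * p := mul_le_mul_of_nonneg_left hp2 hσ.le
  have hσψ1 := mul_le_mul_of_nonneg_right hσψ hp.le
  have hσψ2 := mul_le_mul_of_nonneg_right hσψ (pow_nonneg hp.le 2)
  have hσp0 : 0 < σ * p := by positivity
  have hσp20 : 0 < σ * p ^ 2 := by positivity
  obtain ⟨r, hr, hrT⟩ : ∃ r ∈ B 12, ∀ W ∈ Ps, Typ G ((1 - 1 / 2) * p) 1 ψ [r] W := by
    obtain ⟨X', h1, h2, h3⟩ := h10.pick_typ (l := []) (by positivity) (by linarith) (by linarith)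
      (B 12) 1 (Ps.map fun W => (W, 0, ψ)) (by
      intro w hw
      obtain ⟨W, hW, rfl⟩ := List.mem_map.1 hw
      obtain ⟨i, rfl⟩ := (List.mem_ofFn).1 hW
      refine ⟨typ_zero (hB i).ge, hψ.le, ?_, le_rfl⟩
      dsimp only
      rw [pow_zero]
      linarith)
    have hpos : (0 : ℝ) < X'.card := by
      refine lt_of_lt_of_le ?_ h2
      rw [List.length_map, hlen, hB]
      push_cast
      linarith
    obtain ⟨r, hr⟩ := card_pos.1 (Nat.cast_pos.1 hpos)
    exact ⟨r, h1 hr, fun W hW => h3 r hr _ (List.mem_map.2 ⟨W, hW, rfl⟩)⟩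
  obtain ⟨c₀, hc₀, hr0⟩ : ∃ c ∈ nb G [r] (B 0), EdgeOK G p ψ Ps r c := by
    obtain ⟨X', h1, h2, h3⟩ := (h21.mono hσp2 le_rfl).pick_edgeOK (by positivity) hp hp1 hψ
      (by linarith) hrT (nb G [r] (B 0))
    have hpos : (0 : ℝ) < X'.card := by
      refine lt_of_lt_of_le ?_ h2
      have := hrT _ (hmem 0) 1 le_rfl
      rw [List.take_succ_cons, List.take_zero, pow_one] at this
      rw [hlen]
      push_cast
      linarith
    obtain ⟨c, hc⟩ := card_pos.1 (Nat.cast_pos.1 hpos)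
    exact ⟨c, h1 hc, h3 c hc⟩
  -- Chosen among the common neighbours of `c₀` and `r`, which provides the chord.
  obtain ⟨c₅, hc₅, hr5⟩ : ∃ c ∈ nb G [c₀, r] (B 5), EdgeOK G p ψ Ps r c := by
    obtain ⟨X', h1, h2, h3⟩ := h21.pick_edgeOK (by positivity) hp hp1 hψ
      (by linarith) hrT (nb G [c₀, r] (B 5))
    have hpos : (0 : ℝ) < X'.card := by
      refine lt_of_lt_of_le ?_ h2
      have := hr0 _ (hmem 5) 2 le_rfl
      rw [List.take_of_length_le (by simp), mul_pow] at this
      rw [hlen]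
      push_cast
      linarith
    obtain ⟨c, hc⟩ := card_pos.1 (Nat.cast_pos.1 hpos)
    exact ⟨c, h1 hc, h3 c hc⟩
  rw [mem_nb_one] at hc₀
  simp only [mem_nb, List.mem_cons, List.not_mem_nil, or_false, forall_eq_or_imp, forall_eq] at hc₅
  have hσψ' : 16 * (Ps.length + 1) * σ ≤ ψ := by rw [hlen]; push_cast; linarith
  obtain ⟨L, hL, hLc, hLT⟩ := exists_side hσ hp hp1 hψ hσψ' h21 h12 h10 hr0 (hmem 1) (hmem 6)
    (hmem 7) (hmem 13) (B 2)
  obtain ⟨R, hR, hRc, hRT⟩ := exists_side hσ hp hp1 hψ hσψ' h21 h12 h10 hr5 (hmem 4) (hmem 11)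
    (hmem 10) (hmem 13) (B 3)
  rw [hB, hlen] at hLc hRc
  push_cast at hLc hRc
  choose! d₁ e₁ e₂ e₃ e₄ e₅ e₆ using hLT
  choose! d₄ f₁ f₂ f₃ f₄ f₅ f₆ using hRT
  obtain ⟨c₂, hc₂, c₃, hc₃, h23, ⟨y₂, hy₂⟩, ⟨y₃, hy₃⟩⟩ := exists_good_edge (L := L) (R := R)
    (σ := σ) (ψ := ψ) hσ hp hp1 (by linarith) h10 (by linarith)
    (by rw [← hB 2]; exact_mod_cast card_le_card hL) (by linarith)
    (by rw [← hB 3]; exact_mod_cast card_le_card hR)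
    (fun a b => ∃ y, Apex G p ψ (B 8) (B 13) (d₁ a) a b y)
    (fun a b => ∃ y, Apex G p ψ (B 9) (B 13) (d₄ b) b a y) (D := 29 * σ) (by linarith)
    (fun a ha => by
      obtain ⟨X', h1, h2, h3⟩ := exists_apexes hσ hp hp1 hψ (by linarith) h21 h12 (e₄ a ha)
        (hmem 8) (hmem 13) (nb G [a] R)
      refine ⟨X', h1, ?_, fun b hb => (h3 b hb).2⟩
      rw [hlen] at h2
      push_cast at h2
      linarith)
    (fun b hb => by
      obtain ⟨X', h1, h2, h3⟩ := exists_apexes hσ hp hp1 hψ (by linarith) h21 h12 (f₄ b hb)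
        (hmem 9) (hmem 13) (nb G [b] L)
      refine ⟨X', h1, ?_, fun a ha => (h3 a ha).2⟩
      rw [hlen] at h2
      push_cast at h2
      linarith)
  obtain ⟨y₀, hy₀⟩ := e₅ c₂ hc₂
  obtain ⟨y₁, hy₁⟩ := e₆ c₂ hc₂
  obtain ⟨y₅, hy₅⟩ := f₅ c₃ hc₃
  obtain ⟨y₄, hy₄⟩ := f₆ c₃ hc₃
  refine ⟨![c₀, d₁ c₂, c₂, c₃, d₄ c₃, c₅], ![y₀, y₁, y₂, y₃, y₄, y₅], r, ?_, hr, hc₀.2, hc₅.2.2,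
    hc₅.2.1, e₂ c₂ hc₂, e₃ c₂ hc₂, h23, (f₃ c₃ hc₃).symm, (f₂ c₃ hc₃).symm, hy₀, hy₁, hy₂, hy₃, hy₄,
    hy₅⟩
  intro i
  fin_cases i
  · exact hc₀.1
  · exact e₁ c₂ hc₂
  · exact hL hc₂
  · exact hR hc₃
  · exact f₁ c₃ hc₃
  · exact hc₅.1

end

end PowHam

/-! ### The two traversals of the gadget -/

namespace PowHam

open Finset

section

variable {V : Type*} [DecidableEq V] {G : SimpleGraph V} [DecidableRel G.Adj]
variable {p σ θ ψ : ℝ} {k C₀ C₁ : ℕ}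

lemma kPath_two_four {x a b y : V} (h1 : G.Adj x a) (h2 : G.Adj x b) (h3 : G.Adj a b)
    (h4 : G.Adj a y) (h5 : G.Adj b y) : KPath G 2 [x, a, b, y] := by
  have k2 : KPath G 2 [a, b, y] := KPath.of_pairwise (by simp [h3, h4, h5])
  exact k2.cons (by simp [h1.symm, h2.symm])

lemma kPath_two_glue {A M : List V} {a b : V} (h1 : KPath G 2 (A ++ [a, b]))
    (h2 : KPath G 2 (a :: b :: M)) : KPath G 2 (A ++ a :: b :: M) := by
  have := h1.glue (m := M) (by simpa using h2) (by simp)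
  simpa using this

lemma SquareGadget.typ {B : Fin 14 → Finset V} {c y : Fin 6 → V} {r : V}
    (h : SquareGadget G p ψ B c y r) (i : Fin 6) :
    Typ G ((1 - 1 / 2) * p) 2 ψ [y i, c i] (B 13) ∧ G.Adj (c i) (y i) := by
  fin_cases i
  · exact ⟨h.apex_0.2.2.2.2, h.apex_0.2.2.1⟩
  · exact ⟨h.apex_1.2.2.2.2, h.apex_1.2.2.1⟩
  · exact ⟨h.apex_2.2.2.2.2, h.apex_2.2.2.1⟩
  · exact ⟨h.apex_3.2.2.2.2, h.apex_3.2.2.1⟩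
  · exact ⟨h.apex_4.2.2.2.2, h.apex_4.2.2.1⟩
  · exact ⟨h.apex_5.2.2.2.2, h.apex_5.2.2.1⟩

lemma SquareGadget.nodup {B : Fin 14 → Finset V} {c y : Fin 6 → V} {r : V}
    (h : SquareGadget G p ψ B c y r) (hB : ∀ i j, i ≠ j → Disjoint (B i) (B j)) :
    [r, c 0, c 1, c 2, c 3, c 4, c 5, y 0, y 1, y 2, y 3, y 4, y 5].Nodup ∧
    ∀ v ∈ [r, c 0, c 1, c 2, c 3, c 4, c 5, y 0, y 1, y 2, y 3, y 4, y 5], v ∉ B 13 ∧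
      ∃ i, v ∈ B i := by
  let f : Fin 13 → V := ![r, c 0, c 1, c 2, c 3, c 4, c 5, y 0, y 1, y 2, y 3, y 4, y 5]
  let g : Fin 13 → Fin 14 := ![12, 0, 1, 2, 3, 4, 5, 6, 7, 8, 9, 10, 11]
  have hfg : ∀ i, f i ∈ B (g i) := by
    intro i
    fin_cases i
    · exact h.mem_r
    · exact h.mem_c 0
    · exact h.mem_c 1
    · exact h.mem_c 2
    · exact h.mem_c 3
    · exact h.mem_c 4
    · exact h.mem_c 5
    · exact h.apex_0.1
    · exact h.apex_1.1
    · exact h.apex_2.1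
    · exact h.apex_3.1
    · exact h.apex_4.1
    · exact h.apex_5.1
  have hg : Function.Injective g := by decide
  have hg13 : ∀ i, g i ≠ 13 := by decide
  have hf : Function.Injective f := by
    intro i j hij
    by_contra hne
    exact disjoint_left.1 (hB _ _ (hg.ne hne)) (hfg i) (hij ▸ hfg j)
  have hl : [r, c 0, c 1, c 2, c 3, c 4, c 5, y 0, y 1, y 2, y 3, y 4, y 5] = List.ofFn f := rfl
  rw [hl]
  refine ⟨List.nodup_ofFn.2 hf, fun v hv => ?_⟩
  obtain ⟨i, rfl⟩ := (List.mem_ofFn).1 hv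
  exact ⟨fun h13 => disjoint_left.1 (hB _ _ (hg13 i)) (hfg i) h13, g i, hfg i⟩

/-- The gadgets for squares of paths. -/
lemma Tool.hasGadgets_two (h : Tool G p 2 σ θ C₀ C₁) (hC : 2 * C₀ + 13 ≤ C₁)
    (h12 : RgL G p (1 / 2) (σ * p) (σ * p ^ 2)) : HasGadgets G p 2 θ C₁ (14 * (8 * θ + 1)) := by
  intro Z hZ
  have hp := h.p_pos
  have hp1 := h.p_le
  have hσ := h.σ_pos
  have hθ := h.θ_pos
  have hl := h.low
  rw [show 2 - 1 = 1 from rfl, pow_one] at hl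
  obtain ⟨B, hBZ, hBc, hBd⟩ := exists_disjoint_subsets (fun _ : Fin 14 => Z)
    (fun _ => Z.card / 14) (fun _ => by simpa using Nat.mul_div_le _ _)
  set ψ : ℝ := ((Z.card / 14 : ℕ) : ℝ) with hψ
  have hψθ : 8 * θ ≤ ψ := by
    have h1 : Z.card < 14 * (Z.card / 14 + 1) := by omega
    have h2 : (Z.card : ℝ) < 14 * (ψ + 1) := by rw [hψ]; exact_mod_cast h1
    linarith
  have hσθ : 256 * 13 * σ ≤ θ := by
    refine le_trans ?_ h.size_mul_le
    have h1 : (13 : ℝ) ≤ C₁ := by exact_mod_cast (by omega : 13 ≤ C₁)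
    have h2 : (0 : ℝ) ≤ C₀ := by positivity
    have := mul_le_mul_of_nonneg_right (by linarith : (13 : ℝ) ≤ C₀ + C₁) hσ.le
    linarith
  obtain ⟨c, y, r, hg⟩ := exists_squareGadget (ψ := ψ) hσ hp hp1 (by linarith) hl h12 h.low_deg B
    (fun i => by rw [hBc])
  obtain ⟨hnd, hnB⟩ := hg.nodup hBd
  have hty : ∀ i, Typ G p 2 (2 * θ) [y i, c i] (B 13) := fun i =>
    (((hg.typ i).1.mono (by linarith) (by linarith) subset_rfl :
      Typ G ((1 - 1 / 2) * p) 2 (2 ^ 2 * (2 * θ)) [y i, c i] (B 13))).of_half hp.le (by linarith)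
  have hK2 : ∀ i, KPath G 2 [y i, c i] := fun i => KPath.of_pairwise (by simp [(hg.typ i).2.symm])
  have hcon : Conn G p 2 C₀ θ := h.conn.mono hp.le (by linarith)
  -- `K` connects `c₅, y₅` to `y₂, c₂`, and `K'` below connects `c₁, y₁` to `y₃, c₃`. Both
  -- traversals use both connectors, `K` in opposite directions.
  obtain ⟨K, hK1, hKZ, hKl, hKl', hKP⟩ := hcon _ _ (B 13) (by rfl) (by rfl) (hK2 5) (hK2 2)
    ((hty 5).mono hp.le (by linarith) subset_rfl) ((hty 2).mono hp.le (by linarith) subset_rfl)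
  have hpow := h.size_le_pow
  have hKc : (K.toFinset.card : ℝ) ≤ 2 * θ / 2 * p ^ 2 := by
    have h1 : (K.toFinset.card : ℝ) ≤ C₀ := by exact_mod_cast K.toFinset_card_le.trans hKl'
    have h2 : (0 : ℝ) ≤ C₀ := by positivity
    have h3 : (0 : ℝ) ≤ C₁ := by positivity
    linarith
  have hsd : ∀ i, Typ G p 2 θ [y i, c i] (B 13 \ K.toFinset) := fun i =>
    ((hty i).sdiff hp hp1 (by linarith) hKc).mono hp.le (by linarith) subset_rfl
  obtain ⟨K', hK'1, hK'Z, hK'l, hK'l', hK'P⟩ := hcon _ _ (B 13 \ K.toFinset) (by rfl) (by rfl)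
    (hK2 1) (hK2 3) (hsd 1) (hsd 3)
  simp only [List.reverse_cons, List.reverse_nil, List.nil_append,
    List.cons_append] at hKP hK'P
  have hKK' : ∀ v ∈ K', v ∉ K := fun v hv => by
    have := (mem_sdiff.1 (hK'Z v hv)).2
    rwa [List.mem_toFinset] at this
  have hK'B : ∀ v ∈ K', v ∈ B 13 := fun v hv => (mem_sdiff.1 (hK'Z v hv)).1
  set base : List V := [c 0, c 1, c 2, c 3, c 4, c 5, y 0, y 1, y 2, y 3, y 4, y 5] with hbase
  have hnd' : (r :: (base ++ K ++ K')).Nodup := by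
    have e1 : r :: (base ++ K ++ K') = (r :: base) ++ (K ++ K') := by simp
    rw [e1, List.nodup_append]
    refine ⟨hnd, ?_, ?_⟩
    · rw [List.nodup_append]
      refine ⟨hK1, hK'1, fun a ha b hb hab => hKK' b hb (hab ▸ ha)⟩
    · intro a ha b hb hab
      subst hab
      refine (hnB a ha).1 ?_
      rcases List.mem_append.1 hb with h | h
      · exact hKZ a h
      · exact hK'B a h
  -- `l₁` passes through `c₀ r c₅` and the edges `c₂c₁` and `c₃c₄` of the seven-cycle; `l₂` uses the
  -- complementary edges `c₀c₁`, `c₃c₂`, `c₅c₄` and omits `r`. Each of these stretches is flanked by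
  -- the apexes over its two ends, so the connectors and outer ends are the same in both.
  set l₁ : List V := y 0 :: c 0 :: r :: c 5 :: y 5 :: (K ++ y 2 :: c 2 :: c 1 :: y 1 ::
    (K' ++ y 3 :: c 3 :: c 4 :: y 4 :: [])) with hl₁
  set l₂ : List V := y 0 :: c 0 :: c 1 :: y 1 :: (K' ++ y 3 :: c 3 :: c 2 :: y 2 ::
    (K.reverse ++ y 5 :: c 5 :: c 4 :: y 4 :: [])) with hl₂
  have hp₁ : l₁.Perm (r :: (base ++ K ++ K')) := by
    rw [List.perm_iff_count]
    intro a
    simp only [hl₁, hbase, List.count_append, List.count_cons, List.count_nil]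
    ring
  have hp₂ : l₂.Perm (base ++ K ++ K') := by
    rw [List.perm_iff_count]
    intro a
    simp only [hl₂, hbase, List.count_append, List.count_cons, List.count_nil, List.count_reverse]
    ring
  have hend : KPath G 2 (y 3 :: c 3 :: c 4 :: [y 4]) :=
    kPath_two_four hg.apex_3.2.2.1.symm hg.apex_3.2.1.symm hg.adj_34 hg.apex_4.2.2.2.1
      hg.apex_4.2.2.1
  have hk₁ : KPath G 2 l₁ := by
    have s1 : KPath G 2 (c 1 :: y 1 :: (K' ++ y 3 :: c 3 :: [c 4, y 4])) := by
      have := kPath_two_glue (A := c 1 :: y 1 :: K') (by simpa using hK'P) hend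
      simpa using this
    have s2 : KPath G 2 (y 2 :: c 2 :: c 1 :: y 1 :: (K' ++ y 3 :: c 3 :: [c 4, y 4])) :=
      kPath_two_glue (A := [y 2, c 2]) (kPath_two_four hg.apex_2.2.2.1.symm hg.apex_2.2.1.symm
        hg.adj_12.symm hg.apex_1.2.2.2.1 hg.apex_1.2.2.1) s1
    have s3 := kPath_two_glue (A := c 5 :: y 5 :: K) (by simpa using hKP) s2
    have s4 : KPath G 2 (r :: c 5 :: y 5 :: (K ++ y 2 :: c 2 :: c 1 :: y 1 ::
        (K' ++ y 3 :: c 3 :: [c 4, y 4]))) :=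
      kPath_two_glue (A := [r]) (KPath.of_pairwise (by
        simp [hg.adj_r5, hg.apex_5.2.1, hg.apex_5.2.2.1])) (by simpa using s3)
    exact kPath_two_glue (A := [y 0, c 0]) (kPath_two_four hg.apex_0.2.2.1.symm
      hg.apex_0.2.1.symm hg.adj_r0.symm hg.adj_05 hg.adj_r5) s4
  have hk₂ : KPath G 2 l₂ := by
    have hKr : KPath G 2 (c 2 :: y 2 :: (K.reverse ++ [y 5, c 5])) := by
      have := hKP.reverse
      simpa using this
    have s0 : KPath G 2 (y 5 :: c 5 :: c 4 :: [y 4]) :=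
      kPath_two_four hg.apex_5.2.2.1.symm hg.apex_5.2.2.2.1.symm hg.adj_45.symm hg.apex_4.2.1
        hg.apex_4.2.2.1
    have s1 : KPath G 2 (c 2 :: y 2 :: (K.reverse ++ y 5 :: c 5 :: c 4 :: [y 4])) := by
      have := kPath_two_glue (A := c 2 :: y 2 :: K.reverse) (by simpa using hKr) s0
      simpa using this
    have s2 : KPath G 2 (y 3 :: c 3 :: c 2 :: y 2 :: (K.reverse ++ y 5 :: c 5 :: c 4 :: [y 4])) :=
      kPath_two_glue (A := [y 3, c 3]) (kPath_two_four hg.apex_3.2.2.1.symm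
        hg.apex_3.2.2.2.1.symm hg.adj_23.symm hg.apex_2.2.2.2.1 hg.apex_2.2.2.1) s1
    have s3 := kPath_two_glue (A := c 1 :: y 1 :: K') (by simpa using hK'P) s2
    exact kPath_two_glue (A := [y 0, c 0]) (kPath_two_four hg.apex_0.2.2.1.symm
      hg.apex_0.2.2.2.1.symm hg.adj_01 hg.apex_1.2.1 hg.apex_1.2.2.1) (by simpa using s3)
  have hrev₁ : l₁.reverse.take 2 = [y 4, c 4] := by simp [hl₁]
  have hrev₂ : l₂.reverse.take 2 = [y 4, c 4] := by simp [hl₂]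
  have hBZ' : ∀ i, B i ⊆ Z := fun i => hBZ i
  refine ⟨r, (r :: (base ++ K ++ K')).toFinset, [y 0, c 0], [y 4, c 4], ?_, ⟨⟨?_, rfl, rfl, ?_⟩, ?_,
    (hty 0).mono hp.le le_rfl (hBZ' 13), (hty 4).mono hp.le le_rfl (hBZ' 13)⟩⟩
  · intro v hv
    rw [List.mem_toFinset, ← List.cons_append, ← List.cons_append] at hv
    rcases List.mem_append.1 hv with hv | hv
    · rcases List.mem_append.1 hv with hv | hv
      · obtain ⟨i, hi⟩ := (hnB v hv).2
        exact hBZ' i hi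
      · exact hBZ' _ (hKZ v hv)
    · exact hBZ' _ (hK'B v hv)
  · simp
  · intro R' hR'
    rcases subset_singleton_iff.1 hR' with rfl | rfl
    · exact ⟨l₁, hp₁.nodup_iff.2 hnd', hk₁, by
        rw [List.toFinset_eq_of_perm _ _ hp₁, sdiff_empty], by simp [hl₁], hrev₁, List.nil_infix⟩
    · rw [List.nodup_cons] at hnd'
      refine ⟨l₂, hp₂.nodup_iff.2 hnd'.2, hk₂, ?_, by simp [hl₂], hrev₂, List.nil_infix⟩
      rw [List.toFinset_eq_of_perm _ _ hp₂, List.toFinset_cons,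
        insert_sdiff_of_mem _ (mem_singleton_self r), sdiff_singleton_eq_erase,
        erase_eq_of_notMem (by rw [List.mem_toFinset]; exact hnd'.1)]
  · refine (List.toFinset_card_le _).trans (le_trans (le_of_eq ?_) (by omega : 13 + K.length + K'.length ≤ C₁))
    simp [hbase]
    omega

end

end PowHam

/-! ### Changing pools and the greedy phase -/

namespace PowHam

open Finset

section

variable {V : Type*} [DecidableEq V] {G : SimpleGraph V} [DecidableRel G.Adj]
variable {p σ θ : ℝ} {k C₀ C₁ : ℕ}

lemma Typ.of_ge_half {η : ℝ} {l : List V} {Z : Finset V}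
    (h : Typ G ((1 - η) * p) k (2 ^ k * θ) l Z) (hp : 0 ≤ p) (hη : η ≤ 1 / 2) (hθ : 0 ≤ θ) :
    Typ G p k θ l Z :=
  (h.mono_prob (by linarith) (mul_le_mul_of_nonneg_right (by linarith) hp)
    (by positivity)).of_half hp hθ

/-- Extend a segment by `k` vertices of the pool such that the new end is typical for given
sets. -/
lemma Tool.switch (h : Tool G p k σ θ C₀ C₁) {η : ℝ} (hη0 : 0 ≤ η) (hη : η ≤ 1 / 2)
    (hR : RgL G p η (σ * p ^ k) (σ * p ^ (k - 1))) {S R Z : Finset V} {s e w : List V}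
    (hS : Seg G k S R s e w) (he : Typ G p k θ e Z) (hZ : Z ∩ S ⊆ R)
    (Ws : List (Finset V × ℝ)) (hlen : Ws.length ≤ 2) (hW : ∀ w ∈ Ws, w.2 ≤ w.1.card ∧ θ ≤ w.2) :
    ∃ X ⊆ Z, X.card = k ∧ ∃ e', Seg G k (S ∪ X) (R \ X) s e' w ∧
      ∀ w ∈ Ws, Typ G ((1 - η) * p) k w.2 e' w.1 := by
  have hk := h.two_le
  have hp := h.p_pos
  have hp1 := h.p_le
  have hσ := h.σ_pos
  have hθ := h.θ_pos
  have hq0 : 0 < (1 - η) * p := mul_pos (by linarith) hp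
  have hq1 : (1 - η) * p ≤ 1 := mul_le_one₀ (by linarith) hp.le hp1
  have hqp : (1 - η) * p ≤ p := mul_le_of_le_one_left hp.le (by linarith)
  have hqh : (1 - 1 / 2) * p ≤ (1 - η) * p := mul_le_mul_of_nonneg_right (by linarith) hp.le
  have hk0 : (0 : ℝ) ≤ k := by positivity
  have hs : ∀ j ≤ k, ∀ N : ℝ, N ≤ 16 * (2 * k + 1) → N * σ * p ^ j ≤ θ * ((1 - η) * p) ^ j := by
    intro j hj N hN
    refine (mul_le_mul_of_nonneg_right (h.numeric N hN) (by positivity)).trans ?_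
    refine (h.half_pow θ hθ.le hj).trans ?_
    exact mul_le_mul_of_nonneg_left (pow_le_pow_left₀ (by linarith) hqh j) hθ.le
  have hs1 := hs (k - 1) (by omega) 1 (by linarith)
  rw [one_mul] at hs1
  obtain ⟨z, h1, h2, h3, h4, -, h6⟩ := hR.exists_extension (by positivity) hq0.le hq1
    (q := k) (k := k) (by omega) (by omega) hθ.le (he.mono_prob hq0.le hqp hθ.le) hs1 Ws (by
      intro w hw
      obtain ⟨g1, g2⟩ := hW w hw
      exact ⟨g1, hθ.le.trans g2, hs1.trans (mul_le_mul_of_nonneg_right g2 (by positivity))⟩) k (by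
      have g1 := hs k le_rfl (8 * k) (by linarith)
      have g2 : (Ws.length : ℝ) ≤ 2 := by exact_mod_cast hlen
      have g3 := mul_le_mul_of_nonneg_left h.big hk0
      have g4 : 0 < (k : ℝ) * (σ * p ^ k) := by
        have : (0 : ℝ) < k := by exact_mod_cast (by omega : 0 < k)
        positivity
      have g5 := mul_le_mul_of_nonneg_right g2 g4.le
      push_cast
      linarith)
  have hK : KPath G k (z ++ e) := h4 hS.kPath_ends.2
  refine ⟨z.toFinset, fun v hv => h3 v (List.mem_toFinset.1 hv), by
    rw [List.toFinset_card_of_nodup h2, h1], (z ++ e).take k, ?_, fun w hw => ?_⟩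
  · exact hS.extend h2 (fun v hv hvS => hZ (mem_inter.2 ⟨h3 v hv, hvS⟩)) hK
  · have := h6 k le_rfl w hw
    rw [Nat.sub_self, List.drop_zero, min_self] at this
    exact this.take

/-- A vertex is not its own neighbour. Hence the uncovered set can shrink along with the greedy path
without eroding typicality: the vertex just removed belongs to every nonempty end block. -/
lemma nb_erase_self {l : List V} {Z : Finset V} {v : V} (hv : v ∈ l) :
    nb G l (Z.erase v) = nb G l Z := by
  ext u
  simp only [mem_nb, mem_erase]
  constructor
  · tauto
  · rintro ⟨h1, h2⟩
    refine ⟨⟨?_, h1⟩, h2⟩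
    rintro rfl
    exact G.loopless.irrefl _ (h2 u hv)

/-- The words produced by the greedy procedure. -/
structure GreedyWord (G : SimpleGraph V) [DecidableRel G.Adj] (p η : ℝ) (k : ℕ) (θ : ℝ)
    (U R : Finset V) (e z : List V) : Prop where
  nodup : z.Nodup
  sub : ∀ v ∈ z, v ∈ U
  kPath : KPath G k (z ++ e)
  typ_U : Typ G ((1 - η) * p) k ((1 - η) * (U \ z.toFinset).card) (z ++ e) (U \ z.toFinset)
  typ_R : Typ G ((1 - η) * p) k θ (z ++ e) R

/-- The last `k` vertices have at least `(1 - η) ^ (k + 1) * p ^ k` times as many common uncovered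
neighbours as there are uncovered vertices. At most `2 * k * (σ * p ^ k)` of these spoil typicality:
two sets have to be kept, with `k` block lengths each. -/
lemma GreedyWord.exists_next {η μ ℓ : ℝ} {U R : Finset V} {e z : List V}
    (hz : GreedyWord G p η k θ U R e z) (hp : 0 < p) (hp1 : p ≤ 1) (hσ : 0 ≤ σ)
    (hη0 : 0 ≤ η) (hη : η < 1) (hk : 1 ≤ k) (hθ : 0 ≤ θ)
    (hR : RgL G p η (σ * p ^ k) (σ * p ^ (k - 1))) (hℓ : ℓ ≤ (U \ z.toFinset).card) (hℓ0 : 0 < ℓ)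
    (hμ : μ * ℓ + 2 * k * σ ≤ (1 - η) ^ (k + 1) * ℓ) (hℓσ : σ ≤ (1 - η) ^ k * ℓ)
    (hθσ : σ ≤ (1 - η) ^ k * θ) :
    ∃ X : Finset V, μ * p ^ k * (U \ z.toFinset).card ≤ X.card ∧
      ∀ v ∈ X, GreedyWord G p η k θ U R e (v :: z) := by
  set u : ℝ := ((U \ z.toFinset).card : ℝ) with hu
  have h1η : 0 < 1 - η := by linarith
  have hq0 : 0 < (1 - η) * p := mul_pos h1η hp
  have hq1 : (1 - η) * p ≤ 1 := mul_le_one₀ (by linarith) hp.le hp1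
  have hpk : 0 < p ^ k := by positivity
  have hpk1 : 0 < p ^ (k - 1) := by positivity
  have ek : (1 - η) * (1 - η) ^ (k - 1) = (1 - η) ^ k := by
    rw [← pow_succ']; congr 1; omega
  obtain ⟨X', hX', hc, hT⟩ := hR.pick_typ (l := z ++ e) (by positivity) hq0.le hq1
    (nb G ((z ++ e).take k) (U \ z.toFinset)) k
    [(U \ z.toFinset, k - 1, (1 - η) * u), (R, k - 1, θ)] (by
    intro w hw
    simp only [List.mem_cons, List.not_mem_nil, or_false] at hw
    rcases hw with rfl | rfl
    · refine ⟨hz.typ_U.mono_len (by simp), by positivity, ?_, by dsimp only; omega⟩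
      dsimp only
      rw [mul_pow, ← mul_assoc, mul_right_comm (1 - η) u, ek]
      refine mul_le_mul_of_nonneg_right (hℓσ.trans ?_) hpk1.le
      exact mul_le_mul_of_nonneg_left hℓ (by positivity)
    · refine ⟨hz.typ_R.mono_len (by simp), hθ, ?_, by dsimp only; omega⟩
      dsimp only
      rw [mul_pow, ← mul_assoc]
      refine mul_le_mul_of_nonneg_right (hθσ.trans ?_) hpk1.le
      rw [mul_comm θ]
      exact mul_le_mul_of_nonneg_right
        (pow_le_pow_of_le_one h1η.le (by linarith) (by omega)) hθ)
  refine ⟨X', ?_, fun v hv => ?_⟩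
  · refine le_trans ?_ hc
    have h1 := hz.typ_U k le_rfl
    rw [← hu] at h1
    have h2 : (1 - η) * u * ((1 - η) * p) ^ k = (1 - η) ^ (k + 1) * u * p ^ k := by
      rw [mul_pow, pow_succ]; ring
    have h3 : μ * u + 2 * k * σ ≤ (1 - η) ^ (k + 1) * u := by
      have h4 : 0 ≤ ((1 - η) ^ (k + 1) - μ) * ℓ := by
        have : 0 ≤ 2 * (k : ℝ) * σ := by positivity
        linarith
      have h5 : 0 ≤ (1 - η) ^ (k + 1) - μ := nonneg_of_mul_nonneg_left h4 hℓ0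
      have h6 := mul_le_mul_of_nonneg_left hℓ h5
      linarith
    have h4 := mul_le_mul_of_nonneg_right h3 hpk.le
    simp only [List.length_cons, List.length_nil]
    push_cast
    linarith
  · have hvX := hX' hv
    rw [mem_nb, mem_sdiff, List.mem_toFinset] at hvX
    have hs : U \ (v :: z).toFinset = (U \ z.toFinset).erase v := by
      ext x; simp only [List.toFinset_cons, mem_sdiff, mem_insert, mem_erase]; tauto
    have hle : ((U \ (v :: z).toFinset).card : ℝ) ≤ u := by
      rw [hs, hu]; exact Nat.cast_le.2 (card_le_card (erase_subset _ _))
    refine ⟨List.nodup_cons.2 ⟨?_, hz.nodup⟩, ?_, hz.kPath.cons hvX.2, ?_, ?_⟩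
    · exact hvX.1.2
    · intro x hx
      rcases List.mem_cons.1 hx with rfl | hx
      · exact hvX.1.1
      · exact hz.sub x hx
    · intro j hj
      rcases j with _ | j
      · rw [pow_zero, mul_one, List.take_zero, nb_nil]
        exact mul_le_of_le_one_left (by positivity) (by linarith)
      · have h1 := hT v hv (U \ z.toFinset, k - 1, (1 - η) * u) List.mem_cons_self (j + 1)
          (by dsimp only; omega)
        rw [List.cons_append]
        rw [hs, nb_erase_self (by simp), ← hs]
        refine le_trans ?_ h1
        exact mul_le_mul_of_nonneg_right (mul_le_mul_of_nonneg_left hle h1η.le) (by positivity)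
    · exact (hT v hv (R, k - 1, θ) (by simp)).mono_len (by dsimp only; omega)

/-- The number of words produced by the greedy procedure. -/
lemma exists_greedyWords {η μ : ℝ} {ℓ : ℕ} {U R : Finset V} {e : List V}
    (hz : GreedyWord G p η k θ U R e []) (hp : 0 < p) (hp1 : p ≤ 1) (hσ : 0 ≤ σ)
    (hη0 : 0 ≤ η) (hη : η < 1) (hk : 1 ≤ k) (hθ : 0 ≤ θ)
    (hR : RgL G p η (σ * p ^ k) (σ * p ^ (k - 1))) (hℓ0 : 0 < ℓ) (hμ0 : 0 ≤ μ)
    (hμ : μ * ℓ + 2 * k * σ ≤ (1 - η) ^ (k + 1) * ℓ) (hℓσ : σ ≤ (1 - η) ^ k * ℓ)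
    (hθσ : σ ≤ (1 - η) ^ k * θ) (T : ℕ) (hT : T + ℓ ≤ U.card) :
    ∃ F : Finset (List V), (∀ z ∈ F, GreedyWord G p η k θ U R e z ∧ z.length = T) ∧
      ∏ i ∈ range T, (μ * p ^ k * ((U.card : ℝ) - i)) ≤ F.card := by
  induction T with
  | zero =>
    refine ⟨{[]}, fun z hz' => ?_, by simp⟩
    rw [mem_singleton] at hz'
    subst hz'
    exact ⟨hz, rfl⟩
  | succ T ih =>
    obtain ⟨F, hF, hFc⟩ := ih (by omega)
    have hcard : ∀ z ∈ F, ((U \ z.toFinset).card : ℝ) = (U.card : ℝ) - T := by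
      intro z hzF
      obtain ⟨h1, h2⟩ := hF z hzF
      have h3 : z.toFinset ⊆ U := fun v hv => h1.sub v (List.mem_toFinset.1 hv)
      rw [cast_card_sdiff h3, List.toFinset_card_of_nodup h1.nodup, h2]
    have hnext : ∀ z ∈ F, ∃ X : Finset V, μ * p ^ k * ((U.card : ℝ) - T) ≤ X.card ∧
        ∀ v ∈ X, GreedyWord G p η k θ U R e (v :: z) := by
      intro z hzF
      have hc := hcard z hzF
      rw [← hc]
      refine (hF z hzF).1.exists_next hp hp1 hσ hη0 hη hk hθ hR (ℓ := ℓ) ?_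
        (by exact_mod_cast hℓ0) hμ hℓσ hθσ
      rw [hc]
      have : ((T : ℝ) + 1) + ℓ ≤ U.card := by exact_mod_cast hT
      linarith
    choose! X hX1 hX2 using hnext
    refine ⟨F.biUnion fun z => (X z).image (· :: z), ?_, ?_⟩
    · intro z hz'
      obtain ⟨y, hy, hz'⟩ := mem_biUnion.1 hz'
      obtain ⟨v, hv, rfl⟩ := mem_image.1 hz'
      exact ⟨hX2 y hy v hv, by rw [List.length_cons, (hF y hy).2]⟩
    · rw [card_biUnion]
      · rw [prod_range_succ]
        have hnn : 0 ≤ μ * p ^ k * ((U.card : ℝ) - T) := by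
          have : ((T : ℝ) + 1) + ℓ ≤ U.card := by exact_mod_cast hT
          have h2 : (0 : ℝ) ≤ ℓ := by positivity
          exact mul_nonneg (by positivity) (by linarith)
        refine (mul_le_mul_of_nonneg_right hFc hnn).trans ?_
        rw [← nsmul_eq_mul, Nat.cast_sum]
        refine card_nsmul_le_sum _ _ _ fun z hzF => ?_
        rw [card_image_of_injective _ (fun a b hab => (List.cons.inj hab).1)]
        exact hX1 z hzF
      · intro y hy y' hy' hne
        rw [Function.onFun, disjoint_left]
        intro z hz1 hz2
        obtain ⟨v, _, rfl⟩ := mem_image.1 hz1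
        obtain ⟨v', _, h⟩ := mem_image.1 hz2
        exact hne (List.cons.inj h).2.symm

end

end PowHam

/-! ### Building the absorbing segment -/

namespace PowHam

open Finset

section

variable {V : Type*} [DecidableEq V] {G : SimpleGraph V} [DecidableRel G.Adj]
variable {p σ θ : ℝ} {k C₀ C₁ : ℕ}

lemma Tool.σ_le (h : Tool G p k σ θ C₀ C₁) : ((C₀ : ℝ) + C₁ + 2) * σ ≤ θ / 16 ∧ σ ≤ θ := by
  have h1 := h.size_mul_le
  have h2 : (5 : ℝ) ≤ C₁ := by
    have := h.size_le
    have := h.two_le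
    exact_mod_cast (by omega : 5 ≤ C₁)
  have h3 : (0 : ℝ) ≤ C₀ := by positivity
  have h4 := h.σ_pos
  have h5 : 0 ≤ (C₀ + C₁ : ℝ) * σ := by positivity
  have h6 : 5 * σ ≤ (C₀ + C₁ : ℝ) * σ := mul_le_mul_of_nonneg_right (by linarith) h4.le
  constructor <;> linarith

/-- Few vertices have small degree into a large set. -/
lemma Tool.card_low_degree_le (h : Tool G p k σ θ C₀ C₁) (A Y : Finset V) {t : ℝ}
    (ht : t ≤ p * Y.card / 2) (hY : σ ≤ Y.card) :
    ((A.filter fun v => ((nb G [v] Y).card : ℝ) < t).card : ℝ) ≤ σ * p ^ k := by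
  have hR : RgL G p (1 / 2) (σ * p ^ k) σ :=
    h.low.mono le_rfl (mul_le_of_le_one_right h.σ_pos.le (pow_le_one₀ h.p_pos.le h.p_le))
  refine le_trans (Nat.cast_le.2 (card_le_card fun v hv => ?_)) (hR.card_bad_lt A hY).le
  rw [mem_filter] at hv ⊢
  exact ⟨hv.1, fun hh => by linarith [hv.2]⟩

lemma card_nb_union_le (l : List V) (Y Z : Finset V) :
    ((nb G l (Y ∪ Z)).card : ℝ) ≤ (nb G l Y).card + (nb G l Z).card := by
  have : nb G l (Y ∪ Z) = nb G l Y ∪ nb G l Z := by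
    ext v; simp only [mem_nb, mem_union]; tauto
  rw [this]
  exact_mod_cast card_union_le _ _

/-- The segment before the greedy phase: it contains all vertices of small degree into the
skippable sets or the rest. -/
structure Prepared (G : SimpleGraph V) [DecidableRel G.Adj] [Fintype V] (p : ℝ) (k : ℕ)
    (θ θ' : ℝ) (S R₁ R₂ Z : Finset V) (s e : List V) (d : ℝ) : Prop where
  seg : Seg G k S (R₁ ∪ R₂) s e []
  disj : Disjoint R₁ R₂
  typ_s : Typ G p k θ s R₂
  typ_e : Typ G p k θ' e Z
  deg : ∀ v, v ∉ S → d ≤ (nb G [v] Z).card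

/-- The first phase: starting segment, vertices of small degree into the main pool, gadgets. -/
lemma Tool.exists_absorber [Fintype V] (h : Tool G p k σ θ C₀ C₁) {M d : ℝ}
    (hG : HasGadgets G p k θ C₁ M) (g m : ℕ) (hd : ∀ v, d ≤ (nb G [v] univ).card)
    (hdθ : 8 * θ * p ≤ d) (hdn : d ≤ p * Fintype.card V / 2) (hg : 2 ^ k * (2 * θ) ≤ g)
    (hm : M + 2 ^ k * (4 * θ) + (C₀ + C₁) * (2 * g : ℕ) ≤ m)
    (hmn : 2 * m ≤ Fintype.card V) :
    ∃ S R₁ R₂ Z s e, Prepared G p k θ (2 * θ) S R₁ R₂ Z s e (d / 2 - σ * p ^ k) ∧ R₁.card = g ∧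
      R₂.card = g ∧ Disjoint Z S ∧ (Fintype.card V : ℝ) / 2 - σ * p ^ k ≤ Z.card ∧
      (S.card : ℝ) ≤ (C₀ + C₁) * (2 * g : ℕ) + θ * p ^ k + k := by
  classical
  have hk := h.two_le
  have hp := h.p_pos
  have hp1 := h.p_le
  have hσ := h.σ_pos
  have hθ := h.θ_pos
  obtain ⟨hCσ, hσθ⟩ := h.σ_le
  have hpk : 0 < p ^ k := by positivity
  have hpk1 : p ^ k ≤ p := by
    have := pow_le_pow_of_le_one hp.le hp1 (by omega : 1 ≤ k)
    rwa [pow_one] at this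
  have hpk1' : p ^ k ≤ 1 := hpk1.trans hp1
  have hθp : θ * p ^ k ≤ θ * p := mul_le_mul_of_nonneg_left hpk1 hθ.le
  have hθ1 : θ * p ^ k ≤ θ := mul_le_of_le_one_right hθ.le hpk1'
  have hk0 : (0 : ℝ) ≤ k := by positivity
  have hC0 : (0 : ℝ) ≤ C₀ + C₁ := by positivity
  have h2k : (4 : ℝ) ≤ 2 ^ k := by
    have : (2 : ℝ) ^ 2 ≤ 2 ^ k := pow_le_pow_right₀ (by norm_num) hk
    linarith
  have hCp : ((C₀ : ℝ) + C₁ + 2) * (σ * p ^ k) ≤ θ * p ^ k / 16 := by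
    have := mul_le_mul_of_nonneg_right hCσ hpk.le
    linarith
  have hkC : 2 * (k : ℝ) + 1 ≤ C₀ + C₁ := by
    have h1 : ((2 * k + 1 : ℕ) : ℝ) ≤ C₁ := by exact_mod_cast h.size_le
    push_cast at h1
    have h2 : (0 : ℝ) ≤ C₀ := by positivity
    linarith
  have hkp : 2 * (k : ℝ) ≤ θ * p ^ k / 16 := by
    have h1 := mul_le_mul_of_nonneg_left h.big (show 0 ≤ 2 * (k : ℝ) by positivity)
    have h2 := mul_le_mul_of_nonneg_right (by linarith : 2 * (k : ℝ) ≤ C₀ + C₁ + 2)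
      (show 0 ≤ σ * p ^ k by positivity)
    linarith
  have h2kθ : 0 < 2 ^ k * θ := by positivity
  have h4θ : 4 * θ ≤ 2 ^ k * θ := mul_le_mul_of_nonneg_right h2k hθ.le
  have hM0 : 0 ≤ (C₀ + C₁ : ℝ) * (2 * g : ℕ) := by positivity
  have hgm : 2 * (g : ℝ) ≤ (C₀ + C₁) * (2 * g : ℕ) := by
    push_cast
    exact le_mul_of_one_le_left (by positivity) (by linarith)
  -- splitting the vertex set
  obtain ⟨V₁, -, hV₁c⟩ := exists_subset_card_eq (s := (univ : Finset V)) (n := m)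
    (by rw [card_univ]; omega)
  set V₂ : Finset V := univ \ V₁ with hV₂
  have hV₂c : (Fintype.card V : ℝ) / 2 ≤ V₂.card := by
    have h1 : V₂.card + V₁.card = Fintype.card V := by
      rw [hV₂, card_sdiff_add_card_eq_card (subset_univ _), card_univ]
    have h2 : (Fintype.card V : ℝ) ≤ 2 * V₂.card := by exact_mod_cast (by omega)
    linarith
  have hmr : (m : ℝ) ≤ Fintype.card V / 2 := by
    have : (2 * m : ℝ) ≤ Fintype.card V := by exact_mod_cast hmn
    linarith
  -- Vertices with few neighbours in `V₂` have at least `d / 2` neighbours in `V₁`, so they are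
  -- covered now, through `V₁`.
  set B : Finset V := univ.filter fun v => ((nb G [v] V₂).card : ℝ) < d / 2 with hB
  -- A negative threshold would demand a gadget inside the empty set.
  by_cases hM : M < 0
  · exfalso
    obtain ⟨r, S, s, e, h1, h2⟩ := hG ∅ (by simpa using hM.le)
    exact absurd (h1 (h2.seg.sub (mem_singleton_self r))) (notMem_empty _)
  rw [not_lt] at hM
  have hBc : (B.card : ℝ) ≤ σ * p ^ k := by
    refine h.card_low_degree_le univ V₂ ?_ ?_
    · have := mul_le_mul_of_nonneg_left hV₂c hp.le
      linarith
    · linarith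
  have hBC : ((C₀ : ℝ) + C₁ + 2) * B.card ≤ θ * p ^ k / 16 :=
    (mul_le_mul_of_nonneg_left hBc (by linarith)).trans hCp
  have hB0 : (0 : ℝ) ≤ B.card := by positivity
  have hCB0 : 0 ≤ (C₀ + C₁ : ℝ) * B.card := by positivity
  set Z₁ := V₁ \ B with hZ₁
  set Z₂ := V₂ \ B with hZ₂
  have hZ₁c : (m : ℝ) - B.card ≤ Z₁.card := by
    have h1 := le_card_sdiff B V₁
    rw [← hZ₁] at h1
    have h2 : m ≤ Z₁.card + B.card := by omega
    have h3 : (m : ℝ) ≤ Z₁.card + B.card := by exact_mod_cast h2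
    linarith
  have hZ₂c : (Fintype.card V : ℝ) / 2 - B.card ≤ Z₂.card := by
    have h1 := le_card_sdiff B V₂
    rw [← hZ₂] at h1
    have h2 : V₂.card ≤ Z₂.card + B.card := by omega
    have h3 : (V₂.card : ℝ) ≤ Z₂.card + B.card := by exact_mod_cast h2
    linarith
  have hZ12 : Disjoint Z₁ Z₂ := disjoint_of_subset_left sdiff_subset
    (disjoint_of_subset_right sdiff_subset disjoint_sdiff)
  have hZ₁B : Disjoint Z₁ B := sdiff_disjoint
  have hZ₂B : Disjoint Z₂ B := sdiff_disjoint
  have hnum := fun N hN => h.numeric N hN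
  obtain ⟨x, hx1, hx2, hx3, hx4, hx5⟩ := h.low.exists_typ_path (q := k) (k := k) (by positivity)
    hp hp1 (by omega) (by omega) (α := 2 ^ k * θ) h2kθ.le (A := Z₁) (by linarith) (by
      refine le_trans ?_ (h.half_pow _ h2kθ.le (by omega))
      rw [mul_div_right_comm, div_self (by positivity), one_mul]
      exact mul_le_mul_of_nonneg_right hσθ (by positivity)) [(Z₁, 2 * θ), (Z₂, 2 * θ)] (by
      have hy : σ * p ^ (k - 1) ≤ 2 ^ k * (2 * θ) * ((1 - 1 / 2) * p) ^ (k - 1) := by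
        refine le_trans ?_ (h.half_pow _ (by positivity) (by omega))
        rw [mul_div_right_comm, div_self (by positivity), one_mul]
        exact mul_le_mul_of_nonneg_right (by linarith) (by positivity)
      intro Z hZ
      simp only [List.mem_cons, List.not_mem_nil, or_false] at hZ
      rcases hZ with rfl | rfl
      · exact ⟨by dsimp only; linarith, by dsimp only; linarith, hy⟩
      · exact ⟨by dsimp only; linarith, by dsimp only; linarith, hy⟩) (by
      refine lt_of_lt_of_le ?_ (h.half_pow _ h2kθ.le le_rfl)
      rw [mul_div_right_comm, div_self (by positivity), one_mul]
      have h1 := mul_le_mul_of_nonneg_right hCp (show (0 : ℝ) ≤ 1 by norm_num)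
      have h2 := mul_le_mul_of_nonneg_right (by linarith : 2 * (k : ℝ) ≤ C₀ + C₁ + 2)
        (show 0 ≤ σ * p ^ k by positivity)
      have h3 : 0 < θ * p ^ k := by positivity
      simp only [List.length_cons, List.length_nil]
      push_cast
      linarith)
  obtain ⟨ht1, ht2⟩ := hx5 (Z₁, 2 * θ) (by simp)
  obtain ⟨ht3, -⟩ := hx5 (Z₂, 2 * θ) (by simp)
  have hxZ : x.toFinset ⊆ Z₁ := fun v hv => hx3 v (List.mem_toFinset.1 hv)
  have hxc : x.toFinset.card = k + k := by rw [List.toFinset_card_of_nodup hx2, hx1]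
  have hxcr : (x.toFinset.card : ℝ) = 2 * k := by rw [hxc]; push_cast; ring
  have hseg₁ := Seg.of_list hx4 hx2 (by omega) (w := []) List.nil_infix
  have hty₁ : Typ G p k θ (x.reverse.take k) (Z₁ \ x.toFinset) :=
    (ht2.sdiff hp hp1 (by linarith) (by rw [hxcr]; linarith)).mono hp.le (by linarith) subset_rfl
  have hBdeg : ∀ v, d / 2 ≤ (nb G [v] V₂).card ∨ v ∈ B := fun v => by
    rw [hB, mem_filter]
    rcases le_or_gt (d / 2) ((nb G [v] V₂).card : ℝ) with h | h
    · exact Or.inl h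
    · exact Or.inr ⟨mem_univ _, h⟩
  have hcover : ∀ v ∈ B, θ * p + (C₀ + C₁) * B.card ≤ (nb G [v] (Z₁ \ x.toFinset)).card := by
    intro v hv
    rw [hB, mem_filter] at hv
    have g1 := hd v
    have g2 := card_nb_union_le (G := G) [v] V₁ V₂
    rw [hV₂, union_sdiff_of_subset (subset_univ _), ← hV₂] at g2
    have g3 := card_nb_sdiff_le (G := G) [v] V₁ B
    have g4 := card_nb_sdiff_le (G := G) [v] Z₁ x.toFinset
    rw [← hZ₁] at g3
    have g5 : 0 < θ * p := by positivity
    linarith [hv.2]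
  obtain ⟨X₁, hX₁, hX₁c, e₁, hseg₂, hty₂⟩ := h.cover_set B hseg₁ hty₁ (by
    rw [disjoint_iff_inter_eq_empty.1 sdiff_disjoint])
    (disjoint_of_subset_right hxZ hZ₁B.symm) (disjoint_of_subset_right sdiff_subset hZ₁B.symm) (by
      have g1 := card_nb_sdiff_le (G := G) [] Z₁ x.toFinset
      rw [nb_nil, nb_nil] at g1
      linarith) hcover
  rw [empty_sdiff] at hseg₂
  have hX₁r : (X₁.card : ℝ) ≤ (C₀ + C₁) * B.card := by exact_mod_cast hX₁c
  obtain ⟨X₂, hX₂, hX₂c, Q, hQ, hQc, e₂, hseg₃, hty₃⟩ := h.append_gadgets hG (2 * g) hseg₂ hty₂ (by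
    rw [disjoint_union_right, disjoint_union_right]
    exact ⟨⟨disjoint_of_subset_left sdiff_subset sdiff_disjoint, disjoint_of_subset_left
      (sdiff_subset.trans sdiff_subset) hZ₁B⟩, sdiff_disjoint⟩) (by
    have g1 := card_nb_sdiff_le (G := G) [] Z₁ x.toFinset
    have g2 := card_nb_sdiff_le (G := G) [] (Z₁ \ x.toFinset) X₁
    rw [nb_nil, nb_nil] at g1 g2
    linarith)
  rw [empty_union] at hseg₃
  have hX₂r : (X₂.card : ℝ) ≤ (C₀ + C₁) * (2 * g : ℕ) := by exact_mod_cast hX₂c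
  -- Half of the skippable vertices is reserved for covering leftovers, the other half for closing
  -- the cycle.
  obtain ⟨R₁, hR₁, hR₁c⟩ := exists_subset_card_eq (s := Q) (n := g) (by omega)
  have hR₂c : (Q \ R₁).card = g := by rw [card_sdiff_of_subset hR₁]; omega
  have hgθ : θ ≤ g := by linarith
  have hZS : Disjoint (((Z₁ \ x.toFinset) \ X₁) \ X₂) (x.toFinset ∪ B ∪ X₁ ∪ X₂) := by
    rw [disjoint_union_right, disjoint_union_right, disjoint_union_right]
    exact ⟨⟨⟨disjoint_of_subset_left (sdiff_subset.trans sdiff_subset) sdiff_disjoint,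
      disjoint_of_subset_left (sdiff_subset.trans (sdiff_subset.trans sdiff_subset)) hZ₁B⟩,
      disjoint_of_subset_left sdiff_subset sdiff_disjoint⟩, sdiff_disjoint⟩
  obtain ⟨X₃, hX₃, hX₃c, e₃, hseg₄, hty₄⟩ := h.switch (by norm_num) le_rfl h.low hseg₃ hty₃ (by
    rw [disjoint_iff_inter_eq_empty.1 hZS]; exact empty_subset _) [(Q \ R₁, (g : ℝ))] (by simp) (by
    intro w hw
    rw [List.mem_singleton] at hw
    subst hw
    exact ⟨by rw [hR₂c], hgθ⟩)
  have hQX : Q \ X₃ = Q := sdiff_eq_self_of_disjoint (disjoint_of_subset_left hseg₃.sub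
    (disjoint_of_subset_right hX₃ hZS.symm))
  rw [hQX] at hseg₄
  refine ⟨x.toFinset ∪ B ∪ X₁ ∪ X₂ ∪ X₃, R₁, Q \ R₁, Z₂, e₃, x.take k, ⟨?_, disjoint_sdiff, ?_,
    ht3, fun v hv => ?_⟩, hR₁c, hR₂c, ?_, by linarith, ?_⟩
  -- The segment is reversed: the end just made typical for `Q \ R₁` becomes the start, to be met
  -- again when the cycle is closed, and growth continues from the initial block, which is typical
  -- for `Z₂`.
  · rw [union_sdiff_of_subset hR₁]
    simpa using hseg₄.reverse
  · exact ((hty₄ _ (List.mem_singleton_self _)).mono (by linarith) (by linarith)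
      subset_rfl).of_half hp.le hθ.le
  · have g1 := (hBdeg v).resolve_right fun hvB => hv (by simp [hvB])
    have g2 := card_nb_sdiff_le (G := G) [v] V₂ B
    rw [← hZ₂] at g2
    linarith
  · have hX₁' := hX₁.trans sdiff_subset
    have hX₂' := hX₂.trans (sdiff_subset.trans sdiff_subset)
    have hX₃' := hX₃.trans (sdiff_subset.trans (sdiff_subset.trans sdiff_subset))
    rw [disjoint_union_right, disjoint_union_right, disjoint_union_right, disjoint_union_right]
    exact ⟨⟨⟨⟨disjoint_of_subset_right hxZ hZ12.symm, hZ₂B⟩, disjoint_of_subset_right hX₁' hZ12.symm⟩,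
      disjoint_of_subset_right hX₂' hZ12.symm⟩, disjoint_of_subset_right hX₃' hZ12.symm⟩
  · have g1 := card_union_le (x.toFinset ∪ B ∪ X₁ ∪ X₂) X₃
    have g2 := card_union_le (x.toFinset ∪ B ∪ X₁) X₂
    have g3 := card_union_le (x.toFinset ∪ B) X₁
    have g4 := card_union_le x.toFinset B
    have g5 : ((x.toFinset ∪ B ∪ X₁ ∪ X₂ ∪ X₃).card : ℝ) ≤
        x.toFinset.card + B.card + X₁.card + X₂.card + k := by
      exact_mod_cast (by omega)
    linarith

end

end PowHam

/-! ### Before and after the greedy phase -/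

namespace PowHam

open Finset

section

variable {V : Type*} [DecidableEq V] {G : SimpleGraph V} [DecidableRel G.Adj]
variable {p σ θ η : ℝ} {k C₀ C₁ : ℕ}

/-- The situation at the start of the greedy phase. -/
structure Ready (G : SimpleGraph V) [DecidableRel G.Adj] [Fintype V] (p η : ℝ) (k : ℕ)
    (θ : ℝ) (S R₁ R₂ : Finset V) (s e : List V) : Prop where
  seg : Seg G k S (R₁ ∪ R₂) s e []
  disj : Disjoint R₁ R₂
  typ_s : Typ G p k θ s R₂
  typ_U : Typ G ((1 - η) * p) k ((1 - η) * (univ \ S).card) e (univ \ S)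
  typ_R : Typ G ((1 - η) * p) k R₁.card e R₁
  deg : ∀ v, v ∉ S → p * R₁.card / 2 ≤ (nb G [v] R₁).card

/-- The second phase: vertices of small degree into the skippable set are covered and the end is
made typical. -/
lemma Tool.exists_ready [Fintype V] (h : Tool G p k σ θ C₀ C₁) {S R₁ R₂ Z : Finset V}
    {s e : List V} {d : ℝ} (hP : Prepared G p k θ (2 * θ) S R₁ R₂ Z s e (d / 2 - σ * p ^ k))
    (hdθ : 8 * θ * p ≤ d) (hR₁ : 2 ^ k * (2 * θ) ≤ R₁.card) (hZS : Disjoint Z S)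
    (hZ : (Fintype.card V : ℝ) / 2 - σ * p ^ k ≤ Z.card)
    (hn : 2 ^ k * (16 * θ) ≤ Fintype.card V) (hη0 : 0 ≤ η) (hη : η ≤ 1 / 2)
    (hR : RgL G p η (σ * p ^ k) (σ * p ^ (k - 1)))
    (hkη : (k : ℝ) ≤ η * (Fintype.card V / 4) * ((1 - η) * p) ^ k) :
    ∃ S' e', Ready G p η k θ S' R₁ R₂ s e' ∧ (S'.card : ℝ) ≤ S.card + θ * p ^ k + k := by
  classical
  have hk := h.two_le
  have hp := h.p_pos
  have hp1 := h.p_le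
  have hσ := h.σ_pos
  have hθ := h.θ_pos
  obtain ⟨hCσ, hσθ⟩ := h.σ_le
  have hpk : 0 < p ^ k := by positivity
  have hpk1 : p ^ k ≤ p := by
    have := pow_le_pow_of_le_one hp.le hp1 (by omega : 1 ≤ k)
    rwa [pow_one] at this
  have hθp : θ * p ^ k ≤ θ * p := mul_le_mul_of_nonneg_left hpk1 hθ.le
  have hθ1 : θ * p ^ k ≤ θ := mul_le_of_le_one_right hθ.le (hpk1.trans hp1)
  have hC0 : (0 : ℝ) ≤ C₀ + C₁ := by positivity
  have h2k : (4 : ℝ) ≤ 2 ^ k := by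
    have : (2 : ℝ) ^ 2 ≤ 2 ^ k := pow_le_pow_right₀ (by norm_num) hk
    linarith
  have h4θ : 4 * θ ≤ 2 ^ k * θ := mul_le_mul_of_nonneg_right h2k hθ.le
  have hCp : ((C₀ : ℝ) + C₁ + 2) * (σ * p ^ k) ≤ θ * p ^ k / 16 := by
    have := mul_le_mul_of_nonneg_right hCσ hpk.le
    linarith
  have hσp0 : 0 < σ * p ^ k := by positivity
  have hCσp : 0 ≤ (C₀ + C₁ : ℝ) * (σ * p ^ k) := by positivity
  have hθp0 : 0 < θ * p := by positivity
  set B : Finset V := (univ.filter fun v => ((nb G [v] R₁).card : ℝ) < p * R₁.card / 2) \ S with hB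
  have hBc : (B.card : ℝ) ≤ σ * p ^ k :=
    (Nat.cast_le.2 (card_le_card sdiff_subset)).trans
      (h.card_low_degree_le univ R₁ le_rfl (by linarith))
  have hBC : ((C₀ : ℝ) + C₁ + 2) * B.card ≤ θ * p ^ k / 16 :=
    (mul_le_mul_of_nonneg_left hBc (by linarith)).trans hCp
  have hB0 : (0 : ℝ) ≤ B.card := by positivity
  have hCB0 : 0 ≤ (C₀ + C₁ : ℝ) * B.card := by positivity
  have hZB := card_nb_sdiff_le (G := G) [] Z B
  rw [nb_nil, nb_nil] at hZB
  obtain ⟨X₁, hX₁, hX₁c, e₁, hseg₁, hty₁⟩ := h.cover_set B (Z := Z \ B) hP.seg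
    ((hP.typ_e.sdiff hp hp1 (by linarith) (by linarith)).mono hp.le (by linarith) subset_rfl) (by
      rw [disjoint_iff_inter_eq_empty.1 (disjoint_of_subset_left sdiff_subset hZS)]
      exact empty_subset _) sdiff_disjoint disjoint_sdiff (by linarith) (fun v hv => by
      have g1 := hP.deg v (mem_sdiff.1 hv).2
      have g2 := card_nb_sdiff_le (G := G) [v] Z B
      linarith)
  have hX₁r : (X₁.card : ℝ) ≤ (C₀ + C₁) * B.card := by exact_mod_cast hX₁c
  set S₁ := S ∪ B ∪ X₁ with hS₁
  have hZS₁ : Disjoint ((Z \ B) \ X₁) S₁ := by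
    rw [disjoint_union_right, disjoint_union_right]
    exact ⟨⟨disjoint_of_subset_left (sdiff_subset.trans sdiff_subset) hZS,
      disjoint_of_subset_left sdiff_subset sdiff_disjoint⟩, sdiff_disjoint⟩
  have hRX : (R₁ ∪ R₂) \ X₁ = R₁ ∪ R₂ := sdiff_eq_self_of_disjoint (disjoint_of_subset_left
    hP.seg.sub (disjoint_of_subset_right (hX₁.trans sdiff_subset) hZS.symm))
  rw [hRX] at hseg₁
  have hR₁θ : θ ≤ R₁.card := by linarith
  have hZU : (Z \ B) \ X₁ ⊆ univ \ S₁ := fun v hv =>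
    mem_sdiff.2 ⟨mem_univ _, disjoint_left.1 hZS₁ hv⟩
  have hU : (Fintype.card V : ℝ) / 4 ≤ (univ \ S₁).card := by
    have g1 := card_nb_sdiff_le (G := G) [] (Z \ B) X₁
    rw [nb_nil, nb_nil] at g1
    have g2 : (((Z \ B) \ X₁).card : ℝ) ≤ (univ \ S₁).card := by exact_mod_cast card_le_card hZU
    linarith
  obtain ⟨X₂, hX₂, hX₂c, e₂, hseg₂, hty₂⟩ := h.switch hη0 hη hR hseg₁ hty₁ (by
    rw [disjoint_iff_inter_eq_empty.1 hZS₁]; exact empty_subset _)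
    [(univ \ S₁, ((univ \ S₁).card : ℝ)), (R₁, (R₁.card : ℝ))] (by simp) (by
    intro w hw
    simp only [List.mem_cons, List.not_mem_nil, or_false] at hw
    rcases hw with rfl | rfl
    · exact ⟨le_rfl, by dsimp only; linarith⟩
    · exact ⟨le_rfl, hR₁θ⟩)
  have hRX₂ : (R₁ ∪ R₂) \ X₂ = R₁ ∪ R₂ := sdiff_eq_self_of_disjoint (disjoint_of_subset_left
    hseg₁.sub (disjoint_of_subset_right hX₂ hZS₁.symm))
  rw [hRX₂] at hseg₂
  have hsd : univ \ (S₁ ∪ X₂) = (univ \ S₁) \ X₂ := by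
    rw [sdiff_sdiff_left, sup_eq_union]
  have hle : ((univ \ (S₁ ∪ X₂)).card : ℝ) ≤ (univ \ S₁).card := by
    rw [hsd]; exact_mod_cast card_le_card sdiff_subset
  refine ⟨S₁ ∪ X₂, e₂, ⟨hseg₂, hP.disj, hP.typ_s, ?_, hty₂ (R₁, (R₁.card : ℝ)) (by simp), ?_⟩, ?_⟩
  -- The factor `1 - η` in front of the size pays for the `k` vertices that the switch itself
  -- removed from the uncovered set.
  · intro j hj
    have hq0 : 0 ≤ (1 - η) * p := mul_nonneg (by linarith) hp.le
    have g1 := hty₂ (univ \ S₁, ((univ \ S₁).card : ℝ)) (by simp) j hj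
    have g2 := card_nb_sdiff_le (G := G) (e₂.take j) (univ \ S₁) X₂
    rw [← hsd, hX₂c] at g2
    have g3 : (k : ℝ) ≤ η * (univ \ S₁).card * ((1 - η) * p) ^ j := by
      refine hkη.trans (mul_le_mul (mul_le_mul_of_nonneg_left hU hη0) ?_ (by positivity)
        (by positivity))
      exact pow_le_pow_of_le_one hq0 (mul_le_one₀ (by linarith) hp.le hp1) hj
    have g4 : (1 - η) * (univ \ (S₁ ∪ X₂)).card * ((1 - η) * p) ^ j ≤
        (1 - η) * (univ \ S₁).card * ((1 - η) * p) ^ j :=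
      mul_le_mul_of_nonneg_right (mul_le_mul_of_nonneg_left hle (by linarith)) (by positivity)
    dsimp only at g1
    linarith
  · intro v hv
    by_contra hlt
    rw [not_le] at hlt
    refine hv (mem_union_left _ ?_)
    rw [hS₁, mem_union, mem_union]
    by_cases hvS : v ∈ S
    · exact Or.inl (Or.inl hvS)
    · refine Or.inl (Or.inr ?_)
      rw [hB, mem_sdiff, mem_filter]
      exact ⟨⟨mem_univ _, hlt⟩, hvS⟩
  · have g1 := card_union_le S₁ X₂
    have g2 := card_union_le (S ∪ B) X₁
    have g3 := card_union_le S B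
    rw [← hS₁] at g2
    have g5 : ((S₁ ∪ X₂).card : ℝ) ≤ S.card + B.card + X₁.card + k := by
      exact_mod_cast (by omega)
    have : 0 < θ * p ^ k := by positivity
    linarith

/-- A cyclic list all of whose windows of `k + 1` vertices are cliques. -/
def CycPath (G : SimpleGraph V) (k : ℕ) (L : List V) : Prop := KPath G k (L ++ L.take k)

/-- Any greedy word can be completed to the `k`-th power of a Hamilton cycle. -/
lemma Tool.exists_cycle [Fintype V] (h : Tool G p k σ θ C₀ C₁) {S R₁ R₂ : Finset V}
    {s e z : List V} {ℓ : ℕ} (hP : Ready G p η k θ S R₁ R₂ s e) (hη : η ≤ 1 / 2)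
    (hz : GreedyWord G p η k R₁.card (univ \ S) R₁ e z)
    (hU : ((univ \ S) \ z.toFinset).card = ℓ)
    (hR₁ : 2 ^ k * (4 * θ) + (C₀ + C₁) * ℓ ≤ R₁.card) (hR₂ : 2 ^ k * θ ≤ R₂.card) :
    ∃ L : List V, L.Nodup ∧ L.toFinset = univ ∧ CycPath G k L ∧ z.reverse <:+: L := by
  have hk := h.two_le
  have hp := h.p_pos
  have hp1 := h.p_le
  have hσ := h.σ_pos
  have hθ := h.θ_pos
  obtain ⟨hCσ, hσθ⟩ := h.σ_le
  have h2k : (4 : ℝ) ≤ 2 ^ k := by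
    have : (2 : ℝ) ^ 2 ≤ 2 ^ k := pow_le_pow_right₀ (by norm_num) hk
    linarith
  have h4θ : 4 * θ ≤ 2 ^ k * θ := mul_le_mul_of_nonneg_right h2k hθ.le
  have hC0 : (0 : ℝ) ≤ C₀ + C₁ := by positivity
  have hCℓ : (0 : ℝ) ≤ (C₀ + C₁) * ℓ := by positivity
  have hseg₁ := hP.seg.extend_word hz.nodup (fun v hv => (mem_sdiff.1 (hz.sub v hv)).2) hz.kPath
  set S₁ := S ∪ z.toFinset with hS₁
  have hty₁ : Typ G p k θ ((z ++ e).take k) R₁ :=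
    ((hz.typ_R.mono (mul_nonneg (by linarith) hp.le) (by linarith)
      subset_rfl).of_ge_half hp.le hη hθ.le).take
  have hRS : R₁ ∪ R₂ ⊆ S := hP.seg.sub
  set U := (univ \ S) \ z.toFinset with hUdef
  have hUS₁ : U = univ \ S₁ := by rw [hUdef, hS₁, sdiff_sdiff_left, sup_eq_union]
  have hdU : Disjoint U S₁ := by rw [hUS₁]; exact sdiff_disjoint
  have hR₁S : R₁ ⊆ S₁ := subset_union_left.trans (hRS.trans subset_union_left)
  -- `R₁` acts as the pool although it lies inside the segment, because its vertices are skippable.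
  obtain ⟨X₁, hX₁, hX₁c, e₁, hseg₂, hty₂⟩ := h.cover_all ℓ hU hseg₁ hty₁
    (inter_subset_left.trans subset_union_left) hdU (disjoint_of_subset_right hR₁S hdU)
    (by rw [hU]; linarith) (fun v hv => by
      have g1 := hP.deg v (mem_sdiff.1 (mem_sdiff.1 hv).1).2
      have g2 := mul_le_mul_of_nonneg_left (by linarith : 4 * θ ≤ R₁.card) hp.le
      have g3 : 0 ≤ (C₀ + C₁ : ℝ) * (σ * p) := by positivity
      linarith)
  have huniv : S₁ ∪ U ∪ X₁ = univ := by
    rw [hUS₁, union_sdiff_of_subset (subset_univ _)]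
    exact union_eq_left.2 (subset_univ _)
  rw [huniv] at hseg₂
  have hX₁r : (X₁.card : ℝ) ≤ (C₀ + C₁) * ℓ := by
    rw [hU] at hX₁c
    exact_mod_cast hX₁c
  obtain ⟨X₂, hX₂, hX₂c, e₂, hseg₃, hty₃⟩ := h.switch (by norm_num) le_rfl h.low hseg₂ hty₂ (by
    rw [inter_univ]
    exact sdiff_subset_sdiff subset_union_left subset_rfl) [(R₂, (R₂.card : ℝ))] (by simp) (by
    intro w hw
    rw [List.mem_singleton] at hw
    subst hw
    exact ⟨le_rfl, by dsimp only; linarith⟩)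
  rw [union_eq_left.2 (subset_univ X₂)] at hseg₃
  have hty₄ : Typ G p k θ e₂ R₂ := ((hty₃ _ (List.mem_singleton_self _)).mono (by linarith) hR₂
    subset_rfl).of_half hp.le hθ.le
  have hcon := h.conn.mono hp.le (by linarith : θ / 2 ≤ θ)
  obtain ⟨c, hc1, hc2, hc3, -, hc5⟩ := hcon e₂ s R₂ hseg₃.len_e hseg₃.len_s hseg₃.kPath_ends.2
    hseg₃.kPath_ends.1 hty₄ hP.typ_s
  -- Everything used so far from the skippable set came from `R₁`, so all of `R₂` is still
  -- skippable. The segment can skip exactly the closing connection `c`, and contains every other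
  -- vertex.
  have hcR : c.toFinset ⊆ ((R₁ ∪ R₂) \ X₁) \ X₂ := by
    intro v hv
    have hv2 := hc2 v (List.mem_toFinset.1 hv)
    have hv1 := disjoint_right.1 hP.disj hv2
    rw [mem_sdiff, mem_sdiff]
    exact ⟨⟨mem_union_right _ hv2, fun hh => hv1 (hX₁ hh)⟩,
      fun hh => hv1 (mem_sdiff.1 (hX₂ hh)).1⟩
  obtain ⟨l, l1, l2, l3, l4, l5, l6⟩ := hseg₃.real _ hcR
  have hkl : k ≤ l.length := by
    have := hseg₃.len_s
    rw [← l4, List.length_take] at this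
    omega
  refine ⟨l ++ c, ?_, ?_, ?_, l6.trans (List.prefix_append _ _).isInfix⟩
  · rw [List.nodup_append]
    refine ⟨l1, hc1, fun a ha b hb hab => ?_⟩
    subst hab
    have := List.mem_toFinset.2 ha
    rw [l3, mem_sdiff] at this
    exact this.2 (List.mem_toFinset.2 hb)
  · rw [List.toFinset_append, l3, sdiff_union_of_subset (subset_univ _)]
  · rw [CycPath, List.take_append_of_le_length hkl, l4]
    have e1 : l = l.take (l.length - k) ++ e₂.reverse := by
      rw [← l5, List.take_reverse, List.reverse_reverse, List.take_append_drop]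
    have g1 : KPath G k (l.take (l.length - k) ++ e₂.reverse ++ (c ++ s)) := by
      refine KPath.glue (by rw [← e1]; exact l2) (by simpa using hc5) ?_
      rw [List.length_reverse, hseg₃.len_e]
    rw [← e1] at g1
    simpa using g1

end

end PowHam

/-! ### Words contained in Hamilton cycle powers -/

namespace PowHam

open Finset

section

variable {V : Type*} [DecidableEq V] {G : SimpleGraph V} [DecidableRel G.Adj]
variable {p σ θ η : ℝ} {k C₀ C₁ : ℕ}

/-- Many words that are infixes of `k`-th powers of Hamilton cycles. -/
lemma Tool.exists_words [Fintype V] (h : Tool G p k σ θ C₀ C₁) {M d μ : ℝ}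
    (hG : HasGadgets G p k θ C₁ M) (g m ℓ : ℕ) (hd : ∀ v, d ≤ (nb G [v] univ).card)
    (hdθ : 8 * θ * p ≤ d) (hdn : d ≤ p * Fintype.card V / 2)
    (hg : 2 ^ k * (4 * θ) + (C₀ + C₁) * ℓ ≤ g)
    (hm : M + 2 ^ k * (4 * θ) + (C₀ + C₁) * (2 * g : ℕ) ≤ m)
    (hmn : 2 * m ≤ Fintype.card V) (hn : 2 ^ k * (16 * θ) ≤ Fintype.card V)
    (hη0 : 0 ≤ η) (hη : η ≤ 1 / 2) (hR : RgL G p η (σ * p ^ k) (σ * p ^ (k - 1)))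
    (hkη : (k : ℝ) ≤ η * (Fintype.card V / 4) * ((1 - η) * p) ^ k) (hℓ0 : 0 < ℓ) (hμ0 : 0 ≤ μ)
    (hμ : μ * ℓ + 2 * k * σ ≤ (1 - η) ^ (k + 1) * ℓ) (hℓσ : σ ≤ (1 - η) ^ k * ℓ)
    (hfin : (C₀ + C₁) * (2 * g : ℕ) + 4 * θ + ℓ ≤ Fintype.card V) :
    ∃ T ≤ Fintype.card V,
      (Fintype.card V : ℝ) ≤ T + ((C₀ + C₁) * (2 * g : ℕ) + 4 * θ + ℓ) ∧
      ∃ F : Finset (List V), (∀ z ∈ F, z.length = T ∧ ∃ L : List V, L.Nodup ∧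
        L.toFinset = univ ∧ CycPath G k L ∧ z.reverse <:+: L) ∧
        ∏ i ∈ range T, (μ * p ^ k * (((T + ℓ : ℕ) : ℝ) - i)) ≤ F.card := by
  have hp := h.p_pos
  have hp1 := h.p_le
  have hσ := h.σ_pos
  have hθ := h.θ_pos
  have hk := h.two_le
  obtain ⟨hCσ, hσθ⟩ := h.σ_le
  have hCℓ : (0 : ℝ) ≤ (C₀ + C₁) * ℓ := by positivity
  have h2kθ : 0 < 2 ^ k * θ := by positivity
  obtain ⟨S₀, R₁, R₂, Z, s, e₀, hP, hR₁, hR₂, hZS, hZ, hS₀⟩ := h.exists_absorber hG g m hd hdθ hdn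
    (by linarith) hm hmn
  have hR₁r : (R₁.card : ℝ) = g := by rw [hR₁]
  have hR₂r : (R₂.card : ℝ) = g := by rw [hR₂]
  obtain ⟨S, e, hS, hSc⟩ := h.exists_ready hP hdθ (by linarith) hZS hZ hn hη0 hη hR hkη
  have hkp : (k : ℝ) ≤ θ * p ^ k := by
    refine le_trans ?_ h.size_le_pow
    have h1 : ((2 * k + 1 : ℕ) : ℝ) ≤ C₁ := by exact_mod_cast h.size_le
    push_cast at h1
    have h2 : (0 : ℝ) ≤ C₀ := by positivity
    have h3 : (0 : ℝ) ≤ k := by positivity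
    linarith
  have hθp : θ * p ^ k ≤ θ := mul_le_of_le_one_right hθ.le (pow_le_one₀ hp.le hp1)
  have hUc : ((univ \ S).card : ℝ) = (Fintype.card V : ℝ) - S.card := by
    rw [cast_card_sdiff (subset_univ _), card_univ]
  have hUℓ : ℓ ≤ (univ \ S).card := by
    have : (ℓ : ℝ) ≤ (univ \ S).card := by linarith
    exact_mod_cast this
  have hz0 : GreedyWord G p η k R₁.card (univ \ S) R₁ e [] :=
    ⟨List.nodup_nil, by simp, by simpa using hS.seg.kPath_ends.2, by simpa using hS.typ_U,
      by simpa using hS.typ_R⟩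
  have h1η : (0 : ℝ) ≤ (1 - η) ^ k := pow_nonneg (by linarith) k
  have hC5 : (1 : ℝ) ≤ C₀ + C₁ := by
    have := h.size_le
    exact_mod_cast (by omega : 1 ≤ C₀ + C₁)
  have hℓg : (ℓ : ℝ) ≤ g := by
    have : (ℓ : ℝ) ≤ (C₀ + C₁) * ℓ := le_mul_of_one_le_left (by positivity) hC5
    linarith
  -- The greedy phase stops when exactly `ℓ` vertices are uncovered, as many as `R₁` is able to
  -- cover.
  obtain ⟨F, hF, hFc⟩ := exists_greedyWords hz0 hp hp1 hσ.le hη0 (by linarith) (by omega)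
    (by positivity) hR hℓ0 hμ0 hμ hℓσ (hℓσ.trans (by
      rw [hR₁r]
      exact mul_le_mul_of_nonneg_left hℓg h1η)) ((univ \ S).card - ℓ) (by omega)
  have hTu : (univ \ S).card - ℓ + ℓ = (univ \ S).card := by omega
  refine ⟨(univ \ S).card - ℓ, (Nat.sub_le _ _).trans (by simpa using card_le_univ (univ \ S)),
    ?_, F, fun z hz => ?_, ?_⟩
  · rw [Nat.cast_sub hUℓ]
    linarith
  · obtain ⟨hz1, hz2⟩ := hF z hz
    refine ⟨hz2, h.exists_cycle (ℓ := ℓ) hS hη hz1 ?_ (by linarith) (by linarith)⟩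
    have : z.toFinset ⊆ univ \ S := fun v hv => hz1.sub v (List.mem_toFinset.1 hv)
    rw [card_sdiff_of_subset this, List.toFinset_card_of_nodup hz1.nodup, hz2]
    omega
  · rwa [hTu]

end

end PowHam

/-! ### From cyclic lists to labelled copies -/

namespace PowHam

open Finset

section

variable {V : Type*} [DecidableEq V] {G : SimpleGraph V} [DecidableRel G.Adj]
variable {k : ℕ}

lemma CycPath.adj {L : List V} {i t : ℕ} (h : CycPath G k L) (hi : i < L.length) (ht : t ≤ k)
    (hne : (i + t) % L.length ≠ i) :
    G.Adj L[i] (L[(i + t) % L.length]'(Nat.mod_lt _ (by omega))) := by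
  have hn : 0 < L.length := by omega
  set n := L.length with hnL
  -- The shift is reduced modulo `n`, so that at most one wrap-around occurs; it stays positive
  -- because the two positions differ.
  obtain ⟨t', ht', ht'n, ht'0, hmod⟩ : ∃ t' ≤ k, t' < n ∧ 0 < t' ∧ (i + t) % n = (i + t') % n := by
    refine ⟨t % n, (Nat.mod_le _ _).trans ht, Nat.mod_lt _ hn, ?_, by simp⟩
    by_contra h0
    have h0 : t % n = 0 := by omega
    exact hne (by rw [Nat.add_mod, h0, add_zero, Nat.mod_mod, Nat.mod_eq_of_lt hi])
  have hj : (L ++ L.take k)[i + t']? = some (L[(i + t) % n]'(Nat.mod_lt _ hn)) := by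
    rcases Nat.lt_or_ge (i + t') n with hlt | hge
    · rw [List.getElem?_append_left hlt, List.getElem?_eq_getElem hlt]
      congr 2
      rw [hmod, Nat.mod_eq_of_lt hlt]
    · have h1 : (i + t') % n = i + t' - n := by
        rw [Nat.mod_eq_sub_mod hge, Nat.mod_eq_of_lt (by omega)]
      rw [List.getElem?_append_right hge, List.getElem?_take_of_lt (by omega),
        List.getElem?_eq_getElem (by omega)]
      congr 2
      rw [hmod, h1]
  exact h i (i + t') _ _ (by omega) (by omega)
    (by rw [List.getElem?_append_left hi, List.getElem?_eq_getElem hi]) hj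

/-- Each step of a walk changes the residue by `1` or `-1`, so distance at most `k` becomes a cyclic
shift by at most `k`. -/
lemma cycleGraph_walk_modEq {n : ℕ} {u v : Fin n} (w : (SimpleGraph.cycleGraph n).Walk u v) :
    ∃ t : ℤ, |t| ≤ w.length ∧ (v : ℤ) ≡ u + t [ZMOD n] := by
  induction w with
  | nil => exact ⟨0, by simp, by simp⟩
  | @cons a b c hab w ih =>
    obtain ⟨t, ht, hm⟩ := ih
    have key : ∀ x y : Fin n, (x - y).val = 1 → (x : ℤ) ≡ y + 1 [ZMOD n] := by
      intro x y hxy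
      rw [Fin.sub_def] at hxy
      have h1 : (((n - y + x) % n : ℕ) : ℤ) = 1 := by exact_mod_cast hxy
      rw [Int.natCast_mod, Nat.cast_add, Nat.cast_sub y.isLt.le] at h1
      have h2 : ((n : ℤ) - y + x) ≡ 1 [ZMOD n] := by
        have := Int.mod_modEq ((n : ℤ) - y + x) n
        rw [h1] at this
        exact this.symm
      have h3 := h2.add_right (y : ℤ)
      have h4 : (n : ℤ) - y + x + y = n + x := by ring
      rw [h4] at h3
      have h5 : (x : ℤ) ≡ n + x [ZMOD n] := by
        have : (n : ℤ) ≡ 0 [ZMOD n] := by simp [Int.ModEq]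
        have := (this.add_right (x : ℤ)).symm
        rwa [zero_add] at this
      exact (h5.trans h3).trans (by rw [add_comm])
    rw [SimpleGraph.Walk.length_cons]
    rcases SimpleGraph.cycleGraph_adj'.1 hab with h | h
    · refine ⟨t - 1, ?_, ?_⟩
      · have := abs_sub t 1
        push_cast
        simp at this
        linarith
      · have h1 := (key a b h).add_right (t - 1)
        have h2 : (b : ℤ) + 1 + (t - 1) = b + t := by ring
        rw [h2] at h1
        exact hm.trans h1.symm
    · refine ⟨t + 1, ?_, ?_⟩
      · have := abs_add_le t 1
        push_cast
        simp at this
        linarith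
      · have h1 := (key b a h).add_right t
        have h2 : (a : ℤ) + 1 + t = a + (t + 1) := by ring
        rw [h2] at h1
        exact hm.trans h1

lemma cycleGraph_kthPower_adj {n : ℕ} {u v : Fin n}
    (h : ((SimpleGraph.cycleGraph n).kthPower k).Adj u v) :
    ∃ t ≤ k, (v : ℕ) = (u + t) % n ∨ (u : ℕ) = (v + t) % n := by
  obtain ⟨hne, hd⟩ := h
  obtain ⟨w, hw⟩ := SimpleGraph.exists_walk_of_edist_ne_top (G := SimpleGraph.cycleGraph n)
    (u := u) (v := v) (ne_top_of_le_ne_top (ENat.natCast_ne_top k) hd)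
  rw [← hw, Nat.cast_le] at hd
  obtain ⟨t, ht, hm⟩ := cycleGraph_walk_modEq w
  have key : ∀ (x y : Fin n) (s : ℕ), (y : ℤ) ≡ x + s [ZMOD n] → (y : ℕ) = (x + s) % n := by
    intro x y s hs
    have h1 : (y : ℕ) ≡ x + s [MOD n] := by
      rw [← Int.natCast_modEq_iff]
      exact_mod_cast hs
    rw [← h1, Nat.mod_eq_of_lt y.isLt]
  rcases le_total 0 t with h0 | h0
  · lift t to ℕ using h0
    refine ⟨t, ?_, Or.inl (key u v t hm)⟩
    simp at ht
    omega
  -- The first summand of the witness vanishes; `s` is simply `-t` as a natural number.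
  · obtain ⟨s, rfl⟩ : ∃ s : ℕ, t = -s := ⟨t.toNat.succ * 0 + (-t).toNat, by simp; omega⟩
    refine ⟨s, ?_, Or.inr (key v u s ?_)⟩
    · simp at ht
      omega
    · have := hm.add_right (s : ℤ)
      rw [neg_add_cancel_right] at this
      exact this.symm

/-- A copy of the `k`-th power of a cycle starting with a given infix. -/
lemma CycPath.exists_copy {n : ℕ} {L w : List V} (h : CycPath G k L) (hn : L.Nodup)
    (hl : L.length = n) (hw : w <:+: L) :
    ∃ f : SimpleGraph.Copy ((SimpleGraph.cycleGraph n).kthPower k) G,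
      ∀ (i : ℕ) (hi : i < w.length) (hin : i < n), f ⟨i, hin⟩ = w[i] := by
  subst hl
  obtain ⟨a, b, rfl⟩ := hw
  set L := a ++ w ++ b with hL
  have hlt : ∀ i : Fin L.length, (i + a.length) % L.length < L.length := fun i =>
    Nat.mod_lt _ (by have := i.isLt; omega)
  -- The numbering starts where `w` begins in the cyclic list, so that the word can be read off from
  -- the copy.
  let f : Fin L.length → V := fun i => L[(i + a.length) % L.length]'(hlt i)
  have hshift : ∀ i j : Fin L.length, (i + a.length) % L.length = (j + a.length) % L.length →
      i = j := by
    intro i j hij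
    have h1 : (i : ℕ) ≡ j [MOD L.length] := Nat.ModEq.add_right_cancel' a.length hij
    have h2 : (i : ℕ) % L.length = j % L.length := h1
    rw [Nat.mod_eq_of_lt i.isLt, Nat.mod_eq_of_lt j.isLt] at h2
    exact Fin.ext h2
  have hinj : Function.Injective f := by
    intro i j hij
    exact hshift i j ((List.Nodup.getElem_inj_iff hn).1 hij)
  have hstep : ∀ (i j : Fin L.length) (t : ℕ), i ≠ j → t ≤ k → (j : ℕ) = (i + t) % L.length →
      G.Adj (f i) (f j) := by
    intro i j t hij ht hj
    have e1 : ((i + a.length) % L.length + t) % L.length = (j + a.length) % L.length := by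
      rw [hj, Nat.mod_add_mod, Nat.mod_add_mod]
      congr 1
      ring
    have := h.adj (hlt i) ht (by
      rw [e1]
      intro hh
      exact hij (hshift j i hh).symm)
    simp only [f]
    convert this using 2
    exact e1.symm
  refine ⟨⟨⟨f, ?_⟩, hinj⟩, ?_⟩
  · intro i j hij
    obtain ⟨t, ht, h1 | h1⟩ := cycleGraph_kthPower_adj hij
    · exact hstep i j t hij.1 ht h1
    · exact (hstep j i t hij.1.symm ht h1).symm
  · intro i hi hin
    change f ⟨i, hin⟩ = w[i]
    have hlen : i + a.length < L.length := by
      rw [hL, List.length_append, List.length_append]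
      omega
    have e1 : (i + a.length) % L.length = i + a.length := Nat.mod_eq_of_lt hlen
    simp only [f, e1]
    simp only [hL]
    rw [List.getElem_append_left (by rw [List.length_append]; omega),
      List.getElem_append_right (by omega)]
    simp

lemma card_le_labelledCopyCount_of_injective {α V W : Type*} [Fintype V] [Fintype W]
    {G : SimpleGraph V} {H : SimpleGraph W} (F : Finset α) (f : F → SimpleGraph.Copy H G)
    (hf : Function.Injective f) : F.card ≤ G.labelledCopyCount H := by
  classical
  have h2 := Nat.card_le_card_of_injective f hf
  rw [Nat.card_eq_fintype_card, Fintype.card_coe] at h2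
  rwa [SimpleGraph.labelledCopyCount, Fintype.card_eq_nat_card]

/-- Words of the same length that are infixes of powers of Hamilton cycles give distinct labelled
copies. -/
lemma card_le_labelledCopyCount [Fintype V] {T : ℕ} (hT : T ≤ Fintype.card V)
    (F : Finset (List V)) (hF : ∀ z ∈ F, z.length = T ∧ ∃ L : List V, L.Nodup ∧
      L.toFinset = univ ∧ CycPath G k L ∧ z.reverse <:+: L) :
    F.card ≤ G.labelledCopyCount ((SimpleGraph.cycleGraph (Fintype.card V)).kthPower k) := by
  have h1 : ∀ z : F, ∃ f : SimpleGraph.Copy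
      ((SimpleGraph.cycleGraph (Fintype.card V)).kthPower k) G,
      ∀ (i : ℕ) (hi : i < z.1.reverse.length) (hin : i < Fintype.card V),
        f ⟨i, hin⟩ = z.1.reverse[i] := by
    intro z
    obtain ⟨-, L, h1, h2, h3, h4⟩ := hF z.1 z.2
    refine h3.exists_copy h1 ?_ h4
    rw [← List.toFinset_card_of_nodup h1, h2, card_univ]
  choose f hf using h1
  have hinj : Function.Injective f := by
    intro z z' hzz
    have hl := (hF z.1 z.2).1
    have hl' := (hF z'.1 z'.2).1
    refine Subtype.ext (List.reverse_injective (List.ext_getElem (by simp [hl, hl']) ?_))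
    intro i hi hi'
    have hin : i < Fintype.card V := by
      rw [List.length_reverse, hl] at hi
      omega
    rw [← hf z i hi hin, ← hf z' i hi' hin, hzz]
  exact card_le_labelledCopyCount_of_injective F f hinj

end

end PowHam

/-! ### From pseudorandomness to regularity -/

namespace PowHam

open Finset

section

variable {V : Type*} [DecidableEq V] {G : SimpleGraph V} [DecidableRel G.Adj]

lemma card_interedges_eq_sum (X Y : Finset V) :
    (G.interedges X Y).card = ∑ v ∈ X, (nb G [v] Y).card := by
  have h : G.interedges X Y = X.biUnion fun v => (nb G [v] Y).image fun w => (v, w) := by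
    ext ⟨a, b⟩
    simp only [SimpleGraph.mem_interedges_iff, mem_biUnion, mem_image, mem_nb_one, Prod.mk.injEq]
    constructor
    · rintro ⟨h1, h2, h3⟩
      exact ⟨a, h1, b, ⟨h2, h3⟩, rfl, rfl⟩
    · rintro ⟨v, h1, w, ⟨h2, h3⟩, rfl, rfl⟩
      exact ⟨h1, h2, h3⟩
  rw [h, card_biUnion]
  · refine sum_congr rfl fun v _ => card_image_of_injective _ fun a b hab => (Prod.mk.inj hab).2
  · intro a _ b _ hab
    rw [Function.onFun, disjoint_left]
    rintro ⟨x, y⟩ h1 h2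
    obtain ⟨_, _, h1⟩ := mem_image.1 h1
    obtain ⟨_, _, h2⟩ := mem_image.1 h2
    exact hab ((Prod.mk.inj h1).1.trans (Prod.mk.inj h2).1.symm)

/-- The edge density between disjoint sets of sizes at least `x` and `y` is within a factor
`1 ± ε` of `p`. -/
def Dense (G : SimpleGraph V) [DecidableRel G.Adj] (ε p x y : ℝ) : Prop :=
  ∀ X Y : Finset V, Disjoint X Y → x ≤ X.card → y ≤ Y.card →
    |∑ v ∈ X, ((nb G [v] Y).card : ℝ) - p * X.card * Y.card| < ε * p * X.card * Y.card

lemma Dense.symm {ε p x y : ℝ} (h : Dense G ε p x y) : Dense G ε p y x := by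
  intro X Y hXY hX hY
  have h1 := h Y X hXY.symm hY hX
  have h2 : ∑ v ∈ Y, ((nb G [v] X).card : ℝ) = ∑ v ∈ X, ((nb G [v] Y).card : ℝ) := by
    have h3 := sum_card_bipartiteAbove_eq_sum_card_bipartiteBelow (s := Y) (t := X) G.Adj
    have h4 : ∀ v, bipartiteAbove G.Adj X v = nb G [v] X := fun v => by
      ext u; rw [bipartiteAbove, mem_filter, mem_nb_one]
    have h5 : ∀ v, bipartiteBelow G.Adj Y v = nb G [v] Y := fun v => by
      ext u; rw [bipartiteBelow, mem_filter, mem_nb_one, G.adj_comm]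
    simp only [h4, h5] at h3
    exact_mod_cast h3
  rw [h2] at h1
  convert h1 using 1 <;> ring_nf

lemma Dense.mono {ε p x y x' y' : ℝ} (h : Dense G ε p x y) (hx : x ≤ x') (hy : y ≤ y') :
    Dense G ε p x' y' := fun X Y hXY hX hY => h X Y hXY (hx.trans hX) (hy.trans hY)

lemma dense_of_isPseudorandom [Fintype V] {ε p : ℝ} {a b : ℕ} (h : G.IsPseudorandom ε p a b) :
    Dense G ε p (ε * p ^ a * Fintype.card V) (ε * p ^ b * Fintype.card V) := by
  intro X Y hXY hX hY
  have := h X Y hXY hX hY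
  rwa [card_interedges_eq_sum, Nat.cast_sum] at this

lemma Dense.exists_ge {ε p x y : ℝ} (h : Dense G ε p x y) {X Y : Finset V} (hXY : Disjoint X Y)
    (hX : x ≤ X.card) (hY : y ≤ Y.card) : ∃ v ∈ X, (1 - ε) * p * Y.card ≤ (nb G [v] Y).card := by
  by_contra hno
  push Not at hno
  have h1 := (abs_lt.1 (h X Y hXY hX hY)).1
  have h2 : ∑ v ∈ X, ((nb G [v] Y).card : ℝ) ≤ X.card * ((1 - ε) * p * Y.card) := by
    rw [← nsmul_eq_mul]
    exact sum_le_card_nsmul _ _ _ fun v hv => (hno v hv).le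
  linarith

lemma Dense.exists_le {ε p x y : ℝ} (h : Dense G ε p x y) {X Y : Finset V} (hXY : Disjoint X Y)
    (hX : x ≤ X.card) (hY : y ≤ Y.card) : ∃ v ∈ X, (nb G [v] Y).card ≤ (1 + ε) * p * Y.card := by
  by_contra hno
  push Not at hno
  have h1 := (abs_lt.1 (h X Y hXY hX hY)).2
  have h2 : X.card * ((1 + ε) * p * Y.card) ≤ ∑ v ∈ X, ((nb G [v] Y).card : ℝ) := by
    rw [← nsmul_eq_mul]
    exact card_nsmul_le_sum _ _ _ fun v hv => (hno v hv).le
  linarith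

/-- Dense pairs at scale `(x, y)` give lower regularity at a larger scale, without
disjointness. -/
lemma Dense.rgL {ε p η x y x' y' : ℝ} (h : Dense G ε p x y) (hp : 0 < p)
    (hεη : ε ≤ η / 2) (hη1 : η ≤ 1) (hx0 : 1 / 2 ≤ x) (hη0 : 0 < η)
    (hx : 12 * x ≤ η * x') (hy : 2 * y ≤ y') : RgL G p η x' y' := by
  intro X Y hX hY
  have hx' : 12 * x ≤ x' := by
    have : η * x' ≤ x' := by
      refine mul_le_of_le_one_left ?_ hη1
      by_contra hneg
      have : η * x' ≤ 0 := mul_nonpos_of_nonneg_of_nonpos hη0.le (by linarith)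
      linarith
    linarith
  have hX0 : (X.card : ℝ) ≤ (X \ Y).card + (X ∩ Y).card := by
    exact_mod_cast (card_sdiff_add_card_inter X Y).ge
  rcases le_or_gt ((X.card : ℝ) / 2) ((X \ Y).card) with hc | hc
  · by_cases hy0 : y ≤ Y.card
    · obtain ⟨v, hv, h1⟩ := h.exists_ge sdiff_disjoint (by linarith) hy0
      refine ⟨v, (mem_sdiff.1 hv).1, le_trans ?_ h1⟩
      have : 0 ≤ p * Y.card := by positivity
      nlinarith
    · exfalso
      have : (0 : ℝ) ≤ Y.card := by positivity
      linarith
  -- If `X` lies mostly inside `Y`, a subset of minimal size is carved out of the intersection and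
  -- removed from `Y`, which costs at most a share `η / 2` of `Y`.
  · obtain ⟨X', hX', hX'c⟩ := exists_subset_card_eq (s := X ∩ Y) (n := ⌈x⌉₊) (by
      rw [Nat.ceil_le]; linarith)
    have hceil : (⌈x⌉₊ : ℝ) ≤ 3 * x := by
      have := Nat.ceil_lt_add_one (show 0 ≤ x by linarith)
      linarith
    have hYX : (Y.card : ℝ) - 3 * x ≤ (Y \ X').card := by
      have h1 := le_card_sdiff X' Y
      have h2 : Y.card ≤ (Y \ X').card + X'.card := by omega
      have h3 : (Y.card : ℝ) ≤ (Y \ X').card + X'.card := by exact_mod_cast h2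
      rw [hX'c] at h3
      linarith
    have hYc : (X.card : ℝ) / 2 ≤ Y.card := by
      have h1 : ((X ∩ Y).card : ℝ) ≤ Y.card := by exact_mod_cast card_le_card inter_subset_right
      linarith
    have hYη : 3 * x ≤ η / 2 * Y.card := by
      have := mul_le_mul_of_nonneg_left hYc hη0.le
      have := mul_le_mul_of_nonneg_left hX hη0.le
      linarith
    have hYY : (1 - η / 2) * Y.card ≤ (Y \ X').card := by linarith
    obtain ⟨v, hv, h1⟩ := h.exists_ge (X := X') (Y := Y \ X') disjoint_sdiff
      (by rw [hX'c]; exact Nat.le_ceil x) (by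
        have : η / 2 * Y.card ≤ 1 / 2 * Y.card :=
          mul_le_mul_of_nonneg_right (by linarith) (by positivity)
        have : (0 : ℝ) ≤ Y.card := by positivity
        linarith)
    refine ⟨v, (mem_inter.1 (hX' hv)).1, ?_⟩
    have h2 : ((nb G [v] (Y \ X')).card : ℝ) ≤ (nb G [v] Y).card := by
      exact_mod_cast card_le_card (nb_mono _ sdiff_subset)
    refine le_trans ?_ (h1.trans h2)
    have h3 := mul_le_mul_of_nonneg_left hYY (mul_nonneg (by linarith : 0 ≤ 1 - ε) hp.le)
    refine le_trans ?_ h3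
    have h4 : (1 - η) ≤ (1 - ε) * (1 - η / 2) := by nlinarith
    have := mul_le_mul_of_nonneg_right h4 (show 0 ≤ p * Y.card by positivity)
    linarith

/-- The density is controlled only for large targets, so a small `Y` is first enlarged to `⌈y'⌉`
elements disjoint from `X'`; the factor `2` covers both the rounding and `ε`. -/
lemma Dense.rgUp [Fintype V] {ε p x y x' y' : ℝ} (h : Dense G ε p x y) (hp : 0 < p)
    (hε : ε ≤ 1 / 4) (hx0 : 1 / 2 ≤ x) (hx : 3 * x ≤ x')
    (hxn : 12 * x ≤ Fintype.card V) (hy : y ≤ y') (hy4 : 4 ≤ y')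
    (hyn : y' ≤ Fintype.card V / 4) : RgUp G p x' y' := by
  intro X Y hXY hX hY
  have hceil : (⌈x⌉₊ : ℝ) ≤ 3 * x := by
    have := Nat.ceil_lt_add_one (show 0 ≤ x by linarith)
    linarith
  obtain ⟨X', hX', hX'c⟩ := exists_subset_card_eq (s := X) (n := ⌈x⌉₊) (by
    have : (⌈x⌉₊ : ℝ) ≤ X.card := by linarith
    exact_mod_cast this)
  have hyc := Nat.ceil_lt_add_one (show 0 ≤ y' by linarith)
  have hYX : Y ⊆ univ \ X' := fun v hv => mem_sdiff.2 ⟨mem_univ _, fun hv' =>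
    disjoint_left.1 hXY (hX' hv') hv⟩
  obtain ⟨Y', hYY', hY'X, hY'c⟩ := exists_subsuperset_card_eq hYX (n := ⌈y'⌉₊) (by
      have : (Y.card : ℝ) ≤ ⌈y'⌉₊ := hY.trans (Nat.le_ceil _)
      exact_mod_cast this) (by
      have h1 : ((univ \ X').card : ℝ) = Fintype.card V - ⌈x⌉₊ := by
        rw [cast_card_sdiff (subset_univ _), card_univ, hX'c]
      have : (⌈y'⌉₊ : ℝ) ≤ (univ \ X').card := by rw [h1]; linarith
      exact_mod_cast this)
  obtain ⟨v, hv, h1⟩ := h.exists_le (X := X') (Y := Y')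
    (disjoint_of_subset_right hY'X disjoint_sdiff) (by rw [hX'c]; exact Nat.le_ceil x) (by
      rw [hY'c]; exact hy.trans (Nat.le_ceil _))
  refine ⟨v, hX' hv, ?_⟩
  have h2 : ((nb G [v] Y).card : ℝ) ≤ (nb G [v] Y').card := by
    exact_mod_cast card_le_card (nb_mono _ hYY')
  refine h2.trans (h1.trans ?_)
  rw [hY'c]
  have h3 : (1 + ε) * ⌈y'⌉₊ ≤ 2 * y' := by
    have : (1 + ε) * ⌈y'⌉₊ ≤ (5 / 4) * (5 / 4 * y') :=
      mul_le_mul (by linarith) (by linarith) (by positivity) (by norm_num)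
    linarith
  have := mul_le_mul_of_nonneg_left h3 hp.le
  linarith

/-- Pseudorandom graphs are complete unless the pseudorandomness only concerns sets with more than
one vertex. -/
lemma Dense.complete_or [Fintype V] {ε p : ℝ} {a b : ℕ}
    (h : Dense G ε p (ε * p ^ a * Fintype.card V) (ε * p ^ b * Fintype.card V)) (hp : 0 < p)
    (hp1 : p < 1) (hε0 : 0 < ε) (hε : ε ≤ 1 / 8) (hεb : b * ε ≤ 1 / 2)
    (hn : 2 ≤ Fintype.card V) :
    (∀ x y, x ≠ y → G.Adj x y) ∨ 1 / 2 ≤ ε * p ^ b * Fintype.card V := by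
  set n : ℝ := (Fintype.card V : ℝ) with hnn
  have hn2 : (2 : ℝ) ≤ n := by rw [hnn]; exact_mod_cast hn
  by_contra hno
  push Not at hno
  obtain ⟨⟨x, y, hxy, hadj⟩, hlt⟩ := hno
  have hεp : 0 < (1 - ε) * p := mul_pos (by linarith) hp
  -- One vertex already counts as a large set on the `b` side. If it does so on the other side too,
  -- a single non-adjacent pair contradicts positive density. Otherwise `x` has few non-neighbours,
  -- and the full density between `x` and its neighbourhood forces `p ≥ 1 - ε`; then `p ^ b ≥ 1 /
  -- 2`, against the smallness of `ε * p ^ b * n`.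
  rcases le_or_gt (ε * p ^ a * n) 1 with h1 | h1
  · obtain ⟨v, hv, h2⟩ := h.exists_ge (X := {x}) (Y := {y}) (by simpa using hxy)
      (by simpa using h1) (by rw [card_singleton]; push_cast; linarith)
    rw [mem_singleton] at hv
    subst hv
    have : nb G [v] {y} = ∅ := by
      rw [eq_empty_iff_forall_notMem]
      intro u hu
      rw [mem_nb_one, mem_singleton] at hu
      exact hadj (hu.1 ▸ hu.2)
    rw [this, card_singleton, card_empty] at h2
    push_cast at h2
    linarith
  · have hpa : p ^ a ≤ 1 := pow_le_one₀ hp.le hp1.le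
    have hεn : ε * p ^ a * n ≤ ε * n := by
      have := mul_le_mul_of_nonneg_left hpa hε0.le
      exact mul_le_mul_of_nonneg_right (by linarith) (by linarith)
    -- the non-neighbours of `x`
    set A := univ.filter fun v => ¬ G.Adj x v with hA
    have hAc : (A.card : ℝ) ≤ ε * n + 1 := by
      by_contra hc
      rw [not_le] at hc
      have h3 : ((A.erase x).card : ℝ) = A.card - 1 := by
        rw [card_erase_of_mem (by simp [hA]), Nat.cast_sub (card_pos.2 ⟨x, by simp [hA]⟩)]
        simp
      obtain ⟨v, hv, h2⟩ := h.symm.exists_ge (X := {x}) (Y := A.erase x) (by simp)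
        (by rw [card_singleton]; push_cast; linarith) (by rw [h3]; linarith)
      rw [mem_singleton] at hv
      subst hv
      have : nb G [v] (A.erase v) = ∅ := by
        rw [eq_empty_iff_forall_notMem]
        intro u hu
        rw [mem_nb_one, mem_erase, hA, mem_filter] at hu
        exact hu.1.2.2 hu.2
      rw [this, card_empty, h3] at h2
      have h4 : 0 < (1 - ε) * p * ((A.card : ℝ) - 1) :=
        mul_pos hεp (by nlinarith)
      push_cast at h2
      linarith
    set Bn := univ.filter fun v => G.Adj x v with hB
    have hBc : n - (ε * n + 1) ≤ Bn.card := by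
      have h1 := card_filter_add_card_filter_not (s := (univ : Finset V)) (fun v => G.Adj x v)
      rw [card_univ] at h1
      have h2 : (Bn.card : ℝ) + A.card = n := by rw [hnn]; exact_mod_cast h1
      linarith
    have hεn2 : ε * n ≤ n / 8 := by nlinarith
    have hn8 : 8 ≤ n := by linarith
    obtain ⟨v, hv, h2⟩ := h.symm.exists_le (X := {x}) (Y := Bn) (by simp [hB])
      (by rw [card_singleton]; push_cast; linarith) (by linarith)
    rw [mem_singleton] at hv
    subst hv
    have hBB : nb G [v] Bn = Bn := by
      ext u; rw [mem_nb_one, hB, mem_filter]; tauto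
    rw [hBB] at h2
    have hBpos : (0 : ℝ) < Bn.card := by linarith
    have hp2 : 1 ≤ (1 + ε) * p := by
      by_contra hc
      rw [not_le] at hc
      have := mul_lt_mul_of_pos_right hc hBpos
      linarith
    have hp3 : 1 - ε ≤ p := by nlinarith
    have hpb : 1 / 2 ≤ p ^ b := by
      have h3 := one_add_mul_le_pow (a := -ε) (by linarith) b
      have h4 : (1 + -ε) ^ b ≤ p ^ b := pow_le_pow_left₀ (by linarith) (by linarith) b
      linarith
    have : ε * n * (1 / 2) ≤ ε * n * p ^ b := mul_le_mul_of_nonneg_left hpb (by positivity)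
    linarith

end

end PowHam

/-! ### The count at scale `θ` -/

namespace PowHam

open Finset

section

variable {V : Type*} [DecidableEq V] {G : SimpleGraph V} [DecidableRel G.Adj] [Fintype V]
variable {ε p σ θ η κ β ν : ℝ} {k b C₀ C₁ : ℕ}

lemma Dense.of_adm (hk : 2 ≤ k)
    (h : Dense G ε p (ε * p ^ (k - 1) * Fintype.card V) (ε * p ^ b * Fintype.card V))
    (hp : 0 < p) (hp1 : p ≤ 1) (hε0 : 0 < ε) {u v : ℕ} (huv : Adm k b u v) :
    Dense G ε p (ε * p ^ u * Fintype.card V) (ε * p ^ v * Fintype.card V) := by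
  have hmono : ∀ i j : ℕ, i ≤ j → ε * p ^ j * Fintype.card V ≤ ε * p ^ i * Fintype.card V := by
    intro i j hij
    have := pow_le_pow_of_le_one hp.le hp1 hij
    gcongr
  rcases huv with ⟨h1, h2⟩ | ⟨h1, h2⟩
  · exact h.mono (hmono _ _ (by omega)) (hmono _ _ h2)
  · exact h.symm.mono (hmono _ _ h2) (hmono _ _ (by omega))

lemma Dense.rgL_pow {u v : ℕ}
    (h : Dense G ε p (ε * p ^ u * Fintype.card V) (ε * p ^ v * Fintype.card V))
    (hp : 0 < p) (hη0 : 0 < η) (hη1 : η ≤ 1) (hεη : ε ≤ η / 2)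
    (hu : 1 / 2 ≤ ε * p ^ u * Fintype.card V) (hε0 : 0 < ε)
    (hσ : 24 * (ε * Fintype.card V) ≤ η * σ) : RgL G p η (σ * p ^ u) (σ * p ^ v) := by
  have hσ1 : 24 * (ε * Fintype.card V) ≤ σ := by
    refine hσ.trans (mul_le_of_le_one_left ?_ hη1)
    have : 0 ≤ η * σ := le_trans (by positivity) hσ
    exact nonneg_of_mul_nonneg_right this hη0
  have hεn : 0 ≤ ε * Fintype.card V := by positivity
  refine h.rgL hp hεη hη1 hu hη0 ?_ ?_
  · have := mul_le_mul_of_nonneg_right (show 12 * (ε * Fintype.card V) ≤ η * σ by linarith)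
      (pow_nonneg hp.le u)
    linarith
  · have := mul_le_mul_of_nonneg_right (show 2 * (ε * Fintype.card V) ≤ σ by linarith)
      (pow_nonneg hp.le v)
    linarith

lemma half_le_of_le {i j : ℕ} (hp : 0 < p) (hp1 : p ≤ 1) (hε0 : 0 < ε) (hij : i ≤ j)
    (h : 1 / 2 ≤ ε * p ^ j * Fintype.card V) : 1 / 2 ≤ ε * p ^ i * Fintype.card V := by
  have := pow_le_pow_of_le_one hp.le hp1 hij
  refine h.trans ?_
  gcongr

/-- Pseudorandom graphs are regular at all scales well above that of pseudorandomness. -/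
lemma Dense.reg (hk : 2 ≤ k) (hkb : k ≤ b)
    (h : Dense G ε p (ε * p ^ (k - 1) * Fintype.card V) (ε * p ^ b * Fintype.card V))
    (hp : 0 < p) (hp1 : p ≤ 1) (hε0 : 0 < ε) (hε : ε ≤ 1 / 12)
    (hb : 1 / 2 ≤ ε * p ^ b * Fintype.card V) (hσ : 48 * (ε * Fintype.card V) ≤ σ) :
    Reg G k b p σ (Fintype.card V / 4) := by
  have hn0 : (0 : ℝ) ≤ Fintype.card V := by positivity
  have hεn : 0 ≤ ε * Fintype.card V := by positivity
  have hadm : ∀ u v, Adm k b u v → u ≤ b ∧ v ≤ b := by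
    rintro u v (⟨h1, h2⟩ | ⟨h1, h2⟩) <;> exact ⟨by omega, by omega⟩
  have hle : ∀ i : ℕ, 48 * (ε * p ^ i * Fintype.card V) ≤ σ * p ^ i := fun i => by
    have := mul_le_mul_of_nonneg_right hσ (pow_nonneg hp.le i)
    linarith
  have hσp := hle b
  refine ⟨hp, hp1, ?_, by linarith, hkb, hk, fun u v huv => ?_, fun u v huv y hy hyn => ?_⟩
  · have : 0 < σ * p ^ b := by linarith
    exact pos_of_mul_pos_left this (pow_nonneg hp.le b)
  · exact (h.of_adm hk hp hp1 hε0 huv).rgL_pow hp (by norm_num) (by norm_num) (by linarith)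
      (half_le_of_le hp hp1 hε0 (hadm u v huv).1 hb) hε0 (by linarith)
  · have hu := half_le_of_le hp hp1 hε0 (hadm u v huv).1 hb
    have hv := half_le_of_le hp hp1 hε0 (hadm u v huv).2 hb
    have hu1 := hle u
    have hv1 := hle v
    refine (h.of_adm hk hp hp1 hε0 huv).rgUp hp (by linarith) hu (by linarith) ?_
      (by linarith) (by linarith) hyn
    have h1 : ε * p ^ u ≤ 1 / 12 := by
      have := mul_le_of_le_one_right hε0.le (pow_le_one₀ (n := u) hp.le hp1)
      linarith
    have := mul_le_mul_of_nonneg_right h1 hn0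
    linarith

lemma nb_univ_eq_neighborFinset (v : V) : nb G [v] univ = G.neighborFinset v := by
  ext u
  rw [mem_nb_one, SimpleGraph.mem_neighborFinset]
  simp

lemma prod_ge_factorial {x : ℝ} (hx : 0 ≤ x) (T ℓ : ℕ) :
    x ^ T * T.factorial ≤ ∏ i ∈ range T, (x * (((T + ℓ : ℕ) : ℝ) - i)) := by
  have h1 : (T.factorial : ℝ) = ∏ i ∈ range T, ((T : ℝ) - i) := by
    rw [← Nat.descFactorial_self, Nat.descFactorial_eq_prod_range, Nat.cast_prod]
    refine prod_congr rfl fun i hi => ?_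
    rw [Nat.cast_sub (mem_range.1 hi).le]
  rw [h1, prod_mul_distrib, prod_const, card_range]
  refine mul_le_mul_of_nonneg_left (prod_le_prod ?_ ?_) (pow_nonneg hx T)
  · intro i hi
    have : (i : ℝ) ≤ T := by exact_mod_cast (mem_range.1 hi).le
    linarith
  · intro i _
    push_cast
    have : (0 : ℝ) ≤ ℓ := by positivity
    linarith

/-- The constant bounding, in units of `θ`, the size of the parts of the graph that are not
covered by the freely chosen path. -/
def restBound (k C : ℕ) : ℝ := 130 * 2 ^ k + 2 * C * (4 * 2 ^ k + 2 * C + 1) + 1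

lemma restBound_ge (k C : ℕ) : 130 * 2 ^ k + 1 ≤ restBound k C := by
  have : (0 : ℝ) ≤ 2 * C * (4 * 2 ^ k + 2 * C + 1) := by positivity
  unfold restBound
  linarith

/-- The counting result, in terms of the scale `θ`. -/
lemma exists_card_le (hk : 2 ≤ k) (hkb : k ≤ b)
    (h : Dense G ε p (ε * p ^ (k - 1) * Fintype.card V) (ε * p ^ b * Fintype.card V))
    (hp : 0 < p) (hp1 : p ≤ 1) (hε0 : 0 < ε)
    (hb : 1 / 2 ≤ ε * p ^ b * Fintype.card V)
    (hdeg : ∀ v, β * p * Fintype.card V ≤ (nb G [v] univ).card) (hβ : β ≤ 1 / 2)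
    (hC₁ : 2 * k + 1 ≤ C₁)
    (hconn : ∀ θ, Reg G k b p (κ * (2 * θ)) (Fintype.card V / 4) → 0 < θ →
      4 ^ (k + 1) * θ ≤ Fintype.card V / 4 → Conn G p k C₀ θ)
    (hgad : ∀ σ θ, 48 * (ε * Fintype.card V) ≤ σ → Tool G p k σ θ C₀ C₁ →
      HasGadgets G p k θ C₁ (126 * 2 ^ k * θ))
    (hκ0 : 0 < κ) (hκ : 4 ^ (k + 2) * (C₀ + C₁) * κ ≤ 1) (hκk : 2 * k * κ ≤ ν / 4)
    (hν : 0 < ν) (hν1 : ν ≤ 1) (hη : η = ν / (4 * (k + 1)))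
    (hθ0 : 0 < θ) (hθβ : 8 * θ ≤ β * Fintype.card V) (hθη : θ ≤ 32 * η * Fintype.card V)
    (hθn : 2 * restBound k (C₀ + C₁) * θ ≤ Fintype.card V)
    (hθk : 2 * 4 ^ (k + 1) * θ ≤ Fintype.card V)
    (hεθ : 48 * (ε * Fintype.card V) ≤ η * (κ * θ)) :
    ∃ T ≤ Fintype.card V, (Fintype.card V : ℝ) ≤ T + restBound k (C₀ + C₁) * θ ∧
      ((1 - ν / 2) * p ^ k) ^ T * T.factorial ≤
        (G.labelledCopyCount ((SimpleGraph.cycleGraph (Fintype.card V)).kthPower k) : ℝ) := by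
  set n : ℝ := (Fintype.card V : ℝ) with hn
  set C : ℝ := ((C₀ + C₁ : ℕ) : ℝ) with hC
  have hCC : (C₀ : ℝ) + C₁ = C := by rw [hC]; push_cast; ring
  have hk2 : (2 : ℝ) ≤ k := by exact_mod_cast hk
  have hη0 : 0 < η := by rw [hη]; positivity
  have hην : (k + 1) * η = ν / 4 := by rw [hη]; field_simp
  have hη8 : η ≤ 1 / 8 := by nlinarith
  have hκ1 : κ ≤ 1 / 16 := by nlinarith
  have hκθ : 0 < κ * θ := by positivity
  have hσε : 48 * (ε * n) ≤ κ * θ :=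
    hεθ.trans (mul_le_of_le_one_left hκθ.le (by linarith))
  have hB := restBound_ge k (C₀ + C₁)
  have h2k : (4 : ℝ) ≤ 2 ^ k := by
    calc (4 : ℝ) = 2 ^ 2 := by norm_num
      _ ≤ 2 ^ k := pow_le_pow_right₀ (by norm_num) hk
  have hBθ := mul_le_mul_of_nonneg_right hB hθ0.le
  have h2kθ := mul_le_mul_of_nonneg_right h2k hθ0.le
  have hn0 : 0 < n := by linarith
  have hθn1 : θ ≤ n := by linarith
  have hεη : ε ≤ η / 2 := by
    have h1 : η * (κ * θ) ≤ η * (1 * n) := by gcongr; linarith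
    have h2 : ε * n ≤ η / 2 * n := by
      have : 0 < η * n := by positivity
      linarith
    exact le_of_mul_le_mul_right h2 hn0
  have hR : Reg G k b p (κ * θ) (n / 4) :=
    h.reg hk hkb hp hp1 hε0 (by linarith) hb hσε
  have hT : Tool G p k (κ * θ) θ C₀ C₁ := by
    refine ⟨hk, hp, hp1, hκθ, hθ0, hR.big.trans ?_, ?_, hC₁, hR.lower _ _ (Or.inr ⟨by omega, hkb⟩),
      ?_, hconn _ (by rwa [show κ * (2 * (θ / 2)) = κ * θ by ring]) (by linarith) (by linarith)⟩
    · exact mul_le_mul_of_nonneg_left (pow_le_pow_of_le_one hp.le hp1 hkb) hκθ.le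
    · have := mul_le_mul_of_nonneg_right hκ hθ0.le
      linarith
    · simpa using hR.lower 1 0 (Or.inr ⟨by omega, by omega⟩)
  have hgad := hgad _ _ hσε hT
  have hpow := hT.size_le_pow
  rw [hCC] at hpow
  have hCk : (k : ℝ) ≤ C ∧ 1 ≤ C := by
    rw [hC]
    exact ⟨by exact_mod_cast (by omega : k ≤ C₀ + C₁), by exact_mod_cast (by omega : 1 ≤ C₀ + C₁)⟩
  have hθ1 : 1 ≤ θ := by
    have := mul_le_of_le_one_right hθ0.le (pow_le_one₀ (n := k) hp.le hp1)
    linarith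
  -- The number `ℓ` of leftover vertices, the size `g` of each half of the skippable set and the
  -- size `m` of the part hosting the gadgets are all bounded by constants times `θ`.
  obtain ⟨ℓ, hℓ1, hℓ2⟩ : ∃ ℓ : ℕ, θ ≤ ℓ ∧ (ℓ : ℝ) ≤ 2 * θ :=
    ⟨⌈θ⌉₊, Nat.le_ceil θ, by linarith [Nat.ceil_lt_add_one hθ0.le]⟩
  have hCℓ : C * ℓ ≤ C * (2 * θ) := mul_le_mul_of_nonneg_left hℓ2 (by linarith)
  obtain ⟨g, hg1, hg2⟩ : ∃ g : ℕ, 2 ^ k * (4 * θ) + C * ℓ ≤ g ∧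
      (g : ℝ) ≤ (4 * 2 ^ k + 2 * C + 1) * θ :=
    ⟨⌈2 ^ k * (4 * θ) + C * ℓ⌉₊, Nat.le_ceil _, by
      have := Nat.ceil_lt_add_one (show 0 ≤ 2 ^ k * (4 * θ) + C * ℓ by positivity)
      linarith⟩
  have hCg : C * (2 * g : ℕ) ≤ C * (2 * ((4 * 2 ^ k + 2 * C + 1) * θ)) := by
    push_cast
    exact mul_le_mul_of_nonneg_left (by linarith) (by linarith)
  have hBe : restBound k (C₀ + C₁) * θ = 130 * 2 ^ k * θ +
      C * (2 * ((4 * 2 ^ k + 2 * C + 1) * θ)) + θ := by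
    unfold restBound; rw [← hC]; ring
  obtain ⟨m, hm1, hm2⟩ : ∃ m : ℕ, 126 * 2 ^ k * θ + 2 ^ k * (4 * θ) + C * (2 * g : ℕ) ≤ m ∧
      (m : ℝ) ≤ restBound k (C₀ + C₁) * θ :=
    ⟨⌈126 * 2 ^ k * θ + 2 ^ k * (4 * θ) + C * (2 * g : ℕ)⌉₊, Nat.le_ceil _, by
      have := Nat.ceil_lt_add_one
        (show 0 ≤ 126 * 2 ^ k * θ + 2 ^ k * (4 * θ) + C * (2 * g : ℕ) by positivity)
      rw [hBe]
      linarith⟩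
  have hrest : C * (2 * g : ℕ) + 4 * θ + ℓ ≤ restBound k (C₀ + C₁) * θ := by
    rw [hBe]
    linarith
  -- Bernoulli with `(k + 1) * η = ν / 4`. The gap between `1 - ν / 4` and `μ = 1 - ν / 2` absorbs
  -- the `2 * k * σ` atypical vertices.
  have hbern : 1 - ν / 4 ≤ (1 - η) ^ (k + 1) := by
    have := one_add_mul_le_pow (a := -η) (by linarith) (k + 1)
    push_cast at this
    rw [← sub_eq_add_neg] at this
    linarith
  have hbern' : 1 / 2 ≤ (1 - η) ^ k := by
    have : (1 - η) ^ (k + 1) ≤ (1 - η) ^ k :=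
      pow_le_pow_of_le_one (by linarith) (by linarith) (Nat.le_succ k)
    linarith
  obtain ⟨T, hTn, hTn', F, hF, hFc⟩ := hT.exists_words (μ := 1 - ν / 2) hgad g m ℓ hdeg
    (by have := mul_le_mul_of_nonneg_right hθβ hp.le; linarith)
    (by have := mul_le_mul_of_nonneg_right hβ (show 0 ≤ p * n by positivity); linarith)
    (by rwa [hCC]) (by rwa [hCC])
    (by
      have : (2 : ℝ) * m ≤ n := by linarith
      rw [hn] at this
      exact_mod_cast this)
    (by linarith) hη0.le (by linarith)
    ((h.of_adm hk hp hp1 hε0 (Or.inr ⟨by omega, hkb⟩)).rgL_pow hp hη0 (by linarith) hεη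
      (half_le_of_le hp hp1 hε0 hkb hb) hε0 (by
        have : 0 ≤ ε * n := by positivity
        linarith))
    (by
      rw [mul_pow]
      have h1 : η * (n / 4) * (1 / 2 * p ^ k) ≤ η * (n / 4) * ((1 - η) ^ k * p ^ k) := by gcongr
      have h2 : θ * p ^ k ≤ 32 * η * n * p ^ k := by gcongr
      linarith [hCk.1])
    (by
      have : (0 : ℝ) < ℓ := by linarith
      exact_mod_cast this)
    (by linarith)
    (by
      have h1 := mul_le_mul_of_nonneg_right hbern (show (0 : ℝ) ≤ ℓ by positivity)
      have h2 := mul_le_mul_of_nonneg_right hκk hθ0.le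
      have h3 := mul_le_mul_of_nonneg_left hℓ1 hν.le
      linarith)
    (by
      have h1 := mul_le_mul_of_nonneg_right hbern' (show (0 : ℝ) ≤ ℓ by positivity)
      have h2 := mul_le_mul_of_nonneg_right hκ1 hθ0.le
      linarith)
    (by rw [hCC]; linarith)
  rw [hCC] at hTn'
  refine ⟨T, hTn, by linarith, ?_⟩
  refine (prod_ge_factorial (by have := pow_nonneg hp.le k; exact mul_nonneg (by linarith) this)
    T ℓ).trans (hFc.trans ?_)
  exact_mod_cast card_le_labelledCopyCount hTn F hF

/-- A path missing at most `ν n / (4 log n)` vertices can be completed at no cost in the count. -/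
lemma factorial_bound {n T : ℕ} (hTn : T ≤ n) (hn : 0 < n) (hν : 0 ≤ ν) (hν1 : ν ≤ 1) (hp : 0 ≤ p)
    (hp1 : p ≤ 1) {x : ℝ} (hx : (n : ℝ) ≤ T + x) (hx2 : 2 * x ≤ n)
    (hxl : x * Real.log n ≤ ν / 4 * n) :
    (1 - ν) ^ n * p ^ (k * n) * (n.factorial : ℝ) ≤ ((1 - ν / 2) * p ^ k) ^ T * T.factorial := by
  have hn0 : (0 : ℝ) < n := by exact_mod_cast hn
  have hlog : 0 ≤ Real.log n := Real.log_natCast_nonneg n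
  -- The quotient `n! / T!` is at most `n ^ (n - T) ≤ exp (x * log n) ≤ exp (ν * n / 4)`, and `n ≤ 2
  -- * T`.
  have h1 : (n.factorial : ℝ) ≤ T.factorial * Real.exp (ν / 2) ^ T := by
    have h2 : n.factorial ≤ T.factorial * n ^ (n - T) := by
      have h3 := Nat.factorial_mul_ascFactorial T (n - T)
      rw [Nat.add_sub_cancel' hTn] at h3
      rw [← h3]
      refine Nat.mul_le_mul_left _ ((Nat.ascFactorial_le_pow_add _ _).trans ?_)
      rw [Nat.add_sub_cancel' hTn]
    have h4 : (n : ℝ) ^ (n - T) ≤ Real.exp (ν / 2) ^ T := by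
      rw [← Real.exp_nat_mul, ← Real.exp_log (pow_pos hn0 (n - T)), Real.log_pow,
        Nat.cast_sub hTn]
      refine Real.exp_le_exp.2 ?_
      have h5 := mul_le_mul_of_nonneg_right (show (n : ℝ) - T ≤ x by linarith) hlog
      have h6 := mul_le_mul_of_nonneg_left (show (n : ℝ) ≤ 2 * T by linarith) hν
      linarith
    have h7 : (n.factorial : ℝ) ≤ T.factorial * (n : ℝ) ^ (n - T) := by exact_mod_cast h2
    exact h7.trans (by gcongr)
  -- This amounts to `1 - ν ≤ (1 - ν / 2) ^ 2`, combined with `1 - ν / 2 ≤ exp (-(ν / 2))`.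
  have h2 : (1 - ν) * Real.exp (ν / 2) ≤ 1 - ν / 2 := by
    have h3 : 1 - ν / 2 ≤ Real.exp (-(ν / 2)) := by
      linarith [Real.add_one_le_exp (-(ν / 2))]
    have h4 : (1 - ν) ≤ (1 - ν / 2) * Real.exp (-(ν / 2)) := by
      have := mul_le_mul_of_nonneg_left h3 (show 0 ≤ 1 - ν / 2 by linarith)
      nlinarith
    have h5 := mul_le_mul_of_nonneg_right h4 (Real.exp_pos (ν / 2)).le
    rwa [mul_assoc, ← Real.exp_add, neg_add_cancel, Real.exp_zero, mul_one] at h5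
  have h3 : (1 - ν) ^ n ≤ (1 - ν) ^ T := pow_le_pow_of_le_one (by linarith) (by linarith) hTn
  have h4 : p ^ (k * n) ≤ p ^ (k * T) := pow_le_pow_of_le_one hp hp1 (Nat.mul_le_mul_left k hTn)
  have h5 : (0 : ℝ) ≤ 1 - ν := by linarith
  calc (1 - ν) ^ n * p ^ (k * n) * (n.factorial : ℝ)
      ≤ (1 - ν) ^ T * p ^ (k * T) * (T.factorial * Real.exp (ν / 2) ^ T) := by gcongr
    _ = ((1 - ν) * Real.exp (ν / 2)) ^ T * p ^ (k * T) * T.factorial := by rw [mul_pow]; ring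
    _ ≤ (1 - ν / 2) ^ T * p ^ (k * T) * T.factorial := by
        have : 0 ≤ (1 - ν) * Real.exp (ν / 2) := mul_nonneg h5 (Real.exp_pos _).le
        gcongr
    _ = _ := by rw [mul_pow, pow_mul]

lemma factorial_le_labelledCopyCount (hG : ∀ x y, x ≠ y → G.Adj x y)
    (H : SimpleGraph (Fin (Fintype.card V))) :
    (Fintype.card V).factorial ≤ G.labelledCopyCount H := by
  have h1 : (univ : Finset (Fin (Fintype.card V) ≃ V)).card = (Fintype.card V).factorial := by
    rw [card_univ, Fintype.card_equiv (Fintype.equivFin V).symm, Fintype.card_fin]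
  rw [← h1]
  let f : (Fin (Fintype.card V) ≃ V) → SimpleGraph.Copy H G := fun e =>
    ⟨⟨e, fun h => hG _ _ fun he => h.ne (e.injective he)⟩, e.injective⟩
  refine card_le_labelledCopyCount_of_injective _ (fun e => f e.1) fun e e' he => ?_
  refine Subtype.ext (Equiv.ext fun i => ?_)
  exact DFunLike.congr_fun he i

lemma bound_le_of_complete (hG : ∀ x y, x ≠ y → G.Adj x y) (hν : 0 ≤ ν) (hν1 : ν ≤ 1)
    (hp : 0 ≤ p) (hp1 : p ≤ 1) :
    (1 - ν) ^ Fintype.card V * p ^ (k * Fintype.card V) * ((Fintype.card V).factorial : ℝ) ≤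
      (G.labelledCopyCount
        ((SimpleGraph.cycleGraph (Fintype.card V)).kthPower k) : ℝ) := by
  have h1 : (1 - ν) ^ Fintype.card V ≤ 1 := pow_le_one₀ (by linarith) (by linarith)
  have h2 : p ^ (k * Fintype.card V) ≤ 1 := pow_le_one₀ hp hp1
  have h3 := factorial_le_labelledCopyCount hG
    ((SimpleGraph.cycleGraph (Fintype.card V)).kthPower k)
  refine le_trans ?_ (Nat.cast_le.2 h3)
  exact mul_le_of_le_one_left (by positivity) (mul_le_one₀ h1 (by positivity) h2)

end

end PowHam

/-! ### Choice of constants and conclusion -/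

namespace PowHam

open Finset

/-- Pseudorandomness at the exponents `(k - 1, b)` yields many powers of Hamilton cycles, provided
that paths can be connected and that there are gadgets. -/
lemma exists_const {k b C₀ C₁ : ℕ} (hk : 2 ≤ k) (hkb : k ≤ b) (hbk : b ≤ 2 * k)
    (hC₁ : 2 * k + 1 ≤ C₁) {κ' β ν : ℝ} (hκ' : 0 < κ') (hβ : 0 < β) (hν : 0 < ν) (hν1 : ν ≤ 1) :
    ∃ c : ℝ, 0 < c ∧ ∀ (V : Type u) [Fintype V] [DecidableEq V] (G : SimpleGraph V)
      [DecidableRel G.Adj] (ε p : ℝ), 0 < ε → ε * Real.log (Fintype.card V : ℝ) ^ 2 ≤ c →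
      0 < p → p < 1 → β * p * (Fintype.card V : ℝ) ≤ (G.minDegree : ℝ) →
      G.IsPseudorandom ε p (k - 1) b →
      (∀ σ θ, Reg G k b p σ (Fintype.card V / 4) → 0 < θ → σ ≤ κ' * θ →
        4 ^ (k + 1) * θ ≤ Fintype.card V / 4 → Conn G p k C₀ θ) →
      (∀ σ θ, 48 * (ε * Fintype.card V) ≤ σ → ε ≤ 1 / 12 →
        1 / 2 ≤ ε * p ^ b * Fintype.card V → Tool G p k σ θ C₀ C₁ →
        HasGadgets G p k θ C₁ (126 * 2 ^ k * θ)) →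
      (1 - ν) ^ Fintype.card V * p ^ (k * Fintype.card V) * ((Fintype.card V).factorial : ℝ) ≤
        (G.labelledCopyCount
          ((SimpleGraph.cycleGraph (Fintype.card V)).kthPower k) : ℝ) := by
  have hk2 : (2 : ℝ) ≤ k := by exact_mod_cast hk
  have hbk' : (b : ℝ) ≤ 2 * k := by exact_mod_cast hbk
  set B := restBound k (C₀ + C₁) with hB
  have hB1 : 1 ≤ B := by
    have := restBound_ge k (C₀ + C₁)
    have h2 : (0 : ℝ) ≤ 130 * 2 ^ k := by positivity
    linarith
  set β' := min β (1 / 2) with hβ'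
  have hβ'0 : 0 < β' := lt_min hβ (by norm_num)
  set η := ν / (4 * ((k : ℝ) + 1)) with hη
  have hη0 : 0 < η := by positivity
  have hη1 : η ≤ 1 := by
    rw [hη, div_le_one (by positivity)]
    linarith
  have hC : (0 : ℝ) ≤ C₀ + C₁ := by positivity
  obtain ⟨κ, hκ0, hκ1, hκ2, hκ3⟩ : ∃ κ : ℝ, 0 < κ ∧ 2 * κ ≤ κ' ∧
      4 ^ (k + 2) * (C₀ + C₁) * κ ≤ 1 ∧ 2 * k * κ ≤ ν / 4 := by
    refine ⟨min (κ' / 2) (min (1 / (4 ^ (k + 2) * (C₀ + C₁ + 1))) (ν / 4 / (2 * k))),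
      by positivity, ?_, ?_, ?_⟩
    · linarith [min_le_left (κ' / 2) (min (1 / (4 ^ (k + 2) * ((C₀ : ℝ) + C₁ + 1)))
        (ν / 4 / (2 * k)))]
    · refine (mul_le_mul_of_nonneg_left ((min_le_right _ _).trans (min_le_left _ _))
        (by positivity)).trans ?_
      rw [mul_one_div, div_le_one (by positivity)]
      exact mul_le_mul_of_nonneg_left (by linarith) (by positivity)
    · refine (mul_le_mul_of_nonneg_left ((min_le_right _ _).trans (min_le_right _ _))
        (by positivity)).trans ?_
      rw [mul_div_cancel₀ _ (by positivity)]
  obtain ⟨τ, hτ0, hτβ, hτη, hτB, hτk⟩ : ∃ τ : ℝ, 0 < τ ∧ 16 * τ ≤ β' ∧ τ ≤ η ∧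
      4 * B * τ ≤ ν ∧ 4 * 4 ^ (k + 1) * τ ≤ 1 := by
    refine ⟨min (min (β' / 16) η) (min (ν / (4 * B)) (1 / (4 * 4 ^ (k + 1)))), by positivity,
      ?_, ?_, ?_, ?_⟩
    · have := (min_le_left (min (β' / 16) η) (min (ν / (4 * B)) (1 / (4 * 4 ^ (k + 1))))).trans
        (min_le_left _ _)
      linarith
    · exact (min_le_left _ _).trans (min_le_right _ _)
    · refine (mul_le_mul_of_nonneg_left ((min_le_right _ _).trans (min_le_left _ _))
        (by positivity)).trans ?_
      rw [mul_div_cancel₀ _ (by positivity)]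
    · refine (mul_le_mul_of_nonneg_left ((min_le_right _ _).trans (min_le_right _ _))
        (by positivity)).trans ?_
      rw [mul_div_cancel₀ _ (by positivity)]
  -- Together with `log n ≥ 1 / 2` this gives `ε * log n ≤ η * κ * τ / 48`, which is the condition
  -- `48 * (ε * n) ≤ η * (κ * θ)` for the `θ` chosen below.
  refine ⟨η * κ * τ / 96, by positivity, ?_⟩
  intro V _ _ G _ ε p hε0 hεc hp hp1 hdeg hps hconn hgad
  rcases Nat.lt_or_ge (Fintype.card V) 2 with hn | hn
  · exact bound_le_of_complete (fun x y hxy => absurd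
      (Fintype.card_le_one_iff.1 (by omega) x y) hxy) hν.le hν1 hp.le hp1.le
  set n : ℝ := (Fintype.card V : ℝ) with hnn
  have hn2 : (2 : ℝ) ≤ n := by rw [hnn]; exact_mod_cast hn
  set L := Real.log n with hL
  have hL2 : 1 / 2 ≤ L := by
    have h1 : Real.log 2 ≤ L := Real.log_le_log (by norm_num) hn2
    linarith [Real.log_two_gt_d9]
  have hL0 : 0 < L := by linarith
  have hεL : ε * L ≤ η * κ * τ / 48 := by
    have h1 : ε * L * (1 / 2) ≤ ε * L * L := mul_le_mul_of_nonneg_left hL2 (by positivity)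
    linarith
  have hε1 : ε ≤ η * κ * τ / 24 := by
    have h1 : ε * (1 / 2) ≤ ε * L := mul_le_mul_of_nonneg_left hL2 hε0.le
    linarith
  have hτ1 : τ ≤ 1 := hτη.trans hη1
  have hεκ : ε ≤ κ / 24 := by
    have h1 : η * κ * τ ≤ 1 * κ * 1 := by gcongr
    linarith
  have hkκ : k * κ ≤ 1 / 8 := by linarith
  have hκ16 : κ ≤ 1 / 16 := by nlinarith
  have hεb : b * ε ≤ 1 / 2 := by
    have h1 : b * ε ≤ 2 * k * (κ / 24) := by gcongr
    linarith
  have hD := dense_of_isPseudorandom hps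
  rcases hD.complete_or hp hp1 hε0 (by linarith) hεb hn with hG | hb
  · exact bound_le_of_complete hG hν.le hν1 hp.le hp1.le
  -- With this scale `θ * log n = τ * n`, so omitting a constant multiple of `θ` vertices costs only
  -- a factor exponential in a small multiple of `n`.
  set θ := τ * n / L with hθ
  have hθ0 : 0 < θ := by positivity
  have hθL : θ * L = τ * n := div_mul_cancel₀ _ hL0.ne'
  have hθτ : θ ≤ 2 * τ * n := by
    have h1 : θ * (1 / 2) ≤ θ * L := mul_le_mul_of_nonneg_left hL2 hθ0.le
    linarith
  have hn0 : 0 < n := by linarith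
  have hθn : 2 * B * θ ≤ n := by
    have h1 : 2 * B * θ ≤ 2 * B * (2 * τ * n) := by gcongr
    have h2 := mul_le_mul_of_nonneg_right (hτB.trans hν1) hn0.le
    linarith
  obtain ⟨T, hTn, hT, hTc⟩ := exists_card_le (C₀ := C₀) (C₁ := C₁) (κ := κ) (ν := ν) (η := η)
    (θ := θ) (β := β') hk hkb hD hp hp1.le hε0 hb
    (fun v => by
      rw [nb_univ_eq_neighborFinset, SimpleGraph.card_neighborFinset_eq_degree]
      have h1 : (G.minDegree : ℝ) ≤ G.degree v := by exact_mod_cast G.minDegree_le_degree v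
      refine le_trans ?_ (hdeg.trans h1)
      gcongr
      exact min_le_left _ _)
    (min_le_right _ _) hC₁
    (fun θ hR hθ h4 => hconn _ θ hR hθ (by
      have := mul_le_mul_of_nonneg_right hκ1 hθ.le
      linarith) h4)
    (fun σ θ hσ hT => hgad σ θ hσ (by linarith) hb hT) hκ0 hκ2 hκ3 hν hν1 hη hθ0
    (by
      have := mul_le_mul_of_nonneg_right hτβ hn0.le
      linarith)
    (by
      have := mul_le_mul_of_nonneg_right hτη hn0.le
      have : 0 < η * n := by positivity
      linarith)
    hθn
    (by
      have h1 : 2 * 4 ^ (k + 1) * θ ≤ 2 * 4 ^ (k + 1) * (2 * τ * n) := by gcongr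
      have h2 := mul_le_mul_of_nonneg_right hτk hn0.le
      linarith)
    (by
      have h1 := mul_le_mul_of_nonneg_right hεL hn0.le
      have h2 : 48 * (ε * n) * L ≤ η * (κ * θ) * L := by
        rw [show η * (κ * θ) * L = η * κ * (θ * L) by ring, hθL]
        linarith
      exact le_of_mul_le_mul_right h2 hL0)
  refine le_trans ?_ hTc
  refine factorial_bound hTn (by omega) hν.le hν1 hp.le hp1.le hT (by rw [← hB]; linarith) ?_
  rw [← hB, mul_assoc, ← hnn, ← hL, hθL]
  have := mul_le_mul_of_nonneg_right hτB hn0.le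
  linarith

end PowHam

theorem theorem1p5 (k : ℕ) (hk : 2 ≤ k) (β ν : ℝ) (hβ : 0 < β) (hν : 0 < ν) (hν1 : ν ≤ 1) :
    ∃ c : ℝ, 0 < c ∧
      ∀ (V : Type*) [Fintype V] [DecidableEq V] (G : SimpleGraph V) [DecidableRel G.Adj]
        (ε p : ℝ), 0 < ε →
        ε * Real.log (Fintype.card V : ℝ) ^ 2 ≤ c →
        0 < p → p < 1 →
        β * p * (Fintype.card V : ℝ) ≤ (G.minDegree : ℝ) →
        (k = 2 → G.IsPseudorandom ε p 1 2) →
        (2 < k → G.IsPseudorandom ε p (k - 1) (2 * k - 1) ∧ G.IsPseudorandom ε p k (k + 1)) →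
        (1 - ν) ^ Fintype.card V * p ^ (k * Fintype.card V) * ((Fintype.card V).factorial : ℝ) ≤
          (G.labelledCopyCount
            ((SimpleGraph.cycleGraph (Fintype.card V)).kthPower k) : ℝ) := by
  open PowHam in
  rcases Nat.eq_or_lt_of_le hk with rfl | hk3
  · obtain ⟨κ, hκ, hκc⟩ := exists_connection (leftOK_two (b := 2)) (by decide)
    -- A connection has `6 + 2 + 6 = 14` vertices; `46` leaves room for a gadget, which has at most
    -- `2 * 14 + 13`.
    obtain ⟨c, hc, h⟩ := exists_const (k := 2) (b := 2) (C₀ := 14) (C₁ := 46) le_rfl le_rfl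
      (by norm_num) (by norm_num) hκ hβ hν hν1
    refine ⟨c, hc, fun V _ _ G _ ε p hε0 hεc hp hp1 hdeg hps _ => ?_⟩
    refine h V G ε p hε0 hεc hp hp1 hdeg (hps rfl) ?_ ?_
    · intro σ θ hR hθ hσ hn e s Z he hs hKe hKs hte hts
      obtain ⟨w, h1, h2, h3, h4⟩ := hκc V G p σ _ θ e s Z hR hθ hσ hn he hs hKe hKs hte hts
      exact ⟨w, h1, h2, by omega, by omega, h4⟩
    · intro σ θ hσ hε hb hT
      have hR := (dense_of_isPseudorandom (hps rfl)).reg (k := 2) le_rfl le_rfl hp hp1.le hε0 hε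
        hb hσ
      have h12 := hR.lower 1 2 (Or.inl ⟨le_rfl, le_rfl⟩)
      rw [pow_one] at h12
      have hθ := mul_le_of_le_one_right hT.θ_pos.le (pow_le_one₀ (n := 2) hp.le hp1.le)
      have hs := hT.size_le_pow
      push_cast at hs
      exact fun Z hZ => hT.hasGadgets_two (by norm_num) h12 Z (by linarith)
  · obtain ⟨κ, hκ, hκc⟩ := exists_connection
      (leftOK_of_large (k := k) (b := 2 * k - 1) (by omega)) (fun i => by omega)
    -- A connection has `k + k + k` vertices; covering pieces and gadgets both consist of `2 * k`
    -- vertices and one inserted vertex.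
    obtain ⟨c, hc, h⟩ := exists_const (k := k) (b := 2 * k - 1) (C₀ := k + k + k)
      (C₁ := 2 * k + 1) hk (by omega) (by omega) le_rfl hκ hβ hν hν1
    refine ⟨c, hc, fun V _ _ G _ ε p hε0 hεc hp hp1 hdeg _ hps => ?_⟩
    obtain ⟨hps1, hps2⟩ := hps hk3
    refine h V G ε p hε0 hεc hp hp1 hdeg hps1 ?_ ?_
    · intro σ θ hR hθ hσ hn e s Z he hs hKe hKs hte hts
      obtain ⟨w, h1, h2, h3, h4⟩ := hκc V G p σ _ θ e s Z hR hθ hσ hn he hs hKe hKs hte hts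
      exact ⟨w, h1, h2, by omega, by omega, h4⟩
    · intro σ θ hσ hε hb hT
      have hεn : 0 ≤ ε * Fintype.card V := by positivity
      have hb' := half_le_of_le hp hp1.le hε0 (show k + 1 ≤ 2 * k - 1 by omega) hb
      have hbig : 1 ≤ σ * p ^ (k + 1) := by
        have := mul_le_mul_of_nonneg_right hσ (pow_nonneg hp.le (k + 1))
        linarith
      -- The `(k, k + 1)`-condition, with its sides exchanged, is what the gadgets require;
      -- connections rely on the other condition alone.
      have hR := (dense_of_isPseudorandom hps2).symm.rgL_pow (η := 1 / 2) (σ := σ) hp (by norm_num)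
        (by norm_num) (by linarith) hb' hε0 (by linarith)
      have h2 : 0 ≤ 2 ^ k * θ := mul_nonneg (by positivity) hT.θ_pos.le
      exact fun Z hZ => hT.hasGadgets_of_large hbig hR Z (by linarith)
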